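/- The problem \textsc{$k$-Inversion}, parameterized by $k$, admits an FPT algorithm when the underlying undirected graph of the input digraph is a block graph. In detail: the input consists of a directed graph $D$ on $n$ vertices (loops, opposite arcs and parallel arcs are allowed), given by its adjacency matrix (of arc multiplicities), and an integer $k\ge 0$. The inversion $D\oplus Y$ of $D$ with respect to a vertex set $Y$ is obtained by reversing every arc of $D$ with both endpoints in $Y$; a decycling family of $D$ of size $\ell$ is a tuple $(Y_1,\dots,Y_\ell)$ of vertex sets such that $(\cdots(D\oplus Y_1)\oplus\cdots)\oplus Y_\ell$ has no directed cycle. The question is whether $D$ has a decycling family of size at most $k$. A block graph is an undirected graph, not necessarily connected, in which every block (maximal connected subgraph without a cut vertex) is a clique. The claim is that there are an algorithm (a single program for a unit-cost random access machine with addition and subtraction), a computable function $f$ and a constant $c$ such that, for every $k$ and every $D$ whose underlying undirected simple graph is a block graph, the algorithm answers the question correctly within $f(k)\cdot (n^2+2)^{c}$ steps, where $n^2+2$ is the number of words of the input. -/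

import Mathlib

/-! ### Directed multigraphs, inversions, decycling families -/

/-- A directed graph on the vertex set `V`; loops, opposite arcs and parallel arcs are allowed.
`mult u v` is the number of arcs from `u` to `v`. -/
structure DirGraph (V : Type) where
  mult : V → V → ℕ

namespace DirGraph

variable {V : Type}

/-- There is an arc from `u` to `v`. -/
def Arc (D : DirGraph V) (u v : V) : Prop := 0 < D.mult u v

/-- The inversion `D ⊕ Y`: every arc with both ends in `Y` is reversed. -/
def invert [DecidableEq V] (D : DirGraph V) (Y : Finset V) : DirGraph V where
  mult u v := if u ∈ Y ∧ v ∈ Y then D.mult v u else D.mult u v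

/-- The inversion of `D` with respect to a tuple of vertex sets, applied one after the other. -/
def invertAll [DecidableEq V] (D : DirGraph V) (Ys : List (Finset V)) : DirGraph V :=
  Ys.foldl invert D

/-- `D` has no directed cycle (of any length, including loops and pairs of opposite arcs). -/
def Acyclic (D : DirGraph V) : Prop := ∀ v, ¬ Relation.TransGen D.Arc v v

/-- `Ys` is a decycling family of `D`. -/
def IsDecyclingFamily [DecidableEq V] (D : DirGraph V) (Ys : List (Finset V)) : Prop :=
  (D.invertAll Ys).Acyclic

/-- `inv(D) ≤ k`: some decycling family of `D` has size at most `k`. -/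
def InvLE [DecidableEq V] (D : DirGraph V) (k : ℕ) : Prop :=
  ∃ Ys : List (Finset V), Ys.length ≤ k ∧ D.IsDecyclingFamily Ys

/-- The underlying undirected (simple) graph: distinct vertices are adjacent when there is an arc
between them in some direction. -/
def underlying (D : DirGraph V) : SimpleGraph V := SimpleGraph.fromRel D.Arc

end DirGraph

/-! ### Block graphs -/

/-- The subgraph of `G` induced by `B` is connected (in particular nonempty) and has no cut
vertex. -/
def SimpleGraph.IsNonseparable {V : Type} (G : SimpleGraph V) (B : Set V) : Prop :=
  (G.induce B).Connected ∧ ∀ v ∈ B, (G.induce (B \ {v})).Preconnected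

/-- `B` is (the vertex set of) a block of `G`: a maximal connected subgraph without a cut vertex. -/
def SimpleGraph.IsBlock {V : Type} (G : SimpleGraph V) (B : Set V) : Prop :=
  Maximal G.IsNonseparable B

/-- `G` is a block graph: every block of `G` is a clique. `G` may be disconnected. -/
def SimpleGraph.IsBlockGraph {V : Type} (G : SimpleGraph V) : Prop :=
  ∀ B : Set V, G.IsBlock B → G.IsClique B

/-! ### Random access machines

The unit-cost random access machine with addition and (truncated) subtraction, without
multiplication. A program uses finitely many registers and an unbounded memory with indirect
addressing; control flow is structured. -/

/-- The contents of the registers and of the memory. -/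
structure RamState where
  reg : ℕ → ℕ
  mem : ℕ → ℕ

namespace RamState

/-- Write `a` into register `x`. -/
def setReg (s : RamState) (x a : ℕ) : RamState := ⟨Function.update s.reg x a, s.mem⟩

/-- Write `a` into the memory cell with address `i`. -/
def setMem (s : RamState) (i a : ℕ) : RamState := ⟨s.reg, Function.update s.mem i a⟩

/-- The initial state on the input `w`: cells `0, 1, …, w.length - 1` of the memory hold `w`,
register `0` holds the length of `w`, and everything else is `0`. -/
def initial (w : List ℕ) : RamState where
  reg x := if x = 0 then w.length else 0
  mem i := w.getD i 0

end RamState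

/-- Programs. Registers are named by natural numbers. -/
inductive RamProg where
  /-- `reg x := c` -/
  | const (x c : ℕ)
  /-- `reg x := reg y + reg z` -/
  | add (x y z : ℕ)
  /-- `reg x := reg y - reg z`, truncated at `0` -/
  | sub (x y z : ℕ)
  /-- `reg x := mem (reg y)` -/
  | load (x y : ℕ)
  /-- `mem (reg x) := reg y` -/
  | store (x y : ℕ)
  /-- `p`, then `q` -/
  | seq (p q : RamProg)
  /-- `if reg x ≠ 0 then p else q` -/
  | ifNZ (x : ℕ) (p q : RamProg)
  /-- `while reg x ≠ 0 do p` -/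
  | whileNZ (x : ℕ) (p : RamProg)

namespace RamProg

/-- `Runs p s t s'`: started in state `s`, the program `p` halts in state `s'` after exactly `t`
steps. An assignment, a memory access and a test cost one step each. -/
inductive Runs : RamProg → RamState → ℕ → RamState → Prop
  | const (x c : ℕ) (s : RamState) : Runs (const x c) s 1 (s.setReg x c)
  | add (x y z : ℕ) (s : RamState) : Runs (add x y z) s 1 (s.setReg x (s.reg y + s.reg z))
  | sub (x y z : ℕ) (s : RamState) : Runs (sub x y z) s 1 (s.setReg x (s.reg y - s.reg z))
  | load (x y : ℕ) (s : RamState) : Runs (load x y) s 1 (s.setReg x (s.mem (s.reg y)))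
  | store (x y : ℕ) (s : RamState) : Runs (store x y) s 1 (s.setMem (s.reg x) (s.reg y))
  | seq {p q : RamProg} {s s' s'' : RamState} {t t' : ℕ} :
      Runs p s t s' → Runs q s' t' s'' → Runs (seq p q) s (t + t') s''
  | ifTrue {x : ℕ} {p q : RamProg} {s s' : RamState} {t : ℕ} :
      s.reg x ≠ 0 → Runs p s t s' → Runs (ifNZ x p q) s (t + 1) s'
  | ifFalse {x : ℕ} {p q : RamProg} {s s' : RamState} {t : ℕ} :
      s.reg x = 0 → Runs q s t s' → Runs (ifNZ x p q) s (t + 1) s'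
  | whileDone {x : ℕ} {p : RamProg} {s : RamState} :
      s.reg x = 0 → Runs (whileNZ x p) s 1 s
  | whileStep {x : ℕ} {p : RamProg} {s s' s'' : RamState} {t t' : ℕ} :
      s.reg x ≠ 0 → Runs p s t s' → Runs (whileNZ x p) s' t' s'' →
        Runs (whileNZ x p) s (t + t' + 1) s''

/-- The machine is deterministic: final state and running time are determined by the start. -/
theorem Runs.deterministic {p : RamProg} {s s₁ s₂ : RamState} {t₁ t₂ : ℕ}
    (h₁ : Runs p s t₁ s₁) (h₂ : Runs p s t₂ s₂) : t₁ = t₂ ∧ s₁ = s₂ := by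
  induction h₁ generalizing t₂ s₂ with
  | const | add | sub | load | store => cases h₂; exact ⟨rfl, rfl⟩
  | seq _ _ ih ih' =>
    cases h₂ with
    | seq a b =>
      obtain ⟨rfl, rfl⟩ := ih a
      obtain ⟨rfl, rfl⟩ := ih' b
      exact ⟨rfl, rfl⟩
  | ifTrue hx _ ih =>
    cases h₂ with
    | ifTrue _ a => obtain ⟨rfl, rfl⟩ := ih a; exact ⟨rfl, rfl⟩
    | ifFalse hx' _ => exact absurd hx' hx
  | ifFalse hx _ ih =>
    cases h₂ with
    | ifTrue hx' _ => exact absurd hx hx'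
    | ifFalse _ a => obtain ⟨rfl, rfl⟩ := ih a; exact ⟨rfl, rfl⟩
  | whileDone hx =>
    cases h₂ with
    | whileDone _ => exact ⟨rfl, rfl⟩
    | whileStep hx' _ _ => exact absurd hx hx'
  | whileStep hx _ _ ih ih' =>
    cases h₂ with
    | whileDone hx' => exact absurd hx' hx
    | whileStep _ a b =>
      obtain ⟨rfl, rfl⟩ := ih a
      obtain ⟨rfl, rfl⟩ := ih' b
      exact ⟨rfl, rfl⟩

end RamProg

/-! ### Parameterized problems and fixed-parameter tractability -/

/-- A parameterized decision problem, together with the encoding of its instances as sequences of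
machine words. -/
structure ParamProblem where
  /-- the instances -/
  Inst : Type
  /-- the input that is given to the machine -/
  encode : Inst → List ℕ
  /-- the parameter -/
  param : Inst → ℕ
  /-- the yes-instances -/
  yes : Inst → Prop

/-- `P`, restricted to the instances in `C`, admits an FPT algorithm: a single program decides
every instance `I ∈ C` in at most `f (param I) * |I| ^ c` steps, where `f` is a computable function,
`c` is a constant and `|I|` is the number of words of the input. The answer (`1` for yes, `0` for
no) is left in register `0`. -/
def ParamProblem.FPTOn (P : ParamProblem) (C : Set P.Inst) : Prop :=
  ∃ (p : RamProg) (f : ℕ → ℕ) (c : ℕ), Computable f ∧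
    ∀ I ∈ C, ∃ (t : ℕ) (s : RamState),
      p.Runs (RamState.initial (P.encode I)) t s ∧
      t ≤ f (P.param I) * (P.encode I).length ^ c ∧
      (P.yes I → s.reg 0 = 1) ∧ (¬ P.yes I → s.reg 0 = 0)

/-- An instance of `k`-Inversion: a directed graph on the vertices `0, …, n - 1`, and `k`. -/
structure InversionInstance where
  n : ℕ
  D : DirGraph (Fin n)
  k : ℕ

/-- `k`-Inversion parameterized by `k`: decide whether `inv(D) ≤ k`. The input consists of `n`, `k`
and the adjacency matrix of `D`, row by row. -/
def kInversion : ParamProblem where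
  Inst := InversionInstance
  encode I := I.n :: I.k ::
    (List.finRange I.n).flatMap fun u => (List.finRange I.n).map fun v => I.D.mult u v
  param I := I.k
  yes I := I.D.InvLE I.k

/-!
# An FPT algorithm for `k`-Inversion on block graphs

A family of `k` vertex sets gives every vertex `v` a label in `𝔽₂ ^ k`, the vector of its
memberships, coded here as a number below `2 ^ k`. An arc `uv` is reversed by the family if and only
if the labels of `u` and `v` have inner product `1`, so the question is for a labelling whose
reorientation is acyclic. In a block graph a shortest directed cycle of an orientation is a triangle
(`acyclic_of_no_triangle`). Hence, unless there is a loop or a pair of opposite arcs, which no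
inversion destroys, only directed triangles have to be avoided, and each triangle lies in one block
(`DirGraph.invLE_iff_exists_goodOn`).

The blocks hang together in a tree-like way, which makes arc consistency complete. Every vertex
keeps a list of labels, and a label is removed from the list of `p` when it does not extend to a
good labelling, from the lists, of some block that contains `p`. When no label can be removed any
more and no list is empty, good labellings of the blocks are glued along single vertices to a good
labelling of the graph (`exists_goodOn_univ`); the block of an edge consists of its ends and their
common neighbours.

There remains the search in one block, that is, for a labelling of a tournament that makes it
transitive. The vertices are added one by one. If the first `m` vertices are ordered as some labels
of them demand, then the label of a vertex together with the direction of its arc to the next vertex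
determines its arcs to all later vertices (`SortedBy.exists_classes`). So a dynamic program along
this order has to distinguish partial labellings only by their last label and by the set of types of
pairs of positions, where a type consists of the labels, the mutual arcs and the arcs to later
positions. Triangles do not see more than that (`GoodOn.replace_prefix`), and the number of
representatives is bounded in terms of `k` (`card_le_of_not_dominates`, `repBound`). A
representative of the whole labelling yields the order for the next vertex, by sorting with respect
to scores (`GoodOn.sortedBy_of_score`).

The algorithm is written in a small language with bounded loops over variables and two-dimensional
arrays, whose assignments truncate at a bound `N`; by this device every program runs in time
polynomial in `N` (`Cmd.polyBounded_time`). `Cmd.haltsIn_compile` translates it into programs of the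
random access machine. A prelude computes a value `N`, the sum of the input length and the double
exponential `Inversion.bigBound k`, at which no relevant value is truncated. As `N` is at most the
product of the two summands, a polynomial in `N` has the form that fixed-parameter tractability
demands.
-/

set_option linter.unusedSectionVars false

/-! ### Block graphs and directed triangles -/

namespace SimpleGraph

variable {V : Type} {G : SimpleGraph V}

/-- A path together with a further vertex adjacent to both of its ends spans a nonseparable set. -/
theorem isNonseparable_of_isPath {b p w : V} (P : G.Walk p w) (hP : P.IsPath)
    (hb : b ∉ P.support) (hp : G.Adj b p) (hw : G.Adj b w) :
    G.IsNonseparable (insert b {x | x ∈ P.support}) := by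
  classical
  -- in every induced subgraph that misses at most one vertex of the path, all vertices reach `b`
  have key : ∀ S : Set V, b ∈ S → ∀ x ∈ P.support,
      (∃ Q : G.Walk b x, ∀ z ∈ Q.support, z ∈ S) → ∀ (hb : b ∈ S) (hx : x ∈ S),
      (G.induce S).Reachable ⟨b, hb⟩ ⟨x, hx⟩ := by
    rintro S - x - ⟨Q, hQ⟩ hb hx
    exact ⟨Q.induce S hQ⟩
  have pre : ∀ S : Set V, ∀ hbS : b ∈ S,
      (∀ x ∈ S, x ≠ b → x ∈ P.support ∧ ∃ Q : G.Walk b x, ∀ z ∈ Q.support, z ∈ S) →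
      (G.induce S).Preconnected := by
    intro S hbS h
    have hr : ∀ x : S, (G.induce S).Reachable ⟨b, hbS⟩ x := by
      rintro ⟨x, hx⟩
      by_cases hxb : x = b
      · subst hxb; exact Reachable.refl _
      · obtain ⟨hx', hQ⟩ := h x hx hxb
        exact key S hbS x hx' hQ hbS hx
    exact fun x y => (hr x).symm.trans (hr y)
  have left : ∀ x (hx : x ∈ P.support), ∃ Q : G.Walk b x,
      ∀ z ∈ Q.support, z = b ∨ z ∈ (P.takeUntil x hx).support := fun x hx =>
    ⟨(P.takeUntil x hx).cons hp, by simp⟩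
  have right : ∀ x (hx : x ∈ P.support), ∃ Q : G.Walk b x,
      ∀ z ∈ Q.support, z = b ∨ z ∈ (P.dropUntil x hx).support := fun x hx =>
    ⟨(P.dropUntil x hx).reverse.cons hw, by simp⟩
  refine ⟨{ preconnected := pre _ (Set.mem_insert _ _) ?_, nonempty := ⟨⟨b, by simp⟩⟩ }, ?_⟩
  · rintro x (rfl | hx) hxb
    · exact absurd rfl hxb
    · obtain ⟨Q, hQ⟩ := left x hx
      refine ⟨hx, Q, fun z hz => ?_⟩
      rcases hQ z hz with rfl | h
      · simp
      · exact Or.inr (P.support_takeUntil_subset_support hx h)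
  · rintro v hv
    by_cases hvb : v = b
    · subst hvb
      have : (insert v {x | x ∈ P.support} : Set V) \ {v} = {x | x ∈ P.support} := by
        ext x
        simp only [Set.mem_sdiff, Set.mem_insert_iff, Set.mem_ofPred_eq, Set.mem_singleton_iff]
        exact ⟨fun h => h.1.resolve_left h.2, fun h => ⟨Or.inr h, fun e => hb (e ▸ h)⟩⟩
      rw [this]
      exact P.connected_induce_support.preconnected
    · refine pre _ ⟨by simp, fun h => hvb h.symm⟩ ?_
      rintro x ⟨hx, hxv⟩ hxb
      have hx : x ∈ P.support := hx.resolve_left hxb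
      refine ⟨hx, ?_⟩
      by_cases hvl : v ∈ (P.takeUntil x hx).support
      · -- `v` lies before `x` on the path, so it does not lie after `x`
        obtain ⟨Q, hQ⟩ := right x hx
        refine ⟨Q, fun z hz => ?_⟩
        rcases hQ z hz with rfl | h
        · exact ⟨by simp, fun h => hvb h.symm⟩
        · refine ⟨Or.inr (P.support_dropUntil_subset_support hx h), fun hzv => ?_⟩
          have hzv : z = v := hzv
          subst hzv
          have hP' : ((P.takeUntil x hx).append (P.dropUntil x hx)).IsPath := by
            rwa [P.take_spec hx]
          exact hP'.ne_of_mem_support_of_append (fun e => hxv e.symm) hvl h rfl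
      · obtain ⟨Q, hQ⟩ := left x hx
        refine ⟨Q, fun z hz => ?_⟩
        rcases hQ z hz with rfl | h
        · exact ⟨by simp, fun h => hvb h.symm⟩
        · exact ⟨Or.inr (P.support_takeUntil_subset_support hx h),
            fun hzv => hvl ((show z = v from hzv) ▸ h)⟩

/-- The only property of block graphs that is used: two neighbours of `b` that are joined by a
walk avoiding `b` are adjacent. -/
theorem IsBlockGraph.adj_of_walk [Finite V] (hG : G.IsBlockGraph) {b p w : V} (P : G.Walk p w)
    (hb : b ∉ P.support) (hp : G.Adj b p) (hw : G.Adj b w) (hne : p ≠ w) : G.Adj p w := by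
  classical
  have hb' : b ∉ P.bypass.support := fun h => hb (P.support_bypass_subset_support h)
  obtain ⟨B, hle, hB⟩ := Finite.exists_le_maximal
    (isNonseparable_of_isPath P.bypass P.bypass_isPath hb' hp hw)
  exact hG B hB (hle (by simp)) (hle (by simp)) hne

/-- The block that contains the edge `up` of a block graph: the two ends and their common
neighbours. -/
def edgeBlock (G : SimpleGraph V) (u p : V) : Set V :=
  {w | w = p ∨ w = u ∨ (G.Adj w u ∧ G.Adj w p)}

theorem IsBlockGraph.adj_of_adj_adj [Finite V] (hG : G.IsBlockGraph) {a b c d : V}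
    (hab : G.Adj a b) (hca : G.Adj c a) (hcb : G.Adj c b) (hda : G.Adj d a) (hdb : G.Adj d b)
    (hcd : c ≠ d) : G.Adj c d :=
  hG.adj_of_walk (.cons hcb (.cons hdb.symm .nil))
    (by simpa using ⟨hca.ne', hab.ne, hda.ne'⟩) hca.symm hda.symm hcd

theorem IsBlockGraph.isClique_edgeBlock [Finite V] (hG : G.IsBlockGraph) {u p : V}
    (hup : G.Adj u p) : G.IsClique (G.edgeBlock u p) := by
  rintro a (rfl | rfl | ⟨ha, ha'⟩) b (rfl | rfl | ⟨hb, hb'⟩) hab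
  all_goals first
    | exact absurd rfl hab
    | assumption
    | exact SimpleGraph.Adj.symm ‹_›
    | exact hG.adj_of_adj_adj hup ha ha' hb hb' hab

/-- A common neighbour of two vertices of a block lies in the block. -/
theorem IsBlockGraph.mem_edgeBlock [Finite V] (hG : G.IsBlockGraph) {u p a b c : V}
    (hup : G.Adj u p) (ha : a ∈ G.edgeBlock u p) (hb : b ∈ G.edgeBlock u p)
    (hab : G.Adj a b) (hca : G.Adj c a) (hcb : G.Adj c b) : c ∈ G.edgeBlock u p := by
  have hcl := hG.isClique_edgeBlock hup
  have key : ∀ x ∈ G.edgeBlock u p, c ≠ x → G.Adj c x := by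
    intro x hx hcx
    by_cases hxa : x = a
    · exact hxa ▸ hca
    by_cases hxb : x = b
    · exact hxb ▸ hcb
    exact hG.adj_of_adj_adj hab hca hcb (hcl hx ha hxa) (hcl hx hb hxb) hcx
  by_cases hcp : c = p
  · exact Or.inl hcp
  by_cases hcu : c = u
  · exact Or.inr (Or.inl hcu)
  exact Or.inr (Or.inr ⟨key u (Or.inr (Or.inl rfl)) hcu, key p (Or.inl rfl) hcp⟩)

/-- A chain of adjacent vertices is the support of a walk. -/
theorem exists_walk_of_chain (f : ℕ → V) (a n : ℕ)
    (h : ∀ i, a ≤ i → i < a + n → G.Adj (f i) (f (i + 1))) :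
    ∃ P : G.Walk (f a) (f (a + n)), ∀ x ∈ P.support, ∃ i, a ≤ i ∧ i ≤ a + n ∧ x = f i := by
  induction n with
  | zero => exact ⟨.nil, fun x hx => ⟨a, le_rfl, le_rfl, by simpa using hx⟩⟩
  | succ n ih =>
    obtain ⟨P, hP⟩ := ih fun i hi hi' => h i hi (by omega)
    refine ⟨P.concat (h (a + n) (by omega) (by omega)), fun x hx => ?_⟩
    rw [Walk.support_concat, List.mem_append] at hx
    rcases hx with hx | hx
    · obtain ⟨i, h1, h2, h3⟩ := hP x hx
      exact ⟨i, h1, by omega, h3⟩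
    · exact ⟨a + n + 1, by omega, by omega, by simpa [add_assoc] using hx⟩

end SimpleGraph

/-- A directed walk, as a sequence of vertices. -/
theorem exists_chain_of_transGen {V : Type} {R : V → V → Prop} {u v : V}
    (h : Relation.TransGen R u v) :
    ∃ (n : ℕ) (f : ℕ → V), 0 < n ∧ f 0 = u ∧ f n = v ∧ ∀ i < n, R (f i) (f (i + 1)) := by
  induction h with
  | @single w h =>
    exact ⟨1, fun i => if i = 0 then u else w, by simp, by simp, by simp, by simpa using h⟩
  | @tail w x _ hwx ih =>
    obtain ⟨n, f, hn, h0, h1, hf⟩ := ih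
    refine ⟨n + 1, fun i => if i ≤ n then f i else x, by simp, by simp [h0], by simp,
      fun i hi => ?_⟩
    rcases Nat.lt_succ_iff_lt_or_eq.1 hi with hi | rfl
    · simpa [hi.le, Nat.succ_le_of_lt hi] using hf i hi
    · simpa [h1] using hwx

/-- An orientation of a block graph without directed triangles has no directed cycle: a shortest
one has a chord, which cuts off a shorter cycle or a triangle. -/
theorem acyclic_of_no_triangle {V : Type} [Finite V] {G : SimpleGraph V} (hG : G.IsBlockGraph)
    {R : V → V → Prop} (hR : ∀ u v, R u v → G.Adj u v) (hG' : ∀ u v, G.Adj u v → R u v ∨ R v u)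
    (hasymm : ∀ u v, R u v → ¬ R v u) (htri : ∀ u v w, R u v → R v w → ¬ R w u) (v : V) :
    ¬ Relation.TransGen R v v := by
  intro hv
  classical
  have hex : ∃ n, 0 < n ∧ ∃ f : ℕ → V, f n = f 0 ∧ ∀ i < n, R (f i) (f (i + 1)) := by
    obtain ⟨n, f, hn, h0, h1, hf⟩ := exists_chain_of_transGen hv
    exact ⟨n, hn, f, h1.trans h0.symm, hf⟩
  obtain ⟨hn, f, hf0, hf⟩ := Nat.find_spec hex
  have hmin := fun m hm => Nat.find_min (m := m) hex hm
  set n := Nat.find hex with hn_def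
  have h1 : n ≠ 1 := by
    intro h
    have := hf 0 (by omega)
    rw [h] at hf0
    rw [zero_add, hf0] at this
    exact (hR _ _ this).ne rfl
  have h2 : n ≠ 2 := by
    intro h
    have a := hf 0 (by omega)
    have b := hf 1 (by omega)
    rw [h] at hf0
    simp only [zero_add, Nat.reduceAdd, hf0] at a b
    exact hasymm _ _ a b
  have hlast : R (f (n - 1)) (f 0) := by
    have := hf (n - 1) (by omega)
    rwa [Nat.sub_add_cancel hn, hf0] at this
  have hfirst : R (f 0) (f 1) := hf 0 hn
  -- otherwise the closed walk from `f 1` to `f (n - 1)` would be shorter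
  have hne : f 1 ≠ f (n - 1) := by
    intro h
    exact hmin (n - 2) (by omega) ⟨by omega, fun i => f (1 + i),
      by simpa [show 1 + (n - 2) = n - 1 by omega] using h.symm,
      fun i hi => hf (1 + i) (by omega)⟩
  have hadj : G.Adj (f 1) (f (n - 1)) := by
    have hP := SimpleGraph.exists_walk_of_chain (G := G) f 1 (n - 2)
      fun i _ hi => hR _ _ (hf i (by omega))
    rw [show 1 + (n - 2) = n - 1 by omega] at hP
    obtain ⟨P, hP⟩ := hP
    refine hG.adj_of_walk P (fun h => ?_) (hR _ _ hfirst) (hR _ _ hlast).symm hne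
    obtain ⟨i, hi, hi', he⟩ := hP _ h
    exact hmin i (by omega) ⟨by omega, f, he.symm, fun j hj => hf j (by omega)⟩
  rcases hG' _ _ hadj with h | h
  · exact htri _ _ _ hfirst h hlast
  · refine hmin (n - 1) (by omega) ⟨by omega, fun i => if i = n - 2 + 1 then f 1 else f (1 + i),
      by simp [show n - 1 = n - 2 + 1 by omega], fun i hi => ?_⟩
    have hi' : i ≠ n - 2 + 1 := by omega
    by_cases hi2 : i + 1 = n - 2 + 1
    · dsimp only
      rw [if_neg hi', if_pos hi2, show 1 + i = n - 1 by omega]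
      exact h
    · dsimp only
      rw [if_neg hi', if_neg hi2]
      exact hf (1 + i) (by omega)

/-! ### Arc-consistent lists on a block graph -/

/-- The arc relation after an inversion that is described by labels `y`: an arc is reversed when
`d` holds between the labels of its ends. -/
def Reorient {V Λ : Type} (T : V → V → Prop) (d : Λ → Λ → Prop) (y : V → Λ) (a b : V) : Prop :=
  (d (y a) (y b) ∧ T b a) ∨ (¬ d (y a) (y b) ∧ T a b)

theorem reorient_congr {V Λ : Type} {T : V → V → Prop} {d : Λ → Λ → Prop} {y y' : V → Λ} {a b : V}
    (ha : y a = y' a) (hb : y b = y' b) : Reorient T d y a b ↔ Reorient T d y' a b := by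
  simp [Reorient, ha, hb]

/-- On the vertex set `S`, the labels `y` come from the lists `L` and leave no directed
triangle. -/
structure GoodOn {V Λ : Type} (T : V → V → Prop) (d : Λ → Λ → Prop) (L : V → Λ → Prop)
    (S : Set V) (y : V → Λ) : Prop where
  mem : ∀ v ∈ S, L v (y v)
  no_triangle : ∀ a ∈ S, ∀ b ∈ S, ∀ c ∈ S,
    ¬ (Reorient T d y a b ∧ Reorient T d y b c ∧ Reorient T d y c a)

theorem GoodOn.mono {V Λ : Type} {T : V → V → Prop} {d : Λ → Λ → Prop} {L : V → Λ → Prop}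
    {S S' : Set V} {y : V → Λ} (h : GoodOn T d L S y) (hS : S' ⊆ S) : GoodOn T d L S' y :=
  ⟨fun v hv => h.mem v (hS hv), fun a ha b hb c hc => h.no_triangle a (hS ha) b (hS hb) c (hS hc)⟩

theorem GoodOn.congr {V Λ : Type} {T : V → V → Prop} {d : Λ → Λ → Prop} {L : V → Λ → Prop}
    {S : Set V} {y y' : V → Λ} (h : GoodOn T d L S y) (hy : ∀ v ∈ S, y' v = y v) :
    GoodOn T d L S y' := by
  refine ⟨fun v hv => hy v hv ▸ h.mem v hv, fun a ha b hb c hc => ?_⟩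
  rw [reorient_congr (hy a ha) (hy b hb), reorient_congr (hy b hb) (hy c hc),
    reorient_congr (hy c hc) (hy a ha)]
  exact h.no_triangle a ha b hb c hc

/-- If every label in the list of every vertex `p` extends to a good labelling of each block at
`p`, and no list is empty, then the whole graph has a good labelling. It is built up block by
block: a block that meets the part `S` labelled so far meets it in one vertex only, and no other
edge joins the block to `S`. -/
theorem exists_goodOn_univ {V Λ : Type} [Finite V] {G : SimpleGraph V} (hG : G.IsBlockGraph)
    {T : V → V → Prop} {d : Λ → Λ → Prop} {L : V → Λ → Prop}
    (hT : ∀ a b, T a b → G.Adj a b) (hne : ∀ v, ∃ z, L v z)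
    (hL : ∀ u p, G.Adj u p → ∀ z, L p z → ∃ y, GoodOn T d L (G.edgeBlock u p) y ∧ y p = z) :
    ∃ y, GoodOn T d L Set.univ y := by
  classical
  have hRadj : ∀ (y : V → Λ) a b, Reorient T d y a b → G.Adj a b := by
    rintro y a b (⟨-, h⟩ | ⟨-, h⟩)
    exacts [(hT _ _ h).symm, hT _ _ h]
  -- a labelled part contains the block of each of its edges, and it induces a connected subgraph in
  -- every component
  let Inv : Set V → Prop := fun S => (∃ y, GoodOn T d L S y) ∧
    (∀ a ∈ S, ∀ b ∈ S, G.Adj a b → ∀ c, G.Adj c a → G.Adj c b → c ∈ S) ∧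
    (∀ a ∈ S, ∀ b ∈ S, G.Reachable a b → ∃ P : G.Walk a b, ∀ x ∈ P.support, x ∈ S)
  have h0 : Inv ∅ := ⟨⟨fun v => (hne v).choose, by simp, by simp⟩, by simp, by simp⟩
  obtain ⟨S, -, hS⟩ := Finite.exists_le_maximal h0
  obtain ⟨⟨y, hy⟩, hcl, hcon⟩ := hS.prop
  suffices hu : S = Set.univ by exact ⟨y, hu ▸ hy⟩
  by_contra hSu
  obtain ⟨u₀, hu₀⟩ := (Set.ne_univ_iff_exists_notMem S).1 hSu
  -- it suffices to enlarge `S`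
  suffices hx : ∃ S', Inv S' ∧ S ⊆ S' ∧ ∃ u ∈ S', u ∉ S by
    obtain ⟨S', hI, hle, u, hu, hu'⟩ := hx
    exact hu' (hS.le_of_ge hI hle hu)
  by_cases hout : ∃ p ∈ S, ∃ u, u ∉ S ∧ G.Adj u p
  · obtain ⟨p, hp, u, hu, hup⟩ := hout
    set B := G.edgeBlock u p with hB
    have hpB : p ∈ B := Or.inl rfl
    have huB : u ∈ B := Or.inr (Or.inl rfl)
    have hclique : G.IsClique B := hG.isClique_edgeBlock hup
    have hBS : ∀ b ∈ B, b ≠ p → b ∉ S := fun b hb hbp hbS =>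
      hu (hcl b hbS p hp (hclique hb hpB hbp) u
        (hclique huB hb fun e => hu (e ▸ hbS)) hup)
    have hcut : ∀ b ∈ B, b ≠ p → ∀ w ∈ S, G.Adj b w → w = p := by
      intro b hb hbp w hw hbw
      by_contra hwp
      have hadj := hclique hb hpB hbp
      obtain ⟨P, hP⟩ := hcon p hp w hw (hadj.symm.reachable.trans hbw.reachable)
      have hbS := hBS b hb hbp
      exact hbS (hcl p hp w hw
        (hG.adj_of_walk P (fun h => hbS (hP b h)) hadj hbw fun e => hwp e.symm) b hadj hbw)
    obtain ⟨yB, hyB, hyp⟩ := hL u p hup (y p) (hy.mem p hp)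
    have hadjB : ∀ b ∈ B, b ≠ p → ∀ w ∈ S ∪ B, G.Adj b w → w ∈ B := by
      rintro b hb hbp w (hw | hw) h
      · exact hcut b hb hbp w hw h ▸ hpB
      · exact hw
    refine ⟨S ∪ B, ⟨⟨fun v => if v ∈ S then y v else yB v, ?_⟩, ?_, ?_⟩, Set.subset_union_left, u,
      Or.inr huB, hu⟩
    · have h1 : GoodOn T d L S (fun v => if v ∈ S then y v else yB v) :=
        hy.congr fun v hv => if_pos hv
      have h2 : GoodOn T d L B (fun v => if v ∈ S then y v else yB v) := by
        refine hyB.congr fun v hv => ?_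
        by_cases hvp : v = p
        · subst hvp; simp [hp, hyp]
        · exact if_neg (hBS v hv hvp)
      refine ⟨fun v hv => hv.elim (h1.mem v) (h2.mem v), ?_⟩
      rintro a ha b hb c hc ⟨hab, hbc, hca⟩
      have eab := hRadj _ _ _ hab
      have ebc := hRadj _ _ _ hbc
      have eca := hRadj _ _ _ hca
      by_cases hall : a ∈ S ∧ b ∈ S ∧ c ∈ S
      · exact h1.no_triangle a hall.1 b hall.2.1 c hall.2.2 ⟨hab, hbc, hca⟩
      suffices a ∈ B ∧ b ∈ B ∧ c ∈ B from
        h2.no_triangle a this.1 b this.2.1 c this.2.2 ⟨hab, hbc, hca⟩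
      have hB' : ∀ v ∈ S ∪ B, v ∉ S → v ∈ B ∧ v ≠ p := fun v hv hvS =>
        ⟨hv.resolve_left hvS, fun e => hvS (e ▸ hp)⟩
      by_cases haS : a ∈ S
      · by_cases hbS : b ∈ S
        · have hcS : c ∉ S := fun h => hall ⟨haS, hbS, h⟩
          obtain ⟨h, h'⟩ := hB' c hc hcS
          exact ⟨hadjB c h h' a ha eca, hadjB c h h' b hb ebc.symm, h⟩
        · obtain ⟨h, h'⟩ := hB' b hb hbS
          exact ⟨hadjB b h h' a ha eab.symm, h, hadjB b h h' c hc ebc⟩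
      · obtain ⟨h, h'⟩ := hB' a ha haS
        exact ⟨h, hadjB a h h' b hb eab, hadjB a h h' c hc eca.symm⟩
    · have hin : ∀ a ∈ B, ∀ b ∈ B, G.Adj a b → ∀ c, G.Adj c a → G.Adj c b → c ∈ S ∪ B :=
        fun a ha b hb hab c hca hcb => Or.inr (hG.mem_edgeBlock hup ha hb hab hca hcb)
      intro a ha b hb hab c hca hcb
      by_cases haS : a ∈ S
      · by_cases hbS : b ∈ S
        · exact Or.inl (hcl a haS b hbS hab c hca hcb)
        · have hbB := hb.resolve_left hbS
          have hbp : b ≠ p := fun e => hbS (e ▸ hp)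
          exact hin a (hadjB b hbB hbp a ha hab.symm) b hbB hab c hca hcb
      · have haB := ha.resolve_left haS
        have hap : a ≠ p := fun e => haS (e ▸ hp)
        exact hin a haB b (hadjB a haB hap b hb hab) hab c hca hcb
    · have hto : ∀ a ∈ S ∪ B, ∃ a' ∈ S, ∃ P : G.Walk a a', ∀ x ∈ P.support, x ∈ S ∪ B := by
        intro a ha
        by_cases haS : a ∈ S
        · exact ⟨a, haS, .nil, by simpa using ha⟩
        · have haB := ha.resolve_left haS
          refine ⟨p, hp, .cons (hclique haB hpB fun e => haS (e ▸ hp)) .nil, ?_⟩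
          intro x hx
          simp only [SimpleGraph.Walk.support_cons, SimpleGraph.Walk.support_nil, List.mem_cons,
            List.not_mem_nil, or_false] at hx
          rcases hx with rfl | rfl
          exacts [ha, Or.inl hp]
      intro a ha b hb hab
      obtain ⟨a', ha', P, hP⟩ := hto a ha
      obtain ⟨b', hb', Q, hQ⟩ := hto b hb
      obtain ⟨W, hW⟩ := hcon a' ha' b' hb' (P.reachable.symm.trans (hab.trans Q.reachable))
      refine ⟨P.append (W.append Q.reverse), fun x hx => ?_⟩
      rw [SimpleGraph.Walk.mem_support_append_iff, SimpleGraph.Walk.mem_support_append_iff,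
        SimpleGraph.Walk.support_reverse, List.mem_reverse] at hx
      rcases hx with h | h | h
      exacts [hP x h, Or.inl (hW x h), hQ x h]
  · push Not at hout
    have hno : ∀ a b, G.Reachable a b → a ∈ S → b ∈ S := by
      rintro a b ⟨P⟩ ha
      induction P with
      | nil => exact ha
      | cons h _ ih => exact ih (by_contra fun hn => hout _ ha _ hn h.symm)
    refine ⟨insert u₀ S, ⟨⟨Function.update y u₀ (hne u₀).choose, ?_⟩, ?_, ?_⟩,
      Set.subset_insert _ _, u₀, Set.mem_insert _ _, hu₀⟩
    · have h1 : GoodOn T d L S (Function.update y u₀ (hne u₀).choose) :=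
        hy.congr fun v hv => Function.update_of_ne (by rintro rfl; exact hu₀ hv) _ _
      refine ⟨?_, ?_⟩
      · rintro v (rfl | hv)
        · simpa using (hne v).choose_spec
        · exact h1.mem v hv
      · rintro a ha b hb c hc ⟨hab, hbc, hca⟩
        have eab := hRadj _ _ _ hab
        have ebc := hRadj _ _ _ hbc
        have eca := hRadj _ _ _ hca
        have hiso : ∀ v ∈ insert u₀ S, ¬ G.Adj u₀ v := by
          rintro v (rfl | hv) h
          · exact h.ne rfl
          · exact hout v hv u₀ hu₀ h
        refine h1.no_triangle a (ha.resolve_left ?_) b (hb.resolve_left ?_) c (hc.resolve_left ?_)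
          ⟨hab, hbc, hca⟩
        · rintro rfl; exact hiso b hb eab
        · rintro rfl; exact hiso c hc ebc
        · rintro rfl; exact hiso a ha eca
    · rintro a (rfl | ha) b (rfl | hb) hab c hca hcb
      · exact absurd rfl hab.ne
      · exact absurd hab (hout b hb a hu₀)
      · exact absurd hab.symm (hout a ha b hu₀)
      · exact Or.inr (hcl a ha b hb hab c hca hcb)
    · rintro a (rfl | ha) b (rfl | hb) hab
      · exact ⟨.nil, by simp⟩
      · exact absurd (hno _ _ hab.symm hb) hu₀
      · exact absurd (hno _ _ hab ha) hu₀
      · obtain ⟨P, hP⟩ := hcon a ha b hb hab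
        exact ⟨P, fun x hx => Or.inr (hP x hx)⟩

/-! ### Representatives of partial labellings of a sequence of vertices -/

section Sequence

variable {T : ℕ → ℕ → Prop} {d : ℕ → ℕ → Prop} {L : ℕ → ℕ → Prop}

/-- The labelling `ℓ'` of the positions below `j` dominates `ℓ`: every pair of positions looks,
under `ℓ'`, like some pair looks under `ℓ`, as regards labels, mutual arcs, and arcs to and from
the later positions below `e`. -/
def Dominates (T : ℕ → ℕ → Prop) (e j : ℕ) (ℓ' ℓ : ℕ → ℕ) : Prop :=
  ∀ a < j, ∀ b < j, ∃ a' < j, ∃ b' < j, ℓ' a = ℓ a' ∧ ℓ' b = ℓ b' ∧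
    (T a b ↔ T a' b') ∧ (T b a ↔ T b' a') ∧
    ∀ r < e, j ≤ r → (T a r ↔ T a' r) ∧ (T r a ↔ T r a') ∧ (T b r ↔ T b' r) ∧ (T r b ↔ T r b')

/-- A good labelling stays good when its restriction to a prefix is replaced by a good labelling
that dominates it: a directed triangle that meets both the prefix and the rest is copied to a
directed triangle of the original labelling. -/
theorem GoodOn.replace_prefix {e j : ℕ} {ℓ' ℓ : ℕ → ℕ} (hdom : Dominates T e j ℓ' ℓ)
    (h' : GoodOn T d L (Set.Iio j) ℓ') (h : GoodOn T d L (Set.Iio e) ℓ) :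
    GoodOn T d L (Set.Iio e) (fun q => if q < j then ℓ' q else ℓ q) := by
  set g : ℕ → ℕ := fun q => if q < j then ℓ' q else ℓ q with hg
  have g1 : ∀ q, q < j → g q = ℓ' q := fun q hq => if_pos hq
  have g2 : ∀ q, ¬ q < j → g q = ℓ q := fun q hq => if_neg hq
  have hpre : GoodOn T d L (Set.Iio j) g := h'.congr fun v hv => g1 v hv
  have key : ∀ a < e, ∀ b < e, ∀ c < e, ¬ c < j →
      ¬ (Reorient T d g a b ∧ Reorient T d g b c ∧ Reorient T d g c a) := by
    rintro a ha b hb c hc hcj ⟨hab, hbc, hca⟩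
    obtain ⟨a', ha', b', hb', h1, h2, h3⟩ : ∃ a' < e, ∃ b' < e, Reorient T d ℓ a' b' ∧
        Reorient T d ℓ b' c ∧ Reorient T d ℓ c a' := by
      unfold Reorient at *
      by_cases haj : a < j <;> by_cases hbj : b < j
      · obtain ⟨a', ha', b', hb', e1, e2, e3, e4, e5⟩ := hdom a haj b hbj
        obtain ⟨f1, f2, f3, f4⟩ := e5 c hc (by omega)
        rw [g1 a haj, g1 b hbj, e1, e2, e3, e4] at hab
        rw [g1 b hbj, g2 c hcj, e2, f3, f4] at hbc
        rw [g1 a haj, g2 c hcj, e1, f1, f2] at hca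
        exact ⟨a', by omega, b', by omega, hab, hbc, hca⟩
      · obtain ⟨a', ha', _, _, e1, _, _, _, e5⟩ := hdom a haj a haj
        obtain ⟨f1, f2, -⟩ := e5 c hc (by omega)
        obtain ⟨f3, f4, -⟩ := e5 b hb (by omega)
        rw [g1 a haj, g2 b hbj, e1, f3, f4] at hab
        rw [g2 b hbj, g2 c hcj] at hbc
        rw [g1 a haj, g2 c hcj, e1, f1, f2] at hca
        exact ⟨a', by omega, b, by omega, hab, hbc, hca⟩
      · obtain ⟨b', hb', _, _, e1, _, _, _, e5⟩ := hdom b hbj b hbj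
        obtain ⟨f1, f2, -⟩ := e5 c hc (by omega)
        obtain ⟨f3, f4, -⟩ := e5 a ha (by omega)
        rw [g2 a haj, g1 b hbj, e1, f3, f4] at hab
        rw [g1 b hbj, g2 c hcj, e1, f1, f2] at hbc
        rw [g2 a haj, g2 c hcj] at hca
        exact ⟨a, by omega, b', by omega, hab, hbc, hca⟩
      · rw [g2 a haj, g2 b hbj] at hab
        rw [g2 b hbj, g2 c hcj] at hbc
        rw [g2 a haj, g2 c hcj] at hca
        exact ⟨a, by omega, b, by omega, hab, hbc, hca⟩
    exact h.no_triangle a' ha' b' hb' c hc ⟨h1, h2, h3⟩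
  refine ⟨fun v hv => ?_, fun a ha b hb c hc hcyc => ?_⟩
  · by_cases hvj : v < j
    · exact hpre.mem v hvj
    · rw [g2 v hvj]; exact h.mem v hv
  · by_cases hcj : c < j
    · by_cases hbj : b < j
      · by_cases haj : a < j
        · exact hpre.no_triangle a haj b hbj c hcj hcyc
        · exact key b hb c hc a ha haj ⟨hcyc.2.1, hcyc.2.2, hcyc.1⟩
      · exact key c hc a ha b hb hbj ⟨hcyc.2.2, hcyc.1, hcyc.2.1⟩
    · exact key a ha b hb c hc hcj hcyc

/-- A completion `ℓ` of the candidate `c` turns into a completion of a dominating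
representative `ρ`, without a change of the label in the last position `e - 1`. -/
theorem exists_completion_of_dominates {e j : ℕ} {ρ c ℓ : ℕ → ℕ} (hdom : Dominates T e (j + 1) ρ c)
    (hlast : ρ j = c j) (hρ : GoodOn T d L (Set.Iio (j + 1)) ρ) (hℓ : GoodOn T d L (Set.Iio e) ℓ)
    (hc : ∀ q < j + 1, ℓ q = c q) (hje : j < e) :
    ∃ ℓ', GoodOn T d L (Set.Iio e) ℓ' ∧ ℓ' (e - 1) = ℓ (e - 1) ∧ ∀ q < j + 1, ℓ' q = ρ q := by
  have hdom' : Dominates T e (j + 1) ρ ℓ := by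
    intro a ha b hb
    obtain ⟨a', ha', b', hb', h⟩ := hdom a ha b hb
    exact ⟨a', ha', b', hb', by rwa [hc a' ha', hc b' hb']⟩
  refine ⟨_, GoodOn.replace_prefix hdom' hρ hℓ, ?_, fun q hq => if_pos hq⟩
  by_cases h : e - 1 < j + 1
  · obtain rfl : e - 1 = j := by omega
    simp [hlast, hc]
  · exact if_neg h

/-- If the positions below `j` fall into `K` classes such that positions of one class have the
same arcs to and from the later positions, then few pairwise non-dominating labellings of the
positions below `j` exist: a labelling is determined, up to domination, by its label in the
position `q` and the set of its types of pairs. -/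
theorem card_le_of_not_dominates {e j K M cnt q : ℕ} {rows : ℕ → ℕ → ℕ} {κ : ℕ → ℕ} (hq : q < j)
    (hM : ∀ r < cnt, ∀ a < j, rows r a < M) (hK : ∀ a < j, κ a < K)
    (hκ : ∀ a < j, ∀ a' < j, κ a = κ a' → ∀ r < e, j ≤ r → (T a r ↔ T a' r) ∧ (T r a ↔ T r a'))
    (hdist : ∀ r < cnt, ∀ r' < r, ¬ (rows r' q = rows r q ∧ Dominates T e j (rows r') (rows r))) :
    cnt ≤ M * 2 ^ (K * M * (K * M) * 4) := by
  classical
  -- `f r a b` is the type of the pair of positions `a`, `b` in the row `r`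
  let f : ℕ → ℕ → ℕ → ((ℕ × ℕ) × (ℕ × ℕ)) × (Bool × Bool) := fun r a b =>
    (((κ a, rows r a), (κ b, rows r b)), (decide (T a b), decide (T b a)))
  let S : ℕ → Finset (((ℕ × ℕ) × (ℕ × ℕ)) × (Bool × Bool)) := fun r =>
    (Finset.range j ×ˢ Finset.range j).image fun ab => f r ab.1 ab.2
  let U : Finset (((ℕ × ℕ) × (ℕ × ℕ)) × (Bool × Bool)) :=
    ((Finset.range K ×ˢ Finset.range M) ×ˢ (Finset.range K ×ˢ Finset.range M)) ×ˢ Finset.univ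
  have hU : (Finset.range M ×ˢ U.powerset).card = M * 2 ^ (K * M * (K * M) * 4) := by
    simp [U, Finset.card_product]
  have hS : ∀ r < cnt, S r ⊆ U := by
    intro r hr x hx
    simp only [S, Finset.mem_image, Finset.mem_product, Finset.mem_range, Prod.exists] at hx
    obtain ⟨a, b, ⟨ha, hb⟩, rfl⟩ := hx
    simp [U, f, hK a ha, hK b hb, hM r hr a ha, hM r hr b hb]
  have hdom : ∀ r r', S r' = S r → Dominates T e j (rows r') (rows r) := by
    intro r r' hrr a ha b hb
    have hmem : f r' a b ∈ S r := by
      rw [← hrr]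
      exact Finset.mem_image_of_mem (fun ab : ℕ × ℕ => f r' ab.1 ab.2) (a := (a, b))
        (by simp [ha, hb])
    simp only [S, Finset.mem_image, Finset.mem_product, Finset.mem_range, Prod.exists] at hmem
    obtain ⟨a', b', ⟨ha', hb'⟩, he⟩ := hmem
    simp only [f, Prod.mk.injEq, decide_eq_decide] at he
    obtain ⟨⟨⟨h1, h2⟩, h3, h4⟩, h5, h6⟩ := he
    refine ⟨a', ha', b', hb', h2.symm, h4.symm, h5.symm, h6.symm, fun r hr hjr => ?_⟩
    have hA := hκ a ha a' ha' h1.symm r hr hjr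
    have hB := hκ b hb b' hb' h3.symm r hr hjr
    exact ⟨hA.1, hA.2, hB.1, hB.2⟩
  rw [← hU, ← Finset.card_range cnt]
  refine Finset.card_le_card_of_injOn (fun r => (rows r q, S r)) ?_ ?_
  · intro r hr
    have hr : r < cnt := by simpa using hr
    simp only [Finset.coe_product, Set.mem_prod, Finset.mem_coe, Finset.mem_range,
      Finset.mem_powerset]
    exact ⟨hM r hr q hq, hS r hr⟩
  · intro r hr r' hr' h
    have hr : r < cnt := by simpa using hr
    have hr' : r' < cnt := by simpa using hr'
    simp only [Prod.mk.injEq] at h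
    rcases lt_trichotomy r r' with hlt | heq | hlt
    · exact absurd ⟨h.1, hdom _ _ h.2⟩ (hdist r' hr' r hlt)
    · exact heq
    · exact absurd ⟨h.1.symm, hdom _ _ h.2.symm⟩ (hdist r hr r' hlt)

/-- `T` is a tournament on the positions below `e`. -/
structure TournamentOn (T : ℕ → ℕ → Prop) (e : ℕ) : Prop where
  irrefl : ∀ a < e, ¬ T a a
  total : ∀ a < e, ∀ b < e, a ≠ b → (T a b ↔ ¬ T b a)

/-- The labels `x` turn the tournament on the positions below `m` into the linear order of the
positions. -/
def SortedBy (T : ℕ → ℕ → Prop) (d : ℕ → ℕ → Prop) (M m : ℕ) (x : ℕ → ℕ) : Prop :=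
  (∀ a < m, x a < M) ∧ ∀ c < m, ∀ a < c, Reorient T d x a c

/-- In a sequence that is sorted up to its last vertex `m`, the label `x a` and the direction of
the arc between `a` and `m` determine the arcs between `a` and all later positions. -/
theorem SortedBy.exists_classes {M m : ℕ} {x : ℕ → ℕ} (hT : TournamentOn T (m + 1))
    (hx : SortedBy T d M m x) (hM : 0 < M) :
    ∃ κ : ℕ → ℕ, (∀ a, κ a < 2 * M) ∧ ∀ a a', κ a = κ a' → ∀ r < m + 1, a < r → a' < r →
      (T a r ↔ T a' r) ∧ (T r a ↔ T r a') := by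
  classical
  refine ⟨fun a => if a < m then x a + (if T a m then M else 0) else 0, fun a => ?_, ?_⟩
  · dsimp only
    split_ifs with h1 h2
    · have := hx.1 a h1; omega
    · have := hx.1 a h1; omega
    · omega
  · intro a a' h r hr har har'
    have ham : a < m := by omega
    have ham' : a' < m := by omega
    have hxa := hx.1 a ham
    have hxa' := hx.1 a' ham'
    simp only [ham, ham', if_true] at h
    have hboth : x a = x a' ∧ (T a m ↔ T a' m) := by
      by_cases h1 : T a m <;> by_cases h2 : T a' m <;>
        simp only [h1, h2, if_true, if_false] at h <;> constructor <;> first | omega | simp [h1, h2]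
    have hiff : ∀ b, b < r → (T r b ↔ ¬ T b r) := fun b hb =>
      hT.total r hr b (by omega) (by omega)
    suffices T a r ↔ T a' r from ⟨this, by rw [hiff a har, hiff a' har', this]⟩
    rcases Nat.lt_succ_iff_lt_or_eq.1 hr with hrm | rfl
    · have hval : ∀ b, b < r → (T b r ↔ ¬ d (x b) (x r)) := by
        intro b hb
        rcases hx.2 r hrm b hb with ⟨h1, h2⟩ | ⟨h1, h2⟩
        · exact iff_of_false ((hiff b hb).1 h2) (not_not.2 h1)
        · exact iff_of_true h2 h1
      rw [hval a har, hval a' har', hboth.1]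
    · exact hboth.2

open Classical in
/-- The number of positions below `e` from which an arc leads to `q`. -/
noncomputable def score (R : ℕ → ℕ → Prop) (e q : ℕ) : ℕ := ((Finset.range e).filter (R · q)).card

/-- After a good relabelling, a tournament is transitive, and is ordered by the scores. -/
theorem GoodOn.score_lt_score {e : ℕ} {ℓ : ℕ → ℕ} (hT : TournamentOn T e)
    (hd : ∀ x y, d x y → d y x) (h : GoodOn T d L (Set.Iio e) ℓ) {a b : ℕ} (ha : a < e) (hb : b < e)
    (hab : a ≠ b) :
    score (Reorient T d ℓ) e a < score (Reorient T d ℓ) e b ↔ Reorient T d ℓ a b := by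
  classical
  have hds : ∀ x y, d x y ↔ d y x := fun x y => ⟨hd x y, hd y x⟩
  have hirr : ∀ a < e, ¬ Reorient T d ℓ a a := by
    rintro a ha (⟨-, h⟩ | ⟨-, h⟩) <;> exact hT.irrefl a ha h
  have htot : ∀ a < e, ∀ b < e, a ≠ b → (Reorient T d ℓ a b ↔ ¬ Reorient T d ℓ b a) := by
    intro a ha b hb hab
    have := hT.total a ha b hb hab
    simp only [Reorient, hds (ℓ b) (ℓ a)]
    tauto
  have hlt : ∀ a < e, ∀ b < e, Reorient T d ℓ a b →
      score (Reorient T d ℓ) e a < score (Reorient T d ℓ) e b := by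
    intro a ha b hb hab
    refine Finset.card_lt_card (Finset.ssubset_iff_of_subset ?_ |>.2 ⟨a, ?_, ?_⟩)
    · intro x hx
      simp only [Finset.mem_filter, Finset.mem_range] at hx ⊢
      refine ⟨hx.1, ?_⟩
      by_cases hxb : x = b
      · subst hxb
        by_cases hax : a = x
        · subst hax; exact hab
        · exact absurd hx.2 ((htot a ha x hb hax).1 hab)
      · exact (htot x hx.1 b hb hxb).2 fun hbx =>
          h.no_triangle x hx.1 a ha b hb ⟨hx.2, hab, hbx⟩
    · simpa using ⟨ha, hab⟩
    · simpa using fun _ => hirr a ha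
  refine ⟨fun hs => ?_, hlt a ha b hb⟩
  by_contra hn
  exact absurd (hlt b hb a ha ((htot b hb a ha hab.symm).2 hn)) (by omega)

theorem GoodOn.score_injOn {e : ℕ} {ℓ : ℕ → ℕ} (hT : TournamentOn T e)
    (hd : ∀ x y, d x y → d y x) (h : GoodOn T d L (Set.Iio e) ℓ) :
    Set.InjOn (score (Reorient T d ℓ) e) (Set.Iio e) := by
  intro a ha b hb hab
  by_contra hne
  have h1 := h.score_lt_score hT hd ha hb hne
  have h2 := h.score_lt_score hT hd hb ha (Ne.symm hne)
  have hds : d (ℓ a) (ℓ b) ↔ d (ℓ b) (ℓ a) := ⟨hd _ _, hd _ _⟩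
  have := hT.total a ha b hb hne
  simp only [hab, lt_self_iff_false, false_iff, Reorient] at h1 h2
  tauto

theorem score_lt {R : ℕ → ℕ → Prop} {e q : ℕ} (hq : q < e) (hR : ¬ R q q) : score R e q < e := by
  classical
  have : (Finset.range e).filter (R · q) ⊂ Finset.range e :=
    Finset.filter_ssubset.2 ⟨q, by simpa using hq, hR⟩
  simpa [score] using Finset.card_lt_card this

end Sequence

/-! ### One stage of the search for a good labelling of a sequence -/

section Stage

variable {T : ℕ → ℕ → Prop} {d : ℕ → ℕ → Prop} {L : ℕ → ℕ → Prop}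

/-- The rows below `cnt` represent the good labellings of the sequence of length `e` on its
positions below `j`: every good labelling of the whole sequence can be changed, except for its
last label, so that it continues one of the rows. -/
structure Represent (T d L : ℕ → ℕ → Prop) (e j : ℕ) (rows : ℕ → ℕ → ℕ) (cnt : ℕ) : Prop where
  good : ∀ r < cnt, GoodOn T d L (Set.Iio j) (rows r)
  complete : ∀ ℓ, GoodOn T d L (Set.Iio e) ℓ → ∃ r < cnt, ∃ ℓ', GoodOn T d L (Set.Iio e) ℓ' ∧
    ℓ' (e - 1) = ℓ (e - 1) ∧ ∀ q < j, ℓ' q = rows r q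

/-- The state of the passage from representatives `cur` for `j` positions to representatives `new`
for `j + 1` positions, when the extensions of the row `r` by the label `z` with `P r z` have been
considered. -/
structure Extending (T d L : ℕ → ℕ → Prop) (e j : ℕ) (cur : ℕ → ℕ → ℕ) (cnt : ℕ)
    (new : ℕ → ℕ → ℕ) (cnt' : ℕ) (P : ℕ → ℕ → Prop) : Prop where
  good : ∀ r < cnt', GoodOn T d L (Set.Iio (j + 1)) (new r)
  distinct : ∀ r < cnt', ∀ r' < r,
    ¬ (new r' j = new r j ∧ Dominates T e (j + 1) (new r') (new r))
  complete : ∀ ℓ, GoodOn T d L (Set.Iio e) ℓ → ∀ r < cnt, (∀ q < j, ℓ q = cur r q) → P r (ℓ j) →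
    ∃ r' < cnt', ∃ ℓ', GoodOn T d L (Set.Iio e) ℓ' ∧ ℓ' (e - 1) = ℓ (e - 1) ∧
      ∀ q < j + 1, ℓ' q = new r' q

variable {e j cnt cnt' : ℕ} {cur new : ℕ → ℕ → ℕ} {P P' : ℕ → ℕ → Prop}

theorem represent_zero (rows : ℕ → ℕ → ℕ) : Represent T d L e 0 rows 1 :=
  ⟨fun _ _ => ⟨fun v hv => absurd hv (by simp), fun a ha => absurd ha (by simp)⟩,
    fun ℓ h => ⟨0, by omega, ℓ, h, rfl, fun q hq => absurd hq (by omega)⟩⟩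

theorem Represent.congr {rows rows' : ℕ → ℕ → ℕ} (h : Represent T d L e j rows cnt)
    (hr : ∀ r < cnt, ∀ q < j, rows' r q = rows r q) : Represent T d L e j rows' cnt := by
  refine ⟨fun r hrc => (h.good r hrc).congr fun q hq => hr r hrc q hq, fun ℓ hℓ => ?_⟩
  obtain ⟨r, hrc, ℓ', h1, h2, h3⟩ := h.complete ℓ hℓ
  exact ⟨r, hrc, ℓ', h1, h2, fun q hq => (h3 q hq).trans (hr r hrc q hq).symm⟩

theorem extending_start : Extending T d L e j cur cnt new 0 fun _ _ => False :=
  ⟨fun _ h => absurd h (by omega), fun _ h => absurd h (by omega), fun _ _ _ _ _ h => h.elim⟩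

/-- When all extensions have been considered, the rows of `new` are representatives. -/
theorem Extending.finish (h : Extending T d L e j cur cnt new cnt' P)
    (hcur : Represent T d L e j cur cnt) (hje : j < e)
    (hP : ∀ r < cnt, ∀ z, L j z → P r z) : Represent T d L e (j + 1) new cnt' := by
  refine ⟨h.good, fun ℓ hℓ => ?_⟩
  obtain ⟨r, hr, ℓ', h1, h2, h3⟩ := hcur.complete ℓ hℓ
  obtain ⟨r', hr', ℓ'', h4, h5, h6⟩ := h.complete ℓ' h1 r hr h3 (hP r hr _ (h1.mem j hje))
  exact ⟨r', hr', ℓ'', h4, h5.trans h2, h6⟩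

/-- The rows beyond the counter do not matter. -/
theorem Extending.congr {new' : ℕ → ℕ → ℕ} (h : Extending T d L e j cur cnt new cnt' P)
    (hn : ∀ r < cnt', new' r = new r) : Extending T d L e j cur cnt new' cnt' P := by
  refine ⟨fun r hr => hn r hr ▸ h.good r hr, fun r hr r' hr' => ?_, fun ℓ hℓ r hr hq hP => ?_⟩
  · rw [hn r hr, hn r' (hr'.trans hr)]
    exact h.distinct r hr r' hr'
  · obtain ⟨r', hr', hc⟩ := h.complete ℓ hℓ r hr hq hP
    exact ⟨r', hr', by rwa [hn r' hr']⟩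

theorem Extending.mono (h : Extending T d L e j cur cnt new cnt' P)
    (hP : ∀ ℓ, GoodOn T d L (Set.Iio e) ℓ → ∀ r < cnt, (∀ q < j, ℓ q = cur r q) →
      P' r (ℓ j) → P r (ℓ j)) : Extending T d L e j cur cnt new cnt' P' :=
  ⟨h.good, h.distinct, fun ℓ hℓ r hr hq hP' => h.complete ℓ hℓ r hr hq (hP ℓ hℓ r hr hq hP')⟩

/-- When one position is added, only triangles through the new position have to be excluded. -/
theorem goodOn_Iio_succ {ρ : ℕ → ℕ} (h : GoodOn T d L (Set.Iio j) ρ) (hL : L j (ρ j))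
    (htri : ∀ a < j + 1, ∀ b < j + 1,
      ¬ (Reorient T d ρ a b ∧ Reorient T d ρ b j ∧ Reorient T d ρ j a)) :
    GoodOn T d L (Set.Iio (j + 1)) ρ := by
  refine ⟨fun v hv => ?_, fun a ha b hb c hc hcyc => ?_⟩
  · rcases Nat.lt_succ_iff_lt_or_eq.1 hv with hv | rfl
    exacts [h.mem v hv, hL]
  · rcases Nat.lt_succ_iff_lt_or_eq.1 hc with hc' | rfl
    · rcases Nat.lt_succ_iff_lt_or_eq.1 hb with hb' | rfl
      · rcases Nat.lt_succ_iff_lt_or_eq.1 ha with ha' | rfl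
        · exact h.no_triangle a ha' b hb' c hc' hcyc
        · exact htri b hb c hc ⟨hcyc.2.1, hcyc.2.2, hcyc.1⟩
      · exact htri c hc a ha ⟨hcyc.2.2, hcyc.1, hcyc.2.1⟩
    · exact htri a ha b hb hcyc

/-- The candidate in row `cnt'`, which extends the row `r` of `cur` by the label `z`, is rejected:
it has a directed triangle or is dominated. -/
theorem Extending.reject {r z : ℕ} (h : Extending T d L e j cur cnt new cnt' P) (hje : j < e)
    (hr : ∀ q < j, new cnt' q = cur r q) (hz : new cnt' j = z)
    (hrej : (∃ a < j + 1, ∃ b < j + 1, Reorient T d (new cnt') a b ∧ Reorient T d (new cnt') b j ∧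
      Reorient T d (new cnt') j a) ∨ ∃ r' < cnt', new r' j = new cnt' j ∧
        Dominates T e (j + 1) (new r') (new cnt')) :
    Extending T d L e j cur cnt new cnt' fun r' z' => P r' z' ∨ (r' = r ∧ z' = z) := by
  refine ⟨h.good, h.distinct, fun ℓ hℓ r₀ hr₀ hq hP => ?_⟩
  rcases hP with hP | ⟨rfl, hzj⟩
  · exact h.complete ℓ hℓ r₀ hr₀ hq hP
  have hagree : ∀ q < j + 1, ℓ q = new cnt' q := by
    intro q hq'
    rcases Nat.lt_succ_iff_lt_or_eq.1 hq' with hq' | rfl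
    · rw [hq q hq', hr q hq']
    · rw [hzj, hz]
  rcases hrej with ⟨a, ha, b, hb, h1, h2, h3⟩ | ⟨r', hr', h1, h2⟩
  · rw [← reorient_congr (hagree a ha) (hagree b hb)] at h1
    rw [← reorient_congr (hagree b hb) (hagree j (by omega))] at h2
    rw [← reorient_congr (hagree j (by omega)) (hagree a ha)] at h3
    exact absurd ⟨h1, h2, h3⟩ (hℓ.no_triangle a (lt_of_lt_of_le ha hje) b (lt_of_lt_of_le hb hje)
      j hje)
  · obtain ⟨ℓ', h3, h4, h5⟩ :=
      exists_completion_of_dominates h2 h1 (h.good r' hr') hℓ hagree hje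
    exact ⟨r', hr', ℓ', h3, h4, h5⟩

/-- The candidate in row `cnt'`, which extends the row `r` of `cur` by the label `z`, is kept. -/
theorem Extending.accept {r z : ℕ} (h : Extending T d L e j cur cnt new cnt' P)
    (hcur : GoodOn T d L (Set.Iio j) (cur r))
    (hr : ∀ q < j, new cnt' q = cur r q) (hz : new cnt' j = z) (hL : L j z)
    (htri : ¬ ∃ a < j + 1, ∃ b < j + 1, Reorient T d (new cnt') a b ∧
      Reorient T d (new cnt') b j ∧ Reorient T d (new cnt') j a)
    (hdom : ¬ ∃ r' < cnt', new r' j = new cnt' j ∧ Dominates T e (j + 1) (new r') (new cnt')) :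
    Extending T d L e j cur cnt new (cnt' + 1) fun r' z' => P r' z' ∨ (r' = r ∧ z' = z) := by
  refine ⟨fun r₀ hr₀ => ?_, fun r₀ hr₀ r' hr' => ?_, fun ℓ hℓ r₀ hr₀ hq hP => ?_⟩
  · rcases Nat.lt_succ_iff_lt_or_eq.1 hr₀ with hr₀ | rfl
    · exact h.good r₀ hr₀
    · refine goodOn_Iio_succ (hcur.congr hr) (hz ▸ hL) fun a ha b hb hc => ?_
      exact htri ⟨a, ha, b, hb, hc⟩
  · rcases Nat.lt_succ_iff_lt_or_eq.1 hr₀ with hr₀ | rfl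
    · exact h.distinct r₀ hr₀ r' hr'
    · exact fun hd => hdom ⟨r', hr', hd⟩
  · rcases hP with hP | ⟨rfl, hzj⟩
    · obtain ⟨r', hr', hc⟩ := h.complete ℓ hℓ r₀ hr₀ hq hP
      exact ⟨r', by omega, hc⟩
    · refine ⟨cnt', by omega, ℓ, hℓ, rfl, fun q hq' => ?_⟩
      rcases Nat.lt_succ_iff_lt_or_eq.1 hq' with hq' | rfl
      · rw [hq q hq', hr q hq']
      · rw [hzj, hz]

/-- A bound on the number of representatives for `M` labels: the bound of
`card_le_of_not_dominates` for the `2 * M` classes of positions in a sorted sequence. -/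
def repBound (M : ℕ) : ℕ := M * 2 ^ (2 * M * M * (2 * M * M) * 4)

/-- All candidates that are kept fit below the bound, since a sorted sequence has at most `2 * M`
classes of positions. -/
theorem Extending.card_le {M m : ℕ} {x : ℕ → ℕ}
    (h : Extending T d L (m + 1) j cur cnt new cnt' P)
    (hT : TournamentOn T (m + 1)) (hx : SortedBy T d M m x) (hM : 0 < M)
    (hL : ∀ a z, L a z → z < M) : cnt' ≤ repBound M := by
  obtain ⟨κ, hκ, hκ'⟩ := hx.exists_classes hT hM
  refine card_le_of_not_dominates (j := j + 1) (q := j) (by omega)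
    (fun r hr a ha => hL a _ ((h.good r hr).mem a ha)) (fun a _ => hκ a)
    (fun a ha a' ha' haa r hr hjr => hκ' a a' haa r hr (by omega) (by omega)) h.distinct

/-- The labels of the last position of good labellings are found in the rows for the whole
sequence. -/
theorem Represent.exists_last_iff (h : Represent T d L (j + 1) (j + 1) cur cnt) (z : ℕ) :
    (∃ r < cnt, cur r j = z) ↔ ∃ ℓ, GoodOn T d L (Set.Iio (j + 1)) ℓ ∧ ℓ j = z := by
  constructor
  · rintro ⟨r, hr, hz⟩
    exact ⟨cur r, h.good r hr, hz⟩
  · rintro ⟨ℓ, hℓ, hz⟩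
    obtain ⟨r, hr, ℓ', -, h2, h3⟩ := h.complete ℓ hℓ
    refine ⟨r, hr, ?_⟩
    rw [← h3 j (by omega), ← hz]
    simpa using h2

end Stage

/-- Good labellings are transported along injections. -/
theorem exists_goodOn_image_iff {V W Λ : Type} [Nonempty Λ] {T : W → W → Prop} {d : Λ → Λ → Prop}
    {L : W → Λ → Prop} (f : V → W) {S : Set V} (hf : Set.InjOn f S) {q : V} (hq : q ∈ S) (z : Λ) :
    (∃ y, GoodOn T d L (f '' S) y ∧ y (f q) = z) ↔
      ∃ ℓ, GoodOn (fun a b => T (f a) (f b)) d (fun a => L (f a)) S ℓ ∧ ℓ q = z := by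
  classical
  constructor
  · rintro ⟨y, hy, hz⟩
    exact ⟨fun a => y (f a), ⟨fun v hv => hy.mem _ ⟨v, hv, rfl⟩, fun a ha b hb c hc =>
      hy.no_triangle _ ⟨a, ha, rfl⟩ _ ⟨b, hb, rfl⟩ _ ⟨c, hc, rfl⟩⟩, hz⟩
  · rintro ⟨ℓ, hℓ, hz⟩
    let y : W → Λ := fun x => if h : ∃ v ∈ S, f v = x then ℓ h.choose else Classical.arbitrary Λ
    have hy : ∀ v ∈ S, y (f v) = ℓ v := by
      intro v hv
      have h : ∃ v' ∈ S, f v' = f v := ⟨v, hv, rfl⟩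
      simp only [y, dif_pos h]
      rw [hf h.choose_spec.1 hv h.choose_spec.2]
    have hR : ∀ a ∈ S, ∀ b ∈ S, Reorient T d y (f a) (f b) ↔
        Reorient (fun a b => T (f a) (f b)) d ℓ a b := by
      intro a ha b hb
      simp only [Reorient, hy a ha, hy b hb]
    refine ⟨y, ⟨?_, ?_⟩, (hy q hq).trans hz⟩
    · rintro _ ⟨v, hv, rfl⟩
      rw [hy v hv]
      exact hℓ.mem v hv
    · rintro _ ⟨a, ha, rfl⟩ _ ⟨b, hb, rfl⟩ _ ⟨c, hc, rfl⟩
      rw [hR a ha b hb, hR b hb c hc, hR c hc a ha]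
      exact hℓ.no_triangle a ha b hb c hc

/-- When every vertex of the sequence moves to the position given by its score, the sequence
becomes sorted. -/
theorem GoodOn.sortedBy_of_score {T d L : ℕ → ℕ → Prop} {e M : ℕ} {ℓ seq seq' : ℕ → ℕ}
    (hT : TournamentOn (fun a b => T (seq a) (seq b)) e) (hd : ∀ x y, d x y → d y x)
    (hL : ∀ a z, L a z → z < M)
    (h : GoodOn (fun a b => T (seq a) (seq b)) d L (Set.Iio e) ℓ)
    (hseq : ∀ q < e, seq' (score (Reorient (fun a b => T (seq a) (seq b)) d ℓ) e q) = seq q)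
    (hinj : Set.InjOn seq (Set.Iio e)) :
    (∃ x, SortedBy (fun a b => T (seq' a) (seq' b)) d M e x) ∧
      seq' '' Set.Iio e = seq '' Set.Iio e ∧ Set.InjOn seq' (Set.Iio e) := by
  set σ := score (Reorient (fun a b => T (seq a) (seq b)) d ℓ) e with hσ
  have hσinj : Set.InjOn σ (Set.Iio e) := h.score_injOn hT hd
  have hirr : ∀ a < e, ¬ Reorient (fun a b => T (seq a) (seq b)) d ℓ a a := by
    rintro a ha (⟨-, h⟩ | ⟨-, h⟩) <;> exact hT.irrefl a ha h
  have hσlt : Set.MapsTo σ (Set.Iio e) (Set.Iio e) := fun q hq => score_lt hq (hirr q hq)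
  have hσsurj : Set.SurjOn σ (Set.Iio e) (Set.Iio e) := by
    have := Finset.surjOn_of_injOn_of_card_le σ (s := Finset.range e) (t := Finset.range e)
      (by simpa using hσlt) (by simpa using hσinj) le_rfl
    simpa using this
  refine ⟨⟨fun q => ℓ (Function.invFunOn σ (Set.Iio e) q), ?_, ?_⟩, ?_, ?_⟩
  · intro a ha
    exact hL _ _ (h.mem _ (Function.invFunOn_mem (hσsurj ha)))
  · intro c hc a hac
    obtain ⟨c₀, hc₀, rfl⟩ := hσsurj hc
    obtain ⟨a₀, ha₀, rfl⟩ := hσsurj (show a ∈ Set.Iio e from hac.trans hc)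
    have hR := (h.score_lt_score hT hd ha₀ hc₀ (fun e => by subst e; exact lt_irrefl _ hac)).1 hac
    have hinv : ∀ q ∈ Set.Iio e, Function.invFunOn σ (Set.Iio e) (σ q) = q := fun q hq =>
      hσinj (Function.invFunOn_mem ⟨q, hq, rfl⟩) hq (Function.invFunOn_eq ⟨q, hq, rfl⟩)
    simp only [Reorient, hinv c₀ hc₀, hinv a₀ ha₀, hseq c₀ hc₀, hseq a₀ ha₀] at hR ⊢
    exact hR
  · ext x
    constructor
    · rintro ⟨q, hq, rfl⟩
      obtain ⟨q₀, hq₀, rfl⟩ := hσsurj hq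
      exact ⟨q₀, hq₀, (hseq q₀ hq₀).symm⟩
    · rintro ⟨q, hq, rfl⟩
      exact ⟨σ q, hσlt hq, hseq q hq⟩
  · intro a ha b hb hab
    obtain ⟨a₀, ha₀, rfl⟩ := hσsurj ha
    obtain ⟨b₀, hb₀, rfl⟩ := hσsurj hb
    rw [hseq a₀ ha₀, hseq b₀ hb₀] at hab
    rw [hinj ha₀ hb₀ hab]

/-! ### Decycling families and labels -/

/-- The inner product over `𝔽₂` of the first `t` binary digits of `x` and of `y`. -/
def dotBit : ℕ → ℕ → ℕ → Bool
  | 0, _, _ => false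
  | t + 1, x, y => Bool.xor (dotBit t x y) (x.testBit t && y.testBit t)

/-- The labels `x` and `y` below `2 ^ k` have inner product `1`. -/
def DotRel (k x y : ℕ) : Prop := x < 2 ^ k ∧ y < 2 ^ k ∧ dotBit k x y = true

theorem dotBit_comm (t x y : ℕ) : dotBit t x y = dotBit t y x := by
  induction t with
  | zero => rfl
  | succ t ih => simp only [dotBit, ih, Bool.and_comm]

theorem DotRel.symm {k x y : ℕ} (h : DotRel k x y) : DotRel k y x :=
  ⟨h.2.1, h.1, dotBit_comm k x y ▸ h.2.2⟩

namespace DirGraph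

variable {V : Type} [DecidableEq V] (D : DirGraph V)

/-- A pair of vertices is reversed once for every set that contains both ends. -/
theorem mult_invertAll_range {Y : ℕ → Finset V} {y : V → ℕ} {k : ℕ}
    (h : ∀ t < k, ∀ u, u ∈ Y t ↔ (y u).testBit t = true) (u v : V) :
    (D.invertAll ((List.range k).map Y)).mult u v =
      if dotBit k (y u) (y v) then D.mult v u else D.mult u v := by
  induction k generalizing u v with
  | zero => simp [invertAll, dotBit]
  | succ k ih =>
    have ih' := ih fun t ht => h t (by omega)
    simp only [invertAll] at ih' ⊢
    simp only [List.range_succ, List.map_append, List.map_cons, List.map_nil, List.foldl_append,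
      List.foldl_cons, List.foldl_nil, invert, ih', h k (by omega), dotBit, dotBit_comm k (y v)]
    by_cases h1 : dotBit k (y u) (y v) = true <;> by_cases h2 : (y u).testBit k = true <;>
      by_cases h3 : (y v).testBit k = true <;> simp [h1, h2, h3]

theorem invert_empty : D.invert ∅ = D := by
  simp [invert]

/-- A family of at most `k` sets is padded with empty sets to a family of size `k`. -/
theorem invertAll_range_getD (Ys : List (Finset V)) {k : ℕ} (hk : Ys.length ≤ k) :
    D.invertAll ((List.range k).map fun t => Ys.getD t ∅) = D.invertAll Ys := by
  induction k, hk using Nat.le_induction with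
  | base =>
    congr 1
    refine List.ext_getElem (by simp) fun i h1 h2 => ?_
    simp [h2]
  | succ k hk ih =>
    have : Ys.getD k ∅ = ∅ := by simp [hk]
    unfold invertAll at ih ⊢
    simp only [List.range_succ, List.map_append, List.map_cons, List.map_nil, List.foldl_append,
      List.foldl_cons, List.foldl_nil, ih, this, invert_empty]

/-- Tuples of `k` vertex sets correspond to labellings by numbers below `2 ^ k`: the binary digit
number `t` of a label tells whether the vertex belongs to the set number `t`. -/
theorem invLE_iff_exists_label [Fintype V] {k : ℕ} : D.InvLE k ↔ ∃ y : V → ℕ, (∀ v, y v < 2 ^ k) ∧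
    ∀ v, ¬ Relation.TransGen (Reorient D.Arc (DotRel k) y) v v := by
  have key : ∀ (Y : ℕ → Finset V) (y : V → ℕ), (∀ v, y v < 2 ^ k) →
      (∀ t < k, ∀ u, u ∈ Y t ↔ (y u).testBit t = true) →
      (D.invertAll ((List.range k).map Y)).Arc = Reorient D.Arc (DotRel k) y := by
    intro Y y hy h
    funext u v
    unfold Arc
    rw [D.mult_invertAll_range h]
    cases hd : dotBit k (y u) (y v) <;> simp [Reorient, DotRel, hy, hd]
  constructor
  · rintro ⟨Ys, hlen, hac⟩
    have hac' : (D.invertAll ((List.range k).map fun t => Ys.getD t ∅)).Acyclic := by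
      rwa [D.invertAll_range_getD Ys hlen]
    let y : V → ℕ := fun u => Nat.ofBits fun i : Fin k => decide (u ∈ Ys.getD i ∅)
    have hy : ∀ v, y v < 2 ^ k := fun v => Nat.ofBits_lt_two_pow _
    refine ⟨y, hy, ?_⟩
    unfold Acyclic at hac'
    rwa [key _ y hy fun t ht u => by
      rw [Nat.testBit_ofBits_lt _ _ ht, decide_eq_true_iff]] at hac'
  · rintro ⟨y, hy, hac⟩
    refine ⟨(List.range k).map fun t => Finset.univ.filter fun u => (y u).testBit t = true,
      by simp, ?_⟩
    unfold IsDecyclingFamily Acyclic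
    rwa [key _ _ hy fun t _ u => by simp]

theorem reorient_or_iff {k : ℕ} {y : V → ℕ} {u v : V} :
    Reorient D.Arc (DotRel k) y u v ∨ Reorient D.Arc (DotRel k) y v u ↔
      D.Arc u v ∨ D.Arc v u := by
  have : DotRel k (y u) (y v) ↔ DotRel k (y v) (y u) := ⟨DotRel.symm, DotRel.symm⟩
  unfold Reorient
  tauto

/-- On block graphs without loops and opposite arcs, a decycling family amounts to a labelling
without directed triangles. Loops and opposite arcs survive every inversion. -/
theorem invLE_iff_exists_goodOn [Fintype V] (hG : D.underlying.IsBlockGraph) {k : ℕ} :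
    D.InvLE k ↔ (∀ u v, ¬ (D.Arc u v ∧ D.Arc v u)) ∧
      ∃ y, GoodOn D.Arc (DotRel k) (fun _ z => z < 2 ^ k) Set.univ y := by
  have hsymm : ∀ (y : V → ℕ) u v, DotRel k (y u) (y v) ↔ DotRel k (y v) (y u) :=
    fun _ _ _ => ⟨DotRel.symm, DotRel.symm⟩
  rw [invLE_iff_exists_label]
  constructor
  · rintro ⟨y, hy, hac⟩
    refine ⟨fun u v ⟨h1, h2⟩ => hac u ?_, y, ⟨fun v _ => hy v, ?_⟩⟩
    · have : Reorient D.Arc (DotRel k) y u v ∧ Reorient D.Arc (DotRel k) y v u := by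
        have := hsymm y u v
        unfold Reorient
        tauto
      exact .tail (.single this.1) this.2
    · rintro a - b - c - ⟨h1, h2, h3⟩
      exact hac a (.tail (.tail (.single h1) h2) h3)
  · rintro ⟨h2, y, hy⟩
    refine ⟨y, fun v => hy.mem v trivial, acyclic_of_no_triangle hG ?_ ?_ ?_ ?_⟩
    · intro u v h
      refine (SimpleGraph.fromRel_adj _ _ _).2 ⟨?_, D.reorient_or_iff.1 (Or.inl h)⟩
      rintro rfl
      rcases D.reorient_or_iff.1 (Or.inl h) with h' | h' <;> exact h2 _ _ ⟨h', h'⟩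
    · intro u v h
      exact D.reorient_or_iff.2 ((SimpleGraph.fromRel_adj _ _ _).1 h).2
    · intro u v h h'
      have := hsymm y u v
      have := h2 u v
      unfold Reorient at h h'
      tauto
    · intro u v w huv hvw hwu
      exact hy.no_triangle u trivial v trivial w trivial ⟨huv, hvw, hwu⟩

end DirGraph

/-! ### A structured language with bounded loops -/

/-- Expressions over variables `ν` and two-dimensional arrays `α`. Their only loops are the
bounded sums, so that evaluation is total and has no side effects. -/
inductive Expr (ν α : Type) : Type where
  | const (c : ℕ)
  | var (x : ν)
  | add (e f : Expr ν α)
  | sub (e f : Expr ν α)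
  /-- `if c ≠ 0 then e else f` -/
  | ite (c e f : Expr ν α)
  /-- the cell of the array `a` with indices `e` and `f` -/
  | get (a : α) (e f : Expr ν α)
  /-- `1` if the input word with index `e` is not `0`, and `0` otherwise -/
  | inp (e : Expr ν α)
  /-- the sum of `b` over all values of `x` below the value of the variable `y` -/
  | sum (x y : ν) (b : Expr ν α)

/-- The values of the variables and of the array cells. -/
structure Store (ν α : Type) where
  v : ν → ℕ
  m : α → ℕ → ℕ → ℕ

/-- Commands. All loops are bounded, so that every command terminates. -/
inductive Cmd (ν α : Type) : Type where
  | skip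
  | assign (x : ν) (e : Expr ν α)
  /-- write the value of `g` into the cell of `a` with indices `e` and `f` -/
  | put (a : α) (e f g : Expr ν α)
  | seq (p q : Cmd ν α)
  | ite (e : Expr ν α) (p q : Cmd ν α)
  /-- run `p` for all values of `x` below the value that `y` has at the start -/
  | loop (x y : ν) (p : Cmd ν α)

section Language

variable {ν α : Type} [DecidableEq ν] [DecidableEq α]

namespace Store

/-- Change the value of the variable `x` to `i`. -/
def setV (s : Store ν α) (x : ν) (i : ℕ) : Store ν α := ⟨Function.update s.v x i, s.m⟩

/-- Change the cell `(i, j)` of the array `a` to `c`. -/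
def setM (s : Store ν α) (a : α) (i j c : ℕ) : Store ν α :=
  ⟨s.v, Function.update s.m a (Function.update (s.m a) i (Function.update (s.m a i) j c))⟩

/-- All values are at most `N`. -/
structure Bounded (N : ℕ) (s : Store ν α) : Prop where
  v_le : ∀ x, s.v x ≤ N
  m_le : ∀ a i j, s.m a i j ≤ N

theorem Bounded.setV {N : ℕ} {s : Store ν α} (h : s.Bounded N) (x : ν) {i : ℕ} (hi : i ≤ N) :
    (s.setV x i).Bounded N := by
  refine ⟨fun y => ?_, h.m_le⟩
  unfold Store.setV
  by_cases hy : y = x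
  · subst hy; simpa using hi
  · simpa [hy] using h.v_le y

theorem setM_m (s : Store ν α) (a a' : α) (i j c i' j' : ℕ) :
    (s.setM a i j c).m a' i' j' = if a' = a ∧ i' = i ∧ j' = j then c else s.m a' i' j' := by
  unfold setM
  by_cases ha : a' = a
  · subst ha
    by_cases hi : i' = i
    · subst hi
      by_cases hj : j' = j
      · subst hj; simp
      · simp [hj]
    · simp [hi]
  · simp [ha]

theorem Bounded.setM {N : ℕ} {s : Store ν α} (h : s.Bounded N) (a : α) (i j : ℕ) {c : ℕ}
    (hc : c ≤ N) : (s.setM a i j c).Bounded N := by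
  refine ⟨h.v_le, fun a' i' j' => ?_⟩
  rw [setM_m]
  split_ifs
  exacts [hc, h.m_le _ _ _]

end Store

namespace Expr

/-- The value of an expression on the input `w`. -/
def eval (w : List ℕ) : Expr ν α → Store ν α → ℕ
  | const c, _ => c
  | var x, s => s.v x
  | add e f, s => e.eval w s + f.eval w s
  | sub e f, s => e.eval w s - f.eval w s
  | ite c e f, s => if c.eval w s ≠ 0 then e.eval w s else f.eval w s
  | get a e f, s => s.m a (e.eval w s) (f.eval w s)
  | inp e, s => if w.getD (e.eval w s) 0 = 0 then 0 else 1
  | sum x y b, s => ∑ i ∈ Finset.range (s.v y), b.eval w (s.setV x i)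

/-- A bound on the value of an expression in stores bounded by `N`. -/
def valueBound : Expr ν α → ℕ → ℕ
  | const c, _ => c
  | var _, N => N
  | add e f, N => e.valueBound N + f.valueBound N
  | sub e _, N => e.valueBound N
  | ite _ e f, N => e.valueBound N + f.valueBound N
  | get _ _ _, N => N
  | inp _, _ => 1
  | sum _ _ b, N => N * b.valueBound N

theorem eval_le_valueBound (w : List ℕ) {N : ℕ} (e : Expr ν α) :
    ∀ {s : Store ν α}, s.Bounded N → e.eval w s ≤ e.valueBound N := by
  induction e with
  | const c => intro s _; exact le_rfl
  | var x => intro s hs; exact hs.v_le x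
  | add e f he hf => intro s hs; exact Nat.add_le_add (he hs) (hf hs)
  | sub e f he _ => intro s hs; exact (Nat.sub_le _ _).trans (he hs)
  | ite c e f _ he hf =>
    intro s hs
    have h1 := he hs
    have h2 := hf hs
    simp only [eval, valueBound]
    split_ifs <;> omega
  | get a e f => intro s hs; exact hs.m_le _ _ _
  | inp e => intro s _; simp only [eval, valueBound]; split_ifs <;> omega
  | sum x y b hb =>
    intro s hs
    simp only [eval, valueBound]
    calc _ ≤ ∑ _i ∈ Finset.range (s.v y), b.valueBound N := by
          refine Finset.sum_le_sum fun i hi => hb (hs.setV x ?_)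
          exact (Finset.mem_range.1 hi).le.trans (hs.v_le y)
      _ ≤ _ := by
          rw [Finset.sum_const, Finset.card_range, smul_eq_mul]
          exact Nat.mul_le_mul_right _ (hs.v_le y)

end Expr

namespace Cmd

/-- The effect of a command on the input `w`. Assignments truncate at `N`. -/
def exec (w : List ℕ) (N : ℕ) : Cmd ν α → Store ν α → Store ν α
  | skip, s => s
  | assign x e, s => s.setV x (min (e.eval w s) N)
  | put a e f g, s => s.setM a (e.eval w s) (f.eval w s) (min (g.eval w s) N)
  | seq p q, s => q.exec w N (p.exec w N s)
  | ite e p q, s => if e.eval w s ≠ 0 then p.exec w N s else q.exec w N s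
  | loop x y p, s => Nat.rec s (fun i s => p.exec w N (s.setV x i)) (s.v y)

/-- The rule for loops: `I i` describes the store after `i` iterations. -/
theorem loop_induction {w : List ℕ} {N : ℕ} {x y : ν} {p : Cmd ν α} {s : Store ν α}
    (I : ℕ → Store ν α → Prop) (h0 : I 0 s)
    (hstep : ∀ i t, i < s.v y → I i t → I (i + 1) (p.exec w N (t.setV x i))) :
    I (s.v y) ((loop x y p).exec w N s) := by
  have : ∀ n ≤ s.v y, I n (Nat.rec s (fun i s => p.exec w N (s.setV x i)) n) := by
    intro n
    induction n with
    | zero => exact fun _ => h0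
    | succ n ih => exact fun hn => hstep n _ hn (ih (Nat.le_of_succ_le hn))
  exact this _ le_rfl

theorem exec_bounded {w : List ℕ} {N : ℕ} (p : Cmd ν α) :
    ∀ {s : Store ν α}, s.Bounded N → (p.exec w N s).Bounded N := by
  induction p with
  | skip => exact fun h => h
  | assign x e => exact fun h => h.setV x (min_le_right _ _)
  | put a e f g => exact fun h => h.setM a _ _ (min_le_right _ _)
  | seq p q hp hq => exact fun h => hq (hp h)
  | ite e p q hp hq =>
    intro s h
    simp only [exec]
    split_ifs
    exacts [hp h, hq h]
  | loop x y p hp =>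
    intro s h
    refine loop_induction (fun _ t => t.Bounded N) h fun i t hi ht => hp (ht.setV x ?_)
    exact hi.le.trans (h.v_le y)

end Cmd

/-! ### Polynomial bounds -/

/-- `f` is bounded by a polynomial, on the positive integers. -/
def PolyBounded (f : ℕ → ℕ) : Prop := ∃ K, ∀ N, 1 ≤ N → f N ≤ K * N ^ K

namespace PolyBounded

theorem const (c : ℕ) : PolyBounded fun _ => c :=
  ⟨c, fun _ hN => Nat.le_mul_of_pos_right _ (Nat.pow_pos hN)⟩

theorem id : PolyBounded fun N => N := ⟨1, fun N _ => by simp⟩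

theorem add {f g : ℕ → ℕ} (hf : PolyBounded f) (hg : PolyBounded g) :
    PolyBounded fun N => f N + g N := by
  obtain ⟨K, hK⟩ := hf
  obtain ⟨K', hK'⟩ := hg
  refine ⟨K + K', fun N hN => ?_⟩
  rw [Nat.add_mul]
  exact Nat.add_le_add
    ((hK N hN).trans (Nat.mul_le_mul_left _ (Nat.pow_le_pow_right hN (by omega))))
    ((hK' N hN).trans (Nat.mul_le_mul_left _ (Nat.pow_le_pow_right hN (by omega))))

theorem mul {f g : ℕ → ℕ} (hf : PolyBounded f) (hg : PolyBounded g) :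
    PolyBounded fun N => f N * g N := by
  obtain ⟨K, hK⟩ := hf
  obtain ⟨K', hK'⟩ := hg
  refine ⟨K * K' + K + K', fun N hN => ?_⟩
  calc f N * g N ≤ (K * N ^ K) * (K' * N ^ K') := Nat.mul_le_mul (hK N hN) (hK' N hN)
    _ = (K * K') * N ^ (K + K') := by ring
    _ ≤ _ := Nat.mul_le_mul (by omega) (Nat.pow_le_pow_right hN (by omega))

end PolyBounded

namespace Expr

theorem polyBounded_valueBound (e : Expr ν α) : PolyBounded e.valueBound := by
  induction e with
  | const c => exact .const c
  | var x => exact .id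
  | add e f he hf => exact he.add hf
  | sub e f he _ => exact he
  | ite c e f _ he hf => exact he.add hf
  | get a e f => exact .id
  | inp e => exact .const 1
  | sum x y b hb => exact PolyBounded.id.mul hb

/-- A bound on the time for the computation of an address from indices at most `i` and `j`. -/
def addrTime (c i j : ℕ) : ℕ :=
  3 * (i + j) + 3 * ((i + j) * (i + j) + (i + j) + j + c) + 20

/-- A bound on the time for the evaluation of an expression in stores bounded by `N`. -/
def time (ca : α → ℕ) : Expr ν α → ℕ → ℕ
  | const _, _ => 1
  | var _, _ => 1
  | add e f, N => e.time ca N + f.time ca N + 1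
  | sub e f, N => e.time ca N + f.time ca N + 1
  | ite c e f, N => c.time ca N + e.time ca N + f.time ca N + 1
  | get a e f, N =>
    e.time ca N + f.time ca N + addrTime (ca a) (e.valueBound N) (f.valueBound N) + 1
  | inp e, N => e.time ca N + 10
  | sum _ _ b, N => N * (b.time ca N + 4) + 6

theorem polyBounded_addrTime (c : ℕ) {f g : ℕ → ℕ} (hf : PolyBounded f) (hg : PolyBounded g) :
    PolyBounded fun N => addrTime c (f N) (g N) :=
  (((PolyBounded.const 3).mul (hf.add hg)).add ((PolyBounded.const 3).mul
    (((((hf.add hg).mul (hf.add hg)).add (hf.add hg)).add hg).add (.const c)))).add (.const 20)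

theorem polyBounded_time (ca : α → ℕ) (e : Expr ν α) : PolyBounded (e.time ca) := by
  induction e with
  | const c => exact .const 1
  | var x => exact .const 1
  | add e f he hf => exact (he.add hf).add (.const 1)
  | sub e f he hf => exact (he.add hf).add (.const 1)
  | ite c e f hc he hf => exact ((hc.add he).add hf).add (.const 1)
  | get a e f he hf =>
    exact ((he.add hf).add (polyBounded_addrTime _ e.polyBounded_valueBound
      f.polyBounded_valueBound)).add (.const 1)
  | inp e he => exact he.add (.const 10)
  | sum x y b hb => exact (PolyBounded.id.mul (hb.add (.const 4))).add (.const 6)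

end Expr

namespace Cmd

/-- A bound on the running time of a command in stores bounded by `N`. -/
def time (ca : α → ℕ) : Cmd ν α → ℕ → ℕ
  | skip, _ => 1
  | assign _ e, N => e.time ca N + 3
  | put a e f g, N => e.time ca N + f.time ca N + g.time ca N +
      Expr.addrTime (ca a) (e.valueBound N) (f.valueBound N) + 3
  | seq p q, N => p.time ca N + q.time ca N
  | ite e p q, N => e.time ca N + p.time ca N + q.time ca N + 1
  | loop _ _ p, N => N * (p.time ca N + 4) + 3

theorem polyBounded_time (ca : α → ℕ) (p : Cmd ν α) : PolyBounded (p.time ca) := by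
  induction p with
  | skip => exact .const 1
  | assign x e => exact (e.polyBounded_time ca).add (.const 3)
  | put a e f g =>
    exact ((((e.polyBounded_time ca).add (f.polyBounded_time ca)).add (g.polyBounded_time ca)).add
      (Expr.polyBounded_addrTime _ e.polyBounded_valueBound f.polyBounded_valueBound)).add
        (.const 3)
  | seq p q hp hq => exact hp.add hq
  | ite e p q hp hq => exact (((e.polyBounded_time ca).add hp).add hq).add (.const 1)
  | loop x y p hp => exact (PolyBounded.id.mul (hp.add (.const 4))).add (.const 3)

end Cmd

/-! ### Compilation to the random access machine -/

/-- Triangular numbers. -/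
def tri : ℕ → ℕ
  | 0 => 0
  | n + 1 => tri n + (n + 1)

theorem tri_mono {m n : ℕ} (h : m ≤ n) : tri m ≤ tri n := by
  induction h with
  | refl => exact le_rfl
  | step _ ih => exact ih.trans (Nat.le_add_right _ _)

theorem tri_le (n : ℕ) : tri n ≤ n * n + n := by
  induction n with
  | zero => simp [tri]
  | succ n ih => simp only [tri]; nlinarith

/-- Cantor's pairing function is injective. -/
theorem tri_add_injective {i j i' j' : ℕ} (h : tri (i + j) + j = tri (i' + j') + j') :
    i = i' ∧ j = j' := by
  have key : ∀ {a b c d : ℕ}, a + b < c + d → tri (a + b) + b < tri (c + d) + d := by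
    intro a b c d hlt
    have h1 : tri (a + b + 1) ≤ tri (c + d) := tri_mono hlt
    simp only [tri] at h1
    omega
  rcases lt_trichotomy (i + j) (i' + j') with hlt | heq | hlt
  · exact absurd h (key hlt).ne
  · rw [heq] at h; omega
  · exact absurd h (key hlt).ne'

/-- The address, relative to the end of the input, of the cell `(i, j)` of the array with
number `c`: Cantor's pairing function, twice. -/
def addr (c i j : ℕ) : ℕ := tri (tri (i + j) + j + c) + c

theorem addr_injective {c i j c' i' j' : ℕ} (h : addr c i j = addr c' i' j') :
    c = c' ∧ i = i' ∧ j = j' := by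
  obtain ⟨h1, h2⟩ := tri_add_injective h
  exact ⟨h2, tri_add_injective h1⟩

namespace RamProg

/-- `p` halts in `s'` after at most `T` steps. -/
def HaltsIn (p : RamProg) (s : RamState) (T : ℕ) (s' : RamState) : Prop :=
  ∃ t ≤ T, p.Runs s t s'

theorem HaltsIn.mono {p : RamProg} {s s' : RamState} {T T' : ℕ} (h : p.HaltsIn s T s')
    (hT : T ≤ T') : p.HaltsIn s T' s' := by
  obtain ⟨t, ht, hr⟩ := h
  exact ⟨t, ht.trans hT, hr⟩

theorem HaltsIn.seq {p q : RamProg} {s s' s'' : RamState} {T T' : ℕ} (h : p.HaltsIn s T s')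
    (h' : q.HaltsIn s' T' s'') : (p.seq q).HaltsIn s (T + T') s'' := by
  obtain ⟨t, ht, hr⟩ := h
  obtain ⟨t', ht', hr'⟩ := h'
  exact ⟨t + t', Nat.add_le_add ht ht', .seq hr hr'⟩

theorem haltsIn_const (x c : ℕ) (s : RamState) : (const x c).HaltsIn s 1 (s.setReg x c) :=
  ⟨1, le_rfl, .const x c s⟩

theorem haltsIn_add (x y z : ℕ) (s : RamState) :
    (add x y z).HaltsIn s 1 (s.setReg x (s.reg y + s.reg z)) := ⟨1, le_rfl, .add x y z s⟩

theorem haltsIn_sub (x y z : ℕ) (s : RamState) :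
    (sub x y z).HaltsIn s 1 (s.setReg x (s.reg y - s.reg z)) := ⟨1, le_rfl, .sub x y z s⟩

theorem haltsIn_load (x y : ℕ) (s : RamState) :
    (load x y).HaltsIn s 1 (s.setReg x (s.mem (s.reg y))) := ⟨1, le_rfl, .load x y s⟩

theorem haltsIn_store (x y : ℕ) (s : RamState) :
    (store x y).HaltsIn s 1 (s.setMem (s.reg x) (s.reg y)) := ⟨1, le_rfl, .store x y s⟩

theorem HaltsIn.ifTrue {x : ℕ} {p q : RamProg} {s s' : RamState} {T : ℕ} (hx : s.reg x ≠ 0)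
    (h : p.HaltsIn s T s') : (ifNZ x p q).HaltsIn s (T + 1) s' := by
  obtain ⟨t, ht, hr⟩ := h
  exact ⟨t + 1, Nat.succ_le_succ ht, .ifTrue hx hr⟩

theorem HaltsIn.ifFalse {x : ℕ} {p q : RamProg} {s s' : RamState} {T : ℕ} (hx : s.reg x = 0)
    (h : q.HaltsIn s T s') : (ifNZ x p q).HaltsIn s (T + 1) s' := by
  obtain ⟨t, ht, hr⟩ := h
  exact ⟨t + 1, Nat.succ_le_succ ht, .ifFalse hx hr⟩

/-- A loop whose register `x` counts down from `n`; `I i` describes the state in which `i`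
iterations remain. -/
theorem haltsIn_countdown {x : ℕ} {p : RamProg} {T : ℕ} (I : ℕ → RamState → Prop)
    (hx : ∀ i s, I i s → s.reg x = i)
    (hstep : ∀ i s, I (i + 1) s → ∃ s', p.HaltsIn s T s' ∧ I i s') (n : ℕ) :
    ∀ s, I n s → ∃ s', (whileNZ x p).HaltsIn s (n * (T + 1) + 1) s' ∧ I 0 s' := by
  induction n with
  | zero => exact fun s h => ⟨s, ⟨1, by omega, .whileDone (hx 0 s h)⟩, h⟩
  | succ n ih =>
    intro s h
    obtain ⟨s', ⟨t, ht, hr⟩, h'⟩ := hstep n s h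
    obtain ⟨s'', ⟨t', ht', hr'⟩, h''⟩ := ih s' h'
    refine ⟨s'', ⟨t + t' + 1, ?_, .whileStep (by rw [hx _ s h]; omega) hr hr'⟩, h''⟩
    have : (n + 1) * (T + 1) = n * (T + 1) + T + 1 := by ring
    omega

/-- `s'` arises from `s` by changes in the temporary registers with number at least `d` only. -/
structure Frame (d : ℕ) (s s' : RamState) : Prop where
  mem : s'.mem = s.mem
  reg : ∀ r, (∀ d', d ≤ d' → r ≠ 5 + 2 * d') → s'.reg r = s.reg r

theorem Frame.refl (d : ℕ) (s : RamState) : Frame d s s := ⟨rfl, fun _ _ => rfl⟩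

theorem Frame.trans {d : ℕ} {s s' s'' : RamState} (h : Frame d s s') (h' : Frame d s' s'') :
    Frame d s s'' :=
  ⟨h'.mem.trans h.mem, fun r hr => (h'.reg r hr).trans (h.reg r hr)⟩

theorem Frame.mono {d e : ℕ} {s s' : RamState} (h : Frame e s s') (hd : d ≤ e) : Frame d s s' :=
  ⟨h.mem, fun r hr => h.reg r fun d' hd' => hr d' (hd.trans hd')⟩

theorem Frame.setReg {d : ℕ} {s s' : RamState} (h : Frame d s s') (e c : ℕ) (he : d ≤ e) :
    Frame d s (s'.setReg (5 + 2 * e) c) :=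
  ⟨h.mem, fun r hr => by
    rw [RamState.setReg]
    exact (Function.update_of_ne (hr e he) _ _).trans (h.reg r hr)⟩

theorem Frame.tmp {d e : ℕ} {s s' : RamState} (h : Frame d s s') (he : e < d) :
    s'.reg (5 + 2 * e) = s.reg (5 + 2 * e) := h.reg _ fun d' _ => by omega

@[simp] theorem setReg_reg_self (s : RamState) (x c : ℕ) : (s.setReg x c).reg x = c := by
  simp [RamState.setReg]

theorem setReg_reg_of_ne (s : RamState) {x y : ℕ} (c : ℕ) (h : y ≠ x) :
    (s.setReg x c).reg y = s.reg y := by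
  simp [RamState.setReg, h]

theorem setReg_reg (s : RamState) (x c y : ℕ) :
    (s.setReg x c).reg y = if y = x then c else s.reg y := by
  simp [RamState.setReg, Function.update_apply]

@[simp] theorem setReg_mem (s : RamState) (x c : ℕ) : (s.setReg x c).mem = s.mem := rfl

/-- Double register `y` as often as register `x` says. Register `3` has to hold `1`. -/
def double (x y : ℕ) : RamProg := .whileNZ x (.seq (.add y y y) (.sub x x 3))

theorem haltsIn_double {x y n c : ℕ} (hxy : x ≠ y) (hx : x ≠ 3) (hy : y ≠ 3) (s : RamState)
    (h1 : s.reg 3 = 1) (hn : s.reg x = n) (hc : s.reg y = c) :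
    ∃ s', (double x y).HaltsIn s (n * 3 + 1) s' ∧ s'.reg y = c * 2 ^ n ∧ s'.mem = s.mem ∧
      ∀ r, r ≠ x → r ≠ y → s'.reg r = s.reg r := by
  obtain ⟨s', hs', h, -⟩ := haltsIn_countdown (x := x) (p := .seq (.add y y y) (.sub x x 3))
    (T := 2) (fun i t => (t.reg y * 2 ^ i = c * 2 ^ n ∧ t.mem = s.mem ∧
      ∀ r, r ≠ x → r ≠ y → t.reg r = s.reg r) ∧ t.reg x = i) (fun i t ht => ht.2)
    (by
      rintro i t ⟨⟨hd, hm, hr⟩, hi⟩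
      refine ⟨_, (haltsIn_add y y y t).seq (haltsIn_sub x x 3 _), ⟨?_, hm, fun r hrx hry => ?_⟩, ?_⟩
      · rw [setReg_reg_of_ne _ _ hxy.symm, setReg_reg_self, ← hd]; ring
      · rw [setReg_reg_of_ne _ _ hrx, setReg_reg_of_ne _ _ hry, hr r hrx hry]
      · rw [setReg_reg_self, setReg_reg_of_ne _ _ hxy, setReg_reg_of_ne _ _ hy.symm, hi,
          hr 3 hx.symm hy.symm, h1]
        rfl)
    n s ⟨⟨by rw [hc], rfl, fun _ _ _ => rfl⟩, hn⟩
  exact ⟨s', hs', by simpa using h.1, h.2.1, h.2.2⟩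

end RamProg

open RamProg

/-- The machine state `s` represents the store `st`, on the input `w`. Register `0` holds the length
of the input, register `1` the bound `N`, and registers `2` and `3` the constants `0` and `1`;
variables have even registers, temporary values odd ones. The arrays follow the input in the
memory. -/
structure Represents (cv : ν → ℕ) (ca : α → ℕ) (w : List ℕ) (N : ℕ) (st : Store ν α)
    (s : RamState) : Prop where
  base : s.reg 0 = w.length
  bound : s.reg 1 = N
  zero : s.reg 2 = 0
  one : s.reg 3 = 1
  vars : ∀ x, s.reg (4 + 2 * cv x) = st.v x
  input : ∀ i < w.length, s.mem i = w.getD i 0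
  arrays : ∀ a i j, s.mem (w.length + addr (ca a) i j) = st.m a i j

variable {cv : ν → ℕ} {ca : α → ℕ} {w : List ℕ} {N : ℕ}

theorem Represents.frame {st : Store ν α} {s s' : RamState} {d : ℕ}
    (h : Represents cv ca w N st s) (hf : Frame d s s') : Represents cv ca w N st s' where
  base := (hf.reg 0 fun _ _ => by omega).trans h.base
  bound := (hf.reg 1 fun _ _ => by omega).trans h.bound
  zero := (hf.reg 2 fun _ _ => by omega).trans h.zero
  one := (hf.reg 3 fun _ _ => by omega).trans h.one
  vars x := (hf.reg _ fun _ _ => by omega).trans (h.vars x)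
  input i hi := hf.mem ▸ h.input i hi
  arrays a i j := hf.mem ▸ h.arrays a i j

theorem Represents.setV (hcv : Function.Injective cv) {st : Store ν α} {s : RamState}
    (h : Represents cv ca w N st s) (x : ν) (c : ℕ) :
    Represents cv ca w N (st.setV x c) (s.setReg (4 + 2 * cv x) c) where
  base := (setReg_reg_of_ne _ _ (by omega)).trans h.base
  bound := (setReg_reg_of_ne _ _ (by omega)).trans h.bound
  zero := (setReg_reg_of_ne _ _ (by omega)).trans h.zero
  one := (setReg_reg_of_ne _ _ (by omega)).trans h.one
  vars y := by
    unfold Store.setV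
    by_cases hy : y = x
    · subst hy; simp
    · have : cv y ≠ cv x := fun e => hy (hcv e)
      rw [setReg_reg_of_ne _ _ (by omega)]
      simpa [hy] using h.vars y
  input := h.input
  arrays := h.arrays

theorem Represents.setM (hca : Function.Injective ca) {st : Store ν α} {s : RamState}
    (h : Represents cv ca w N st s) (a : α) (i j c : ℕ) :
    Represents cv ca w N (st.setM a i j c) (s.setMem (w.length + addr (ca a) i j) c) where
  base := h.base
  bound := h.bound
  zero := h.zero
  one := h.one
  vars := h.vars
  input k hk := by
    simp only [RamState.setMem]
    rw [Function.update_of_ne (by omega)]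
    exact h.input k hk
  arrays a' i' j' := by
    rw [Store.setM_m]
    simp only [RamState.setMem]
    split_ifs with he
    · obtain ⟨rfl, rfl, rfl⟩ := he; simp
    · rw [Function.update_of_ne]
      · exact h.arrays a' i' j'
      · intro e
        obtain ⟨h1, h2, h3⟩ := addr_injective (Nat.add_left_cancel e)
        exact he ⟨hca h1, h2, h3⟩

/-- Compute the triangular number of temporary register `d` in temporary register `e`. -/
def triProg (d e : ℕ) : RamProg :=
  .seq (.const (5 + 2 * e) 0)
    (.whileNZ (5 + 2 * d)
      (.seq (.add (5 + 2 * e) (5 + 2 * e) (5 + 2 * d)) (.sub (5 + 2 * d) (5 + 2 * d) 3)))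

theorem haltsIn_triProg {d e : ℕ} (hde : d < e) (s : RamState) (h1 : s.reg 3 = 1) :
    ∃ s', (triProg d e).HaltsIn s (3 * s.reg (5 + 2 * d) + 2) s' ∧ s'.mem = s.mem ∧
      s'.reg (5 + 2 * e) = tri (s.reg (5 + 2 * d)) ∧
      ∀ r, r ≠ 5 + 2 * d → r ≠ 5 + 2 * e → s'.reg r = s.reg r := by
  set n := s.reg (5 + 2 * d) with hn
  obtain ⟨s', hr, h0, hm, hs, hf⟩ := haltsIn_countdown (x := 5 + 2 * d) (T := 2)
    (p := .seq (.add (5 + 2 * e) (5 + 2 * e) (5 + 2 * d)) (.sub (5 + 2 * d) (5 + 2 * d) 3))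
    (fun i t => t.reg (5 + 2 * d) = i ∧ t.mem = s.mem ∧ t.reg (5 + 2 * e) + tri i = tri n ∧
      ∀ r, r ≠ 5 + 2 * d → r ≠ 5 + 2 * e → t.reg r = s.reg r)
    (fun i t ht => ht.1) (by
      rintro i t ⟨h0, hm, hs, hf⟩
      refine ⟨_, (haltsIn_add _ _ _ _).seq (haltsIn_sub _ _ _ _), ?_, hm, ?_, ?_⟩
      · rw [setReg_reg_self, setReg_reg_of_ne _ _ (by omega), setReg_reg_of_ne _ _ (by omega), h0,
          hf 3 (by omega) (by omega), h1]
        omega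
      · rw [setReg_reg_of_ne _ _ (by omega), setReg_reg_self, h0, ← hs]
        simp only [tri]
        omega
      · intro r hr hr'
        rw [setReg_reg_of_ne _ _ hr, setReg_reg_of_ne _ _ hr', hf r hr hr']) n
    (s.setReg (5 + 2 * e) 0) ⟨setReg_reg_of_ne _ _ (by omega), rfl, by simp,
      fun r _ hr => setReg_reg_of_ne _ _ hr⟩
  refine ⟨s', ((haltsIn_const _ _ _).seq hr).mono (by omega), hm, by simpa [tri] using hs, hf⟩

/-- Compute in temporary register `d + 2` the address of an array cell whose indices are in
temporary registers `d` and `d + 1`. -/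
def addrProg (c d : ℕ) : RamProg :=
  .seq (.add (5 + 2 * d) (5 + 2 * d) (5 + 2 * (d + 1)))
    (.seq (triProg d (d + 2))
    (.seq (.add (5 + 2 * d) (5 + 2 * (d + 2)) (5 + 2 * (d + 1)))
    (.seq (.const (5 + 2 * (d + 1)) c)
    (.seq (.add (5 + 2 * d) (5 + 2 * d) (5 + 2 * (d + 1)))
    (.seq (triProg d (d + 2))
    (.seq (.add (5 + 2 * (d + 2)) (5 + 2 * (d + 2)) (5 + 2 * (d + 1)))
    (.add (5 + 2 * (d + 2)) (5 + 2 * (d + 2)) 0)))))))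

theorem haltsIn_addrProg {c d i j I J : ℕ} (s : RamState) (h1 : s.reg 3 = 1)
    (hi : s.reg (5 + 2 * d) = i) (hj : s.reg (5 + 2 * (d + 1)) = j) (hiI : i ≤ I) (hjJ : j ≤ J) :
    ∃ s', (addrProg c d).HaltsIn s (Expr.addrTime c I J) s' ∧ Frame d s s' ∧
      s'.reg (5 + 2 * (d + 2)) = s.reg 0 + addr c i j := by
  set s1 := s.setReg (5 + 2 * d) (i + j) with hs1
  have r1 : (RamProg.add (5 + 2 * d) (5 + 2 * d) (5 + 2 * (d + 1))).HaltsIn s 1 s1 := by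
    rw [hs1, ← hi, ← hj]; exact haltsIn_add _ _ _ _
  have e1 : s1.reg (5 + 2 * d) = i + j := setReg_reg_self _ _ _
  obtain ⟨s2, r2, m2, t2, f2⟩ := haltsIn_triProg (show d < d + 2 by omega) s1
    (by rw [hs1, setReg_reg_of_ne _ _ (by omega), h1])
  rw [e1] at r2 t2
  have e2 : s2.reg (5 + 2 * (d + 1)) = j := by
    rw [f2 _ (by omega) (by omega), hs1, setReg_reg_of_ne _ _ (by omega), hj]
  set s3 := s2.setReg (5 + 2 * d) (tri (i + j) + j) with hs3
  have r3 : (RamProg.add (5 + 2 * d) (5 + 2 * (d + 2)) (5 + 2 * (d + 1))).HaltsIn s2 1 s3 := by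
    rw [hs3, ← t2, ← e2]; exact haltsIn_add _ _ _ _
  set s4 := s3.setReg (5 + 2 * (d + 1)) c with hs4
  have r4 : (RamProg.const (5 + 2 * (d + 1)) c).HaltsIn s3 1 s4 := haltsIn_const _ _ _
  set s5 := s4.setReg (5 + 2 * d) (tri (i + j) + j + c) with hs5
  have e4 : s4.reg (5 + 2 * d) = tri (i + j) + j := by
    rw [hs4, setReg_reg_of_ne _ _ (by omega), hs3, setReg_reg_self]
  have e4' : s4.reg (5 + 2 * (d + 1)) = c := setReg_reg_self _ _ _
  have r5 : (RamProg.add (5 + 2 * d) (5 + 2 * d) (5 + 2 * (d + 1))).HaltsIn s4 1 s5 := by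
    have h := haltsIn_add (5 + 2 * d) (5 + 2 * d) (5 + 2 * (d + 1)) s4
    rwa [e4, e4'] at h
  have keep : ∀ r, r ≠ 5 + 2 * d → r ≠ 5 + 2 * (d + 1) → r ≠ 5 + 2 * (d + 2) →
      s5.reg r = s.reg r := by
    intro r h h' h''
    rw [hs5, setReg_reg_of_ne _ _ h, hs4, setReg_reg_of_ne _ _ h', hs3, setReg_reg_of_ne _ _ h,
      f2 r h h'', hs1, setReg_reg_of_ne _ _ h]
  have e5 : s5.reg (5 + 2 * d) = tri (i + j) + j + c := setReg_reg_self _ _ _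
  obtain ⟨s6, r6, m6, t6, f6⟩ := haltsIn_triProg (show d < d + 2 by omega) s5
    (by rw [keep 3 (by omega) (by omega) (by omega), h1])
  rw [e5] at r6 t6
  have e6 : s6.reg (5 + 2 * (d + 1)) = c := by
    rw [f6 _ (by omega) (by omega), hs5, setReg_reg_of_ne _ _ (by omega), e4']
  refine ⟨_, (r1.seq (r2.seq (r3.seq (r4.seq (r5.seq (r6.seq ((haltsIn_add _ _ _ _).seq
    (haltsIn_add _ _ _ _)))))))).mono ?_, ⟨?_, ?_⟩, ?_⟩
  · have h2 := tri_le (i + j)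
    have h3 : (i + j) * (i + j) ≤ (I + J) * (I + J) := Nat.mul_le_mul (by omega) (by omega)
    simp only [Expr.addrTime]
    omega
  · rw [setReg_mem, setReg_mem, m6, hs5, setReg_mem, hs4, setReg_mem, hs3, setReg_mem, m2, hs1,
      setReg_mem]
  · intro r hr
    have h := hr d le_rfl
    have h' := hr (d + 1) (by omega)
    have h'' := hr (d + 2) (by omega)
    rw [setReg_reg_of_ne _ _ h'', setReg_reg_of_ne _ _ h'', f6 r h h'', keep r h h' h'']
  · rw [setReg_reg_self, setReg_reg_self, setReg_reg_of_ne _ _ (by omega), t6, e6,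
      f6 0 (by omega) (by omega), keep 0 (by omega) (by omega) (by omega), addr]
    omega

namespace Expr

/-- The program that leaves the value of an expression in temporary register `d`, without changing
the temporary registers below `d`. -/
def compile (cv : ν → ℕ) (ca : α → ℕ) : Expr ν α → ℕ → RamProg
  | const c, d => .const (5 + 2 * d) c
  | var x, d => .add (5 + 2 * d) (4 + 2 * cv x) 2
  | add e f, d => .seq (e.compile cv ca d) (.seq (f.compile cv ca (d + 1))
      (.add (5 + 2 * d) (5 + 2 * d) (5 + 2 * (d + 1))))
  | sub e f, d => .seq (e.compile cv ca d) (.seq (f.compile cv ca (d + 1))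
      (.sub (5 + 2 * d) (5 + 2 * d) (5 + 2 * (d + 1))))
  | ite c e f, d => .seq (c.compile cv ca d)
      (.ifNZ (5 + 2 * d) (e.compile cv ca d) (f.compile cv ca d))
  | get a e f, d => .seq (e.compile cv ca d) (.seq (f.compile cv ca (d + 1))
      (.seq (addrProg (ca a) d) (.load (5 + 2 * d) (5 + 2 * (d + 2)))))
  | inp e, d => .seq (e.compile cv ca d) (.seq (.sub (5 + 2 * (d + 1)) 0 (5 + 2 * d))
      (.ifNZ (5 + 2 * (d + 1))
        (.seq (.load (5 + 2 * d) (5 + 2 * d))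
          (.ifNZ (5 + 2 * d) (.const (5 + 2 * d) 1) (.const (5 + 2 * d) 0)))
        (.const (5 + 2 * d) 0)))
  | sum x y b, d => .seq (.const (5 + 2 * d) 0) (.seq (.add (5 + 2 * (d + 1)) (4 + 2 * cv y) 2)
      (.seq (.add (5 + 2 * (d + 2)) (4 + 2 * cv x) 2) (.seq (.const (4 + 2 * cv x) 0)
      (.seq (.whileNZ (5 + 2 * (d + 1)) (.seq (b.compile cv ca (d + 3))
        (.seq (.add (5 + 2 * d) (5 + 2 * d) (5 + 2 * (d + 3)))
        (.seq (.add (4 + 2 * cv x) (4 + 2 * cv x) 3)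
          (.sub (5 + 2 * (d + 1)) (5 + 2 * (d + 1)) 3)))))
      (.add (4 + 2 * cv x) (5 + 2 * (d + 2)) 2)))))

/-- The compiled expression computes the value, within the time bound, and touches only temporary
registers; a bounded sum restores its variable. -/
theorem haltsIn_compile (hcv : Function.Injective cv) (e : Expr ν α) :
    ∀ (d : ℕ) {st : Store ν α} {s : RamState}, Represents cv ca w N st s → st.Bounded N →
      ∃ s', (e.compile cv ca d).HaltsIn s (e.time ca N) s' ∧ Frame d s s' ∧
        s'.reg (5 + 2 * d) = e.eval w st := by
  induction e with
  | const c =>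
    intro d st s _ _
    exact ⟨_, haltsIn_const _ _ _, (Frame.refl d s).setReg d c le_rfl, setReg_reg_self _ _ _⟩
  | var x =>
    intro d st s h _
    refine ⟨_, haltsIn_add _ _ _ _, (Frame.refl d s).setReg d _ le_rfl, ?_⟩
    rw [setReg_reg_self, h.vars, h.zero]; rfl
  | add e f he hf =>
    intro d st s h hb
    obtain ⟨s1, r1, f1, v1⟩ := he d h hb
    obtain ⟨s2, r2, f2, v2⟩ := hf (d + 1) (h.frame f1) hb
    refine ⟨_, (r1.seq (r2.seq (haltsIn_add _ _ _ _))).mono (by simp only [time]; omega),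
      (f1.trans (f2.mono (by omega))).setReg d _ le_rfl, ?_⟩
    rw [setReg_reg_self, f2.tmp (by omega), v1, v2]; rfl
  | sub e f he hf =>
    intro d st s h hb
    obtain ⟨s1, r1, f1, v1⟩ := he d h hb
    obtain ⟨s2, r2, f2, v2⟩ := hf (d + 1) (h.frame f1) hb
    refine ⟨_, (r1.seq (r2.seq (haltsIn_sub _ _ _ _))).mono (by simp only [time]; omega),
      (f1.trans (f2.mono (by omega))).setReg d _ le_rfl, ?_⟩
    rw [setReg_reg_self, f2.tmp (by omega), v1, v2]; rfl
  | ite c e f hc he hf =>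
    intro d st s h hb
    obtain ⟨s1, r1, f1, v1⟩ := hc d h hb
    by_cases h0 : c.eval w st = 0
    · obtain ⟨s2, r2, f2, v2⟩ := hf d (h.frame f1) hb
      refine ⟨_, (r1.seq (r2.ifFalse (v1.trans h0))).mono (by simp only [time]; omega),
        f1.trans f2, ?_⟩
      rw [v2]; simp [eval, h0]
    · obtain ⟨s2, r2, f2, v2⟩ := he d (h.frame f1) hb
      refine ⟨_, (r1.seq (r2.ifTrue (by rwa [v1]))).mono (by simp only [time]; omega),
        f1.trans f2, ?_⟩
      rw [v2]; simp [eval, h0]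
  | get a e f he hf =>
    intro d st s h hb
    obtain ⟨s1, r1, f1, v1⟩ := he d h hb
    obtain ⟨s2, r2, f2, v2⟩ := hf (d + 1) (h.frame f1) hb
    have h2 := (h.frame f1).frame f2
    obtain ⟨s3, r3, f3, v3⟩ := haltsIn_addrProg (c := ca a) (d := d) s2 h2.one
      ((f2.tmp (by omega)).trans v1) v2 (e.eval_le_valueBound w hb) (f.eval_le_valueBound w hb)
    refine ⟨_, (r1.seq (r2.seq (r3.seq (haltsIn_load _ _ _)))).mono (by simp only [time]; omega),
      ((f1.trans (f2.mono (by omega))).trans f3).setReg d _ le_rfl, ?_⟩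
    rw [setReg_reg_self, v3, h2.base, (h2.frame f3).arrays]; rfl
  | inp e he =>
    intro d st s h hb
    obtain ⟨s1, r1, f1, v1⟩ := he d h hb
    set i := e.eval w st with hi
    have h1 := h.frame f1
    set s2 := s1.setReg (5 + 2 * (d + 1)) (w.length - i) with hs2
    have r2 : (RamProg.sub (5 + 2 * (d + 1)) 0 (5 + 2 * d)).HaltsIn s1 1 s2 := by
      have := haltsIn_sub (5 + 2 * (d + 1)) 0 (5 + 2 * d) s1
      rwa [v1, h1.base] at this
    have f2 : Frame d s s2 := f1.setReg (d + 1) _ (by omega)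
    have v2 : s2.reg (5 + 2 * d) = i := by rw [hs2, setReg_reg_of_ne _ _ (by omega), v1]
    have v2' : s2.reg (5 + 2 * (d + 1)) = w.length - i := setReg_reg_self _ _ _
    have heval : (inp e : Expr ν α).eval w st = if w.getD i 0 = 0 then 0 else 1 := rfl
    rw [heval]
    by_cases hlt : i < w.length
    · have r3 := haltsIn_load (5 + 2 * d) (5 + 2 * d) s2
      rw [v2, (h.frame f2).input i hlt] at r3
      have f3 := f2.setReg d (w.getD i 0) le_rfl
      by_cases h0 : w.getD i 0 = 0
      · refine ⟨_, (r1.seq (r2.seq (HaltsIn.ifTrue (by rw [v2']; omega) (r3.seq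
          (HaltsIn.ifFalse (by rw [setReg_reg_self, h0]) (haltsIn_const _ _ _)))))).mono
          (by simp only [time]; omega), f3.setReg d 0 le_rfl, ?_⟩
        rw [setReg_reg_self, if_pos h0]
      · refine ⟨_, (r1.seq (r2.seq (HaltsIn.ifTrue (by rw [v2']; omega) (r3.seq
          (HaltsIn.ifTrue (by rwa [setReg_reg_self]) (haltsIn_const _ _ _)))))).mono
          (by simp only [time]; omega), f3.setReg d 1 le_rfl, ?_⟩
        rw [setReg_reg_self, if_neg h0]
    · have h0 : w.getD i 0 = 0 := by
        rw [List.getD_eq_getElem?_getD, List.getElem?_eq_none (by omega)]; rfl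
      refine ⟨_, (r1.seq (r2.seq (HaltsIn.ifFalse (by rw [v2']; omega)
        (haltsIn_const _ _ _)))).mono (by simp only [time]; omega), f2.setReg d 0 le_rfl, ?_⟩
      rw [setReg_reg_self, if_pos h0]
  | sum x y b hb' =>
    intro d st s h hb
    set n := st.v y with hn
    have hnN : n ≤ N := hb.v_le y
    have g1 := (Frame.refl d s).setReg d 0 le_rfl
    have r2 := haltsIn_add (5 + 2 * (d + 1)) (4 + 2 * cv y) 2 (s.setReg (5 + 2 * d) 0)
    rw [(h.frame g1).vars, (h.frame g1).zero, add_zero, ← hn] at r2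
    have g2 := g1.setReg (d + 1) n (by omega)
    have r3 := haltsIn_add (5 + 2 * (d + 2)) (4 + 2 * cv x) 2
      ((s.setReg (5 + 2 * d) 0).setReg (5 + 2 * (d + 1)) n)
    rw [(h.frame g2).vars, (h.frame g2).zero, add_zero] at r3
    have g3 := g2.setReg (d + 2) (st.v x) (by omega)
    set s3 := ((s.setReg (5 + 2 * d) 0).setReg (5 + 2 * (d + 1)) n).setReg (5 + 2 * (d + 2))
      (st.v x) with hs3
    set s4 := s3.setReg (4 + 2 * cv x) 0 with hs4
    have h4 := (h.frame g3).setV hcv x 0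
    rw [← hs4] at h4
    obtain ⟨s5, r5, h5, k5, v5, hm5, hf5⟩ := haltsIn_countdown (x := 5 + 2 * (d + 1))
      (T := b.time ca N + 3)
      (p := .seq (b.compile cv ca (d + 3))
        (.seq (.add (5 + 2 * d) (5 + 2 * d) (5 + 2 * (d + 3)))
        (.seq (.add (4 + 2 * cv x) (4 + 2 * cv x) 3)
          (.sub (5 + 2 * (d + 1)) (5 + 2 * (d + 1)) 3))))
      (fun i t => t.reg (5 + 2 * (d + 1)) = i ∧
        (∃ k, k + i = n ∧ Represents cv ca w N (st.setV x k) t ∧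
          t.reg (5 + 2 * d) = ∑ i ∈ Finset.range k, b.eval w (st.setV x i)) ∧
        t.reg (5 + 2 * (d + 2)) = st.v x ∧ t.mem = s.mem ∧
        ∀ r, r ≠ 4 + 2 * cv x → (∀ d', d ≤ d' → r ≠ 5 + 2 * d') → t.reg r = s.reg r)
      (fun i t ht => ht.1) (by
        rintro i t ⟨hi, ⟨k, hk, ht, hsum⟩, hx, hm, hf⟩
        obtain ⟨t1, q1, F1, w1⟩ := hb' (d + 3) ht (hb.setV x (show k ≤ N by omega))
        have ht1 := ht.frame F1
        have q2 := haltsIn_add (5 + 2 * d) (5 + 2 * d) (5 + 2 * (d + 3)) t1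
        rw [F1.tmp (by omega), hsum, w1, ← Finset.sum_range_succ] at q2
        set S := ∑ i ∈ Finset.range (k + 1), b.eval w (st.setV x i) with hS
        have F2 := (F1.mono (show d ≤ d + 3 by omega)).setReg d S le_rfl
        have ht2 := ht.frame F2
        have q3 := haltsIn_add (4 + 2 * cv x) (4 + 2 * cv x) 3 (t1.setReg (5 + 2 * d) S)
        have hxk : (st.setV x k).v x = k := by simp [Store.setV]
        rw [ht2.vars, ht2.one, hxk] at q3
        have ht3 := ht2.setV hcv x (k + 1)
        have hset : (st.setV x k).setV x (k + 1) = st.setV x (k + 1) := by simp [Store.setV]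
        rw [hset] at ht3
        set t3 := (t1.setReg (5 + 2 * d) S).setReg (4 + 2 * cv x) (k + 1) with ht3d
        have q4 := haltsIn_sub (5 + 2 * (d + 1)) (5 + 2 * (d + 1)) 3 t3
        have hcount : t3.reg (5 + 2 * (d + 1)) = i + 1 := by
          rw [ht3d, setReg_reg_of_ne _ _ (by omega), setReg_reg_of_ne _ _ (by omega),
            F1.tmp (by omega), hi]
        rw [hcount, ht3.one, Nat.add_sub_cancel] at q4
        refine ⟨_, (q1.seq (q2.seq (q3.seq q4))).mono (by omega), setReg_reg_self _ _ _,
          ⟨k + 1, by omega, ht3.frame ((Frame.refl d t3).setReg (d + 1) i (by omega)), ?_⟩,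
          ?_, ?_, ?_⟩
        · rw [setReg_reg_of_ne _ _ (by omega), ht3d, setReg_reg_of_ne _ _ (by omega),
            setReg_reg_self]
        · rw [setReg_reg_of_ne _ _ (by omega), ht3d, setReg_reg_of_ne _ _ (by omega),
            setReg_reg_of_ne _ _ (by omega), F1.tmp (by omega), hx]
        · rw [setReg_mem, ht3d, setReg_mem, setReg_mem, F1.mem, hm]
        · intro r hr hr'
          rw [setReg_reg_of_ne _ _ (hr' (d + 1) (by omega)), ht3d, setReg_reg_of_ne _ _ hr,
            setReg_reg_of_ne _ _ (hr' d le_rfl), F1.reg r fun d' hd' => hr' d' (by omega),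
            hf r hr hr'])
      n s4 ⟨by rw [hs4, setReg_reg_of_ne _ _ (by omega), hs3, setReg_reg_of_ne _ _ (by omega),
          setReg_reg_self], ⟨0, by omega, h4, by
          rw [hs4, setReg_reg_of_ne _ _ (by omega), hs3, setReg_reg_of_ne _ _ (by omega),
            setReg_reg_of_ne _ _ (by omega), setReg_reg_self, Finset.sum_range_zero]⟩,
        by rw [hs4, setReg_reg_of_ne _ _ (by omega), hs3, setReg_reg_self], g3.mem,
        fun r hr hr' => by rw [hs4, setReg_reg_of_ne _ _ hr, g3.reg r hr']⟩
    obtain ⟨k, hk, hrep, hsum⟩ := k5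
    obtain rfl : k = n := by omega
    have r6 := haltsIn_add (4 + 2 * cv x) (5 + 2 * (d + 2)) 2 s5
    rw [v5, hrep.zero, add_zero] at r6
    refine ⟨_, ((haltsIn_const _ _ _).seq (r2.seq (r3.seq ((haltsIn_const _ _ _).seq
      (r5.seq r6))))).mono ?_, ⟨hm5, fun r hr => ?_⟩, ?_⟩
    · have : n * (b.time ca N + 3 + 1) ≤ N * (b.time ca N + 4) := Nat.mul_le_mul_right _ hnN
      simp only [time]
      omega
    · rw [setReg_reg]
      split_ifs with hrx
      · rw [hrx, h.vars]
      · exact hf5 r hrx hr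
    · rw [setReg_reg_of_ne _ _ (by omega), hsum]; rfl

end Expr

namespace Cmd

/-- The program that carries out a command, without changing the temporary registers below `d`. -/
def compile (cv : ν → ℕ) (ca : α → ℕ) : Cmd ν α → ℕ → RamProg
  | skip, d => .const (5 + 2 * d) 0
  | assign x e, d => .seq (e.compile cv ca d) (.seq (.sub (5 + 2 * (d + 1)) (5 + 2 * d) 1)
      (.sub (4 + 2 * cv x) (5 + 2 * d) (5 + 2 * (d + 1))))
  | put a e f g, d => .seq (g.compile cv ca d) (.seq (.sub (5 + 2 * (d + 1)) (5 + 2 * d) 1)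
      (.seq (.sub (5 + 2 * d) (5 + 2 * d) (5 + 2 * (d + 1)))
      (.seq (e.compile cv ca (d + 1)) (.seq (f.compile cv ca (d + 2))
      (.seq (addrProg (ca a) (d + 1)) (.store (5 + 2 * (d + 3)) (5 + 2 * d)))))))
  | seq p q, d => .seq (p.compile cv ca d) (q.compile cv ca d)
  | ite e p q, d => .seq (e.compile cv ca d)
      (.ifNZ (5 + 2 * d) (p.compile cv ca d) (q.compile cv ca d))
  | loop x y p, d => .seq (.add (5 + 2 * d) (4 + 2 * cv y) 2) (.seq (.const (5 + 2 * (d + 1)) 0)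
      (.whileNZ (5 + 2 * d) (.seq (.add (4 + 2 * cv x) (5 + 2 * (d + 1)) 2)
        (.seq (p.compile cv ca (d + 2)) (.seq (.add (5 + 2 * (d + 1)) (5 + 2 * (d + 1)) 3)
          (.sub (5 + 2 * d) (5 + 2 * d) 3))))))

/-- The compiled command has the effect of the command, within the time bound. The last part keeps
the temporary registers in which an enclosing loop stores its counters. -/
theorem haltsIn_compile (hcv : Function.Injective cv) (hca : Function.Injective ca)
    (p : Cmd ν α) :
    ∀ (d : ℕ) {st : Store ν α} {s : RamState}, Represents cv ca w N st s → st.Bounded N →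
      ∃ s', (p.compile cv ca d).HaltsIn s (p.time ca N) s' ∧
        Represents cv ca w N (p.exec w N st) s' ∧
        ∀ d' < d, s'.reg (5 + 2 * d') = s.reg (5 + 2 * d') := by
  induction p with
  | skip =>
    intro d st s h _
    have f := (Frame.refl d s).setReg d 0 le_rfl
    exact ⟨_, haltsIn_const _ _ _, h.frame f, fun d' hd' => f.tmp hd'⟩
  | assign x e =>
    intro d st s h hb
    obtain ⟨s1, r1, f1, v1⟩ := e.haltsIn_compile hcv d h hb
    have h1 := h.frame f1
    have r2 := haltsIn_sub (5 + 2 * (d + 1)) (5 + 2 * d) 1 s1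
    rw [v1, h1.bound] at r2
    have f2 := f1.setReg (d + 1) (e.eval w st - N) (by omega)
    have r3 := haltsIn_sub (4 + 2 * cv x) (5 + 2 * d) (5 + 2 * (d + 1))
      (s1.setReg (5 + 2 * (d + 1)) (e.eval w st - N))
    rw [setReg_reg_self, setReg_reg_of_ne _ _ (by omega), v1,
      show e.eval w st - (e.eval w st - N) = min (e.eval w st) N by omega] at r3
    refine ⟨_, (r1.seq (r2.seq r3)).mono (by simp only [time]; omega),
      (h.frame f2).setV hcv x _, fun d' hd' => ?_⟩
    rw [setReg_reg_of_ne _ _ (by omega), f2.tmp hd']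
  | put a e f g =>
    intro d st s h hb
    obtain ⟨s1, r1, f1, v1⟩ := g.haltsIn_compile hcv d h hb
    have h1 := h.frame f1
    have r2 := haltsIn_sub (5 + 2 * (d + 1)) (5 + 2 * d) 1 s1
    rw [v1, h1.bound] at r2
    have f2 := f1.setReg (d + 1) (g.eval w st - N) (by omega)
    have r3 := haltsIn_sub (5 + 2 * d) (5 + 2 * d) (5 + 2 * (d + 1))
      (s1.setReg (5 + 2 * (d + 1)) (g.eval w st - N))
    rw [setReg_reg_self, setReg_reg_of_ne _ _ (by omega), v1,
      show g.eval w st - (g.eval w st - N) = min (g.eval w st) N by omega] at r3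
    have f3 := f2.setReg d (min (g.eval w st) N) le_rfl
    obtain ⟨s4, r4, f4, v4⟩ := e.haltsIn_compile hcv (d + 1) (h.frame f3) hb
    obtain ⟨s5, r5, f5, v5⟩ := f.haltsIn_compile hcv (d + 2) ((h.frame f3).frame f4) hb
    have h5 := ((h.frame f3).frame f4).frame f5
    obtain ⟨s6, r6, f6, v6⟩ := haltsIn_addrProg (c := ca a) (d := d + 1) s5 h5.one
      ((f5.tmp (by omega)).trans v4) v5 (e.eval_le_valueBound w hb) (f.eval_le_valueBound w hb)
    have r7 := haltsIn_store (5 + 2 * (d + 3)) (5 + 2 * d) s6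
    rw [v6, h5.base, f6.tmp (by omega), f5.tmp (by omega), f4.tmp (by omega),
      setReg_reg_self] at r7
    refine ⟨_, (r1.seq (r2.seq (r3.seq (r4.seq (r5.seq (r6.seq r7)))))).mono
      (by simp only [time]; omega), (h5.frame f6).setM hca a _ _ _, fun d' hd' => ?_⟩
    rw [show ∀ i c, (s6.setMem i c).reg = s6.reg from fun _ _ => rfl, f6.tmp (by omega),
      f5.tmp (by omega), f4.tmp (by omega), f3.tmp hd']
  | seq p q hp hq =>
    intro d st s h hb
    obtain ⟨s1, r1, h1, f1⟩ := hp d h hb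
    obtain ⟨s2, r2, h2, f2⟩ := hq d h1 (p.exec_bounded hb)
    exact ⟨s2, r1.seq r2, h2, fun d' hd' => (f2 d' hd').trans (f1 d' hd')⟩
  | ite e p q hp hq =>
    intro d st s h hb
    obtain ⟨s1, r1, f1, v1⟩ := e.haltsIn_compile hcv d h hb
    by_cases h0 : e.eval w st = 0
    · obtain ⟨s2, r2, h2, f2⟩ := hq d (h.frame f1) hb
      refine ⟨s2, (r1.seq (r2.ifFalse (v1.trans h0))).mono (by simp only [time]; omega), ?_,
        fun d' hd' => (f2 d' hd').trans (f1.tmp hd')⟩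
      simpa [exec, h0] using h2
    · obtain ⟨s2, r2, h2, f2⟩ := hp d (h.frame f1) hb
      refine ⟨s2, (r1.seq (r2.ifTrue (by rwa [v1]))).mono (by simp only [time]; omega), ?_,
        fun d' hd' => (f2 d' hd').trans (f1.tmp hd')⟩
      simpa [exec, h0] using h2
  | loop x y p hp =>
    intro d st s h hb
    set n := st.v y with hn
    have hnN : n ≤ N := hb.v_le y
    have r1 := haltsIn_add (5 + 2 * d) (4 + 2 * cv y) 2 s
    rw [h.vars, h.zero, add_zero, ← hn] at r1
    have g1 := (Frame.refl d s).setReg d n le_rfl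
    have g2 := g1.setReg (d + 1) 0 (by omega)
    let F : ℕ → Store ν α := fun k => Nat.rec st (fun i s => p.exec w N (s.setV x i)) k
    have hFb : ∀ k ≤ n, (F k).Bounded N := by
      intro k
      induction k with
      | zero => exact fun _ => hb
      | succ k ih =>
        exact fun hk => p.exec_bounded ((ih (by omega)).setV x (by omega))
    obtain ⟨s3, r3, -, ⟨k, hk, hrep, -⟩, hf3⟩ := haltsIn_countdown (x := 5 + 2 * d)
      (T := p.time ca N + 3)
      (p := .seq (.add (4 + 2 * cv x) (5 + 2 * (d + 1)) 2)
        (.seq (p.compile cv ca (d + 2)) (.seq (.add (5 + 2 * (d + 1)) (5 + 2 * (d + 1)) 3)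
          (.sub (5 + 2 * d) (5 + 2 * d) 3))))
      (fun i t => t.reg (5 + 2 * d) = i ∧
        (∃ k, k + i = n ∧ Represents cv ca w N (F k) t ∧ t.reg (5 + 2 * (d + 1)) = k) ∧
        ∀ d' < d, t.reg (5 + 2 * d') = s.reg (5 + 2 * d'))
      (fun i t ht => ht.1) (by
        rintro i t ⟨hi, ⟨k, hk, ht, hkt⟩, hf⟩
        have q1 := haltsIn_add (4 + 2 * cv x) (5 + 2 * (d + 1)) 2 t
        rw [hkt, ht.zero, add_zero] at q1
        have ht1 := ht.setV hcv x k
        obtain ⟨t2, q2, ht2, hf2⟩ := hp (d + 2) ht1 ((hFb k (by omega)).setV x (by omega))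
        have q3 := haltsIn_add (5 + 2 * (d + 1)) (5 + 2 * (d + 1)) 3 t2
        rw [hf2 _ (by omega), ht2.one, setReg_reg_of_ne _ _ (by omega), hkt] at q3
        have g3 := (Frame.refl d t2).setReg (d + 1) (k + 1) (by omega)
        have q4 := haltsIn_sub (5 + 2 * d) (5 + 2 * d) 3 (t2.setReg (5 + 2 * (d + 1)) (k + 1))
        rw [(ht2.frame g3).one, setReg_reg_of_ne _ _ (by omega), hf2 _ (by omega),
          setReg_reg_of_ne _ _ (by omega), hi, Nat.add_sub_cancel] at q4
        have g4 := g3.setReg d i le_rfl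
        refine ⟨_, (q1.seq (q2.seq (q3.seq q4))).mono (by omega), setReg_reg_self _ _ _,
          ⟨k + 1, by omega, ht2.frame g4, ?_⟩, fun d' hd' => ?_⟩
        · rw [setReg_reg_of_ne _ _ (by omega), setReg_reg_self]
        · rw [g4.tmp hd', hf2 d' (by omega), setReg_reg_of_ne _ _ (by omega), hf d' hd'])
      n _ ⟨by rw [setReg_reg_of_ne _ _ (by omega), setReg_reg_self],
        ⟨0, by omega, h.frame g2, setReg_reg_self _ _ _⟩, fun d' hd' => g2.tmp hd'⟩
    obtain rfl : k = n := by omega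
    refine ⟨s3, (r1.seq ((haltsIn_const _ _ _).seq r3)).mono ?_, hrep, hf3⟩
    have : n * (p.time ca N + 3 + 1) ≤ N * (p.time ca N + 4) := Nat.mul_le_mul_right _ hnN
    simp only [time]
    omega

end Cmd

end Language

/-! ### Frame rules and derived expressions -/

section Derived

variable {ν α : Type} [DecidableEq ν] [DecidableEq α] {w : List ℕ} {N : ℕ}

namespace Store

@[simp] theorem setV_m (s : Store ν α) (x : ν) (i : ℕ) : (s.setV x i).m = s.m := rfl

@[simp] theorem setV_v (s : Store ν α) (x y : ν) (i : ℕ) :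
    (s.setV x i).v y = if y = x then i else s.v y := by
  simp [setV, Function.update_apply]

@[simp] theorem setM_v (s : Store ν α) (a : α) (i j c : ℕ) : (s.setM a i j c).v = s.v := rfl

end Store

namespace Cmd

/-- The variables that a command may change. -/
def varWrites : Cmd ν α → List ν
  | skip => []
  | assign x _ => [x]
  | put _ _ _ _ => []
  | seq p q => p.varWrites ++ q.varWrites
  | ite _ p q => p.varWrites ++ q.varWrites
  | loop x _ p => x :: p.varWrites

/-- The arrays that a command may change. -/
def arrWrites : Cmd ν α → List α
  | skip => []
  | assign _ _ => []
  | put a _ _ _ => [a]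
  | seq p q => p.arrWrites ++ q.arrWrites
  | ite _ p q => p.arrWrites ++ q.arrWrites
  | loop _ _ p => p.arrWrites

/-- A command keeps the variables to which it does not write. -/
theorem exec_v (p : Cmd ν α) (s : Store ν α) (y : ν) :
    y ∉ p.varWrites → (p.exec w N s).v y = s.v y := by
  induction p generalizing s with
  | skip => exact fun _ => rfl
  | assign x e =>
    intro h
    simp only [varWrites, List.mem_singleton] at h
    simp [exec, h]
  | put a e f g => exact fun _ => rfl
  | seq p q hp hq =>
    intro h
    simp only [varWrites, List.mem_append, not_or] at h
    simp only [exec]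
    rw [hq _ h.2, hp _ h.1]
  | ite e p q hp hq =>
    intro h
    simp only [varWrites, List.mem_append, not_or] at h
    simp only [exec]
    split_ifs
    exacts [hp _ h.1, hq _ h.2]
  | loop x z p hp =>
    intro h
    simp only [varWrites, List.mem_cons, not_or] at h
    refine loop_induction (fun _ t => t.v y = s.v y) rfl fun i t _ ht => ?_
    rw [hp _ h.2]
    simpa [h.1] using ht

/-- A command keeps the arrays to which it does not write. -/
theorem exec_m (p : Cmd ν α) (s : Store ν α) (a : α) :
    a ∉ p.arrWrites → (p.exec w N s).m a = s.m a := by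
  induction p generalizing s with
  | skip => exact fun _ => rfl
  | assign x e => exact fun _ => rfl
  | put b e f g =>
    intro h
    simp only [arrWrites, List.mem_singleton] at h
    simp [exec, Store.setM, h]
  | seq p q hp hq =>
    intro h
    simp only [arrWrites, List.mem_append, not_or] at h
    simp only [exec]
    rw [hq _ h.2, hp _ h.1]
  | ite e p q hp hq =>
    intro h
    simp only [arrWrites, List.mem_append, not_or] at h
    simp only [exec]
    split_ifs
    exacts [hp _ h.1, hq _ h.2]
  | loop x z p hp =>
    intro h
    refine loop_induction (fun _ t => t.m a = s.m a) rfl fun i t _ ht => ?_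
    rw [hp _ h]
    exact ht

/-- A stronger form of `loop_induction`: in addition, what the body does not change keeps its
value. -/
theorem loop_rule {x y : ν} {p : Cmd ν α} {s : Store ν α} (hs : s.Bounded N)
    (I : ℕ → Store ν α → Prop) (h0 : I 0 s)
    (hstep : ∀ i t, i < s.v y → t.Bounded N →
      (∀ x', x' ∉ (loop x y p).varWrites → t.v x' = s.v x') →
      (∀ a, a ∉ p.arrWrites → t.m a = s.m a) → I i t → I (i + 1) (p.exec w N (t.setV x i))) :
    I (s.v y) ((loop x y p).exec w N s) := by
  have := loop_induction (w := w) (N := N) (x := x) (y := y) (p := p) (s := s)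
    (fun i t => t.Bounded N ∧ (∀ x', x' ∉ (loop x y p).varWrites → t.v x' = s.v x') ∧
      (∀ a, a ∉ p.arrWrites → t.m a = s.m a) ∧ I i t) ⟨hs, fun _ _ => rfl, fun _ _ => rfl, h0⟩ ?_
  · exact this.2.2.2
  · rintro i t hi ⟨hb, hv, hm, hI⟩
    refine ⟨p.exec_bounded (hb.setV x (hi.le.trans (hs.v_le y))), fun x' hx' => ?_,
      fun a ha => ?_, hstep i t hi hb hv hm hI⟩
    · have hx'' := hx'
      simp only [varWrites, List.mem_cons, not_or] at hx''
      rw [exec_v p _ _ hx''.2, Store.setV_v, if_neg hx''.1, hv x' hx']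
    · rw [exec_m p _ _ ha]
      exact hm a ha

/-- A loop that fills the first cells of the row `E` of the array `a`, where the right hand side
does not depend on the cells written before. -/
theorem exec_loop_put {x y : ν} {a : α} {e g : Expr ν α} {s : Store ν α} (hs : s.Bounded N)
    (E : ℕ) (G : ℕ → ℕ) (hG : ∀ i < s.v y, G i ≤ N)
    (he : ∀ i < s.v y, ∀ t : Store ν α, (∀ x', x' ≠ x → t.v x' = s.v x') →
      (∀ a', a' ≠ a → t.m a' = s.m a') →
      (∀ i' j', ¬ (i' = E ∧ j' < i) → t.m a i' j' = s.m a i' j') →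
      t.v x = i → e.eval w t = E ∧ g.eval w t = G i) (i' j' : ℕ) :
    ((loop x y (put a e (.var x) g)).exec w N s).m a i' j' =
      if i' = E ∧ j' < s.v y then G j' else s.m a i' j' := by
  refine (loop_rule (w := w) hs (fun i t => ∀ i' j',
    t.m a i' j' = if i' = E ∧ j' < i then G j' else s.m a i' j') ?_ ?_) i' j'
  · intro i' j'; simp
  · intro i t hi _ hv hm hI i' j'
    obtain ⟨h1, h2⟩ := he i hi (t.setV x i)
      (fun x' hx' => by simpa [hx'] using hv x' (by simpa [varWrites] using hx'))
      (fun a' ha' => hm a' (by simpa [arrWrites] using ha'))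
      (fun i' j' h => by rw [Store.setV_m, hI, if_neg h]) (by simp)
    have h3 : (Expr.var x : Expr ν α).eval w (t.setV x i) = i := by simp [Expr.eval]
    simp only [exec, h1, h2, h3, Store.setM_m, min_eq_left (hG i hi), Store.setV_m, hI, true_and]
    by_cases hj : j' = i
    · by_cases hi' : i' = E <;> simp [hi', hj]
    · have hlt : j' < i + 1 ↔ j' < i := by omega
      simp [hj, hlt]

end Cmd

namespace Expr

/-- The truth of an expression, as a condition. -/
def Holds (w : List ℕ) (e : Expr ν α) (s : Store ν α) : Prop := e.eval w s ≠ 0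

/-- Conjunction. -/
def and (c e : Expr ν α) : Expr ν α := ite c e (const 0)
/-- Disjunction. -/
def or (c e : Expr ν α) : Expr ν α := add c e
/-- Negation; its value is `0` or `1`. -/
def not (e : Expr ν α) : Expr ν α := sub (const 1) e
/-- Equality of values, by truncated subtraction in both directions. -/
def eq (e f : Expr ν α) : Expr ν α := not (add (sub e f) (sub f e))
/-- Equivalence. -/
def iff (c e : Expr ν α) : Expr ν α := ite c e (not e)
/-- The truth value `0` or `1` of a condition. -/
def bool (e : Expr ν α) : Expr ν α := ite e (const 1) (const 0)
/-- Some value of `x` below the value of `y` satisfies `b`. -/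
def ex (x y : ν) (b : Expr ν α) : Expr ν α := sum x y b
/-- All values of `x` below the value of `y` satisfy `b`. -/
def all (x y : ν) (b : Expr ν α) : Expr ν α := not (ex x y (not b))

variable {c e f b : Expr ν α} {s : Store ν α} {x y : ν}

theorem holds_and : (and c e).Holds w s ↔ c.Holds w s ∧ e.Holds w s := by
  simp only [Holds, and, eval]
  split_ifs with h <;> simp_all

theorem holds_or : (or c e).Holds w s ↔ c.Holds w s ∨ e.Holds w s := by
  simp only [Holds, or, eval]
  omega

theorem holds_not : (not e).Holds w s ↔ ¬ e.Holds w s := by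
  simp only [Holds, not, eval]
  omega

theorem holds_eq : (eq e f).Holds w s ↔ e.eval w s = f.eval w s := by
  rw [eq, holds_not]
  simp only [Holds, eval]
  omega

theorem holds_iff : (iff c e).Holds w s ↔ (c.Holds w s ↔ e.Holds w s) := by
  have h := holds_not (w := w) (e := e) (s := s)
  simp only [Holds, iff, eval] at h ⊢
  split_ifs with hc
  · simp [hc]
  · rw [h]; simp [hc]

theorem holds_ite : (ite c e f).Holds w s ↔
    (c.Holds w s ∧ e.Holds w s) ∨ (¬ c.Holds w s ∧ f.Holds w s) := by
  simp only [Holds, eval]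
  split_ifs with h <;> simp [h]

theorem holds_sub : (sub e f).Holds w s ↔ f.eval w s < e.eval w s := by
  simp only [Holds, eval]
  omega

theorem holds_ex : (ex x y b).Holds w s ↔ ∃ i < s.v y, b.Holds w (s.setV x i) := by
  simp [Holds, ex, eval, Finset.sum_eq_zero_iff]

theorem holds_all : (all x y b).Holds w s ↔ ∀ i < s.v y, b.Holds w (s.setV x i) := by
  rw [all, holds_not, holds_ex]
  simp only [holds_not]
  push Not
  rfl

theorem eval_bool : (bool e).eval w s = open Classical in if e.Holds w s then 1 else 0 := by
  by_cases h : e.eval w s = 0 <;> simp [bool, eval, Holds, h]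

end Expr

end Derived

/-! ### The program -/

/-- The variables of the program: the number `n` of vertices, the parameter `k`, the number `M` of
labels, the edge `up` whose block is searched, and counters. -/
inductive Var
  | n | k | M | M1 | n1 | x | y | t | t' | ans | p | u | w | m | mm | ok | i | i1 | j | j1 | r | z
  | cnt | cnt' | q | a | b | a' | b' | r' | f
  deriving DecidableEq

/-- The arrays of the program: the arcs, the inner products of labels, the lists, the vertices of
a block, the same vertices in the current order, the current representatives, their extensions,
and a scratch array. -/
inductive Arr
  | T | dot | L | B | seq | cur | new | tmp
  deriving DecidableEq

namespace Inversion

set_option linter.constructorNameAsVariable false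

open Expr (const var get and or not eq iff bool ex all)
open Cmd (skip assign put loop)

/-- Expressions of the program. -/
abbrev E := Expr Var Arr
/-- Commands of the program. -/
abbrev C := Cmd Var Arr
/-- Stores of the program. -/
abbrev S := Store Var Arr

/-- The vertex in the given position of the sequence. -/
def seqAt (a : Var) : E := get .seq (const 0) (var a)

/-- There is an arc between the given positions of the sequence. -/
def arcSeq (a b : Var) : E := get .T (seqAt a) (seqAt b)

/-- There is an arc between the given positions of the sequence, after the relabelling in a row of
the array `A`. -/
def arcLabel (A : Arr) (row : E) (a b : Var) : E :=
  .ite (get .dot (get A row (var a)) (get A row (var b))) (arcSeq b a) (arcSeq a b)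

/-- The candidate in row `cnt'` of `new` has a directed triangle at the position `j`. -/
def triangle : E :=
  ex .a .j1 <| ex .b .j1 <| and (arcLabel .new (var .cnt') .a .b) <|
    and (arcLabel .new (var .cnt') .b .j) (arcLabel .new (var .cnt') .j .a)

/-- The candidate in row `cnt'` of `new` is dominated by an earlier row with the same last
label. -/
def dominated : E :=
  ex .r' .cnt' <| and (eq (get .new (var .r') (var .j)) (get .new (var .cnt') (var .j))) <|
    all .a .j1 <| all .b .j1 <| ex .a' .j1 <| ex .b' .j1 <|
      and (eq (get .new (var .r') (var .a)) (get .new (var .cnt') (var .a'))) <|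
      and (eq (get .new (var .r') (var .b)) (get .new (var .cnt') (var .b'))) <|
      and (iff (arcSeq .a .b) (arcSeq .a' .b')) <|
      and (iff (arcSeq .b .a) (arcSeq .b' .a')) <|
      all .f .i1 <| or (.sub (var .j1) (var .f)) <|
        and (iff (arcSeq .a .f) (arcSeq .a' .f)) <|
        and (iff (arcSeq .f .a) (arcSeq .f .a')) <|
        and (iff (arcSeq .b .f) (arcSeq .b' .f)) (iff (arcSeq .f .b) (arcSeq .f .b'))

/-- Extend the row `r` of `cur` by the label `z`. -/
def tryLabel : C :=
  .seq (loop .q .j (put .new (var .cnt') (var .q) (get .cur (var .r) (var .q)))) <|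
  .seq (put .new (var .cnt') (var .j) (var .z)) <|
  .ite (or triangle dominated) skip (assign .cnt' (.add (var .cnt') (const 1)))

/-- Pass from representatives for `j` positions to representatives for `j + 1` positions. -/
def extend : C :=
  .seq (assign .j1 (.add (var .j) (const 1))) <|
  .seq (assign .cnt' (const 0)) <|
  .seq (loop .r .cnt <| loop .z .M <| .ite (get .L (seqAt .j) (var .z)) tryLabel skip) <|
  .seq (assign .cnt (var .cnt')) <|
  loop .r .cnt <| loop .q .j1 <| put .cur (var .r) (var .q) (get .new (var .r) (var .q))

/-- Compute representatives for the sequence of length `i1`. -/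
def represent : C := .seq (assign .cnt (const 1)) (loop .j .i1 extend)

/-- Sort the sequence by the scores that belong to the first representative. -/
def reorder : C :=
  .seq (loop .q .i1 <|
    put .tmp (const 0) (.sum .a .i1 (bool (arcLabel .cur (const 0) .a .q))) (seqAt .q)) <|
  loop .q .i1 <| put .seq (const 0) (var .q) (get .tmp (const 0) (var .q))

/-- Add the vertex number `i` of the block to the sequence. -/
def addVertex : C :=
  .ite (var .ok)
    (.seq (put .seq (const 0) (var .i) (get .B (const 0) (var .i))) <|
      .seq (assign .i1 (.add (var .i) (const 1))) <|
      .seq represent <|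
      .ite (var .cnt) reorder (assign .ok (const 0)))
    skip

/-- The vertices `a` and `b` are adjacent. -/
def adjacent (a b : Var) : E := or (get .T (var a) (var b)) (get .T (var b) (var a))

/-- The vertex `w` is `u` or a common neighbour of `u` and `p`. -/
def inBlock : E := or (eq (var .w) (var .u)) (and (adjacent .w .u) (adjacent .w .p))

/-- Append to `B` the vertices of the block of the edge `up`, except `p`. -/
def scan : C :=
  loop .w .n <| .ite inBlock
    (.seq (put .B (const 0) (var .m) (var .w)) (assign .m (.add (var .m) (const 1)))) skip

/-- Collect the vertices of the block of the edge `up`, with `p` in the last position `mm`. -/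
def collect : C :=
  .seq (assign .m (const 0)) <|
  .seq scan <|
  .seq (put .B (const 0) (var .m) (var .p)) <|
  .seq (assign .mm (var .m)) (assign .m (.add (var .m) (const 1)))

/-- Remove from the list of `p` the labels that do not extend to the block of the edge `up`. -/
def filterList : C :=
  .seq collect <|
  .seq (assign .ok (const 1)) <|
  .seq (loop .i .m addVertex) <|
  loop .z .M <| put .L (var .p) (var .z) <|
    bool (and (var .ok) (ex .r .cnt (eq (get .cur (var .r) (var .mm)) (var .z))))

/-- Filter, for every vertex `p`, by the blocks of all edges `up`. -/
def round : C :=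
  loop .p .n <| loop .u .n <| .ite (adjacent .u .p) filterList skip

/-- Write the three cells of the table of inner products that arise from the cell `(x, y)` when
the number of binary digits grows by one. -/
def dotCells : C :=
  .seq (put .dot (.add (var .x) (var .M)) (var .y) (get .dot (var .x) (var .y))) <|
  .seq (put .dot (var .x) (.add (var .y) (var .M)) (get .dot (var .x) (var .y))) <|
  put .dot (.add (var .x) (var .M)) (.add (var .y) (var .M)) (not (get .dot (var .x) (var .y)))

/-- Pass to labels with one more binary digit. -/
def dotDouble : C :=
  .seq (loop .x .M (loop .y .M dotCells)) (assign .M (.add (var .M) (var .M)))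

/-- Compute the table of inner products. -/
def initDot : C := .seq (assign .M (const 1)) (loop .t .k dotDouble)

/-- Read the adjacency matrix, which starts at the word number `2` of the input. The product `x * n`
is computed as a sum. -/
def initArcs : C :=
  loop .x .n <| loop .y .n <|
    put .T (var .x) (var .y) (.inp (.add (const 2) (.add (.sum .x .x (var .n)) (var .y))))

/-- Put all labels into all lists. -/
def initLists : C := loop .x .n <| loop .y .M <| put .L (var .x) (var .y) (const 1)

/-- Some loop or pair of opposite arcs exists. -/
def twoCycle : E :=
  ex .x .n <| ex .y .n <| and (get .T (var .x) (var .y)) (get .T (var .y) (var .x))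

/-- Filter until no list can shrink any more, and check that no list is empty. There are at most
`n * M` labels to remove, so `(M + 1) * (n + 1)` rounds suffice. -/
def search : C :=
  .seq (assign .M1 (.add (var .M) (const 1))) <|
  .seq (assign .n1 (.add (var .n) (const 1))) <|
  .seq (loop .t .M1 (loop .t' .n1 round)) <|
  assign .ans (bool (all .x .n (ex .y .M (get .L (var .x) (var .y)))))

/-- The whole program, apart from the computation of the bound `N`. -/
def main : C :=
  .seq initDot <| .seq initArcs <| .seq initLists <|
  .ite twoCycle (assign .ans (const 0)) search

variable {w : List ℕ} {N : ℕ}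

/-! ### Correctness of the search in a block -/

/-- The arcs between the vertices of the sequence, as stored. -/
def seqArc (s : S) (a b : ℕ) : Prop := s.m .T (s.m .seq 0 a) (s.m .seq 0 b) ≠ 0

/-- The table of inner products, as stored. -/
def storedDot (s : S) (x y : ℕ) : Prop := s.m .dot x y ≠ 0

/-- The lists of labels, as stored. -/
def list (s : S) (v z : ℕ) : Prop := z < s.v .M ∧ s.m .L v z ≠ 0

/-- The lists of the vertices of the sequence. -/
def seqList (s : S) (a z : ℕ) : Prop := list s (s.m .seq 0 a) z

theorem holds_arcSeq (s : S) (a b : Var) :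
    (arcSeq a b).Holds w s ↔ seqArc s (s.v a) (s.v b) := Iff.rfl

theorem holds_arcLabel (s : S) (A : Arr) (row : E) (a b : Var) : (arcLabel A row a b).Holds w s ↔
    Reorient (seqArc s) (storedDot s) (s.m A (row.eval w s)) (s.v a) (s.v b) := by
  rw [arcLabel, Expr.holds_ite]; rfl

theorem seqArc_setV (s : S) (x : Var) (c : ℕ) : seqArc (s.setV x c) = seqArc s := rfl
theorem storedDot_setV (s : S) (x : Var) (c : ℕ) : storedDot (s.setV x c) = storedDot s := rfl

theorem holds_triangle (s : S) : triangle.Holds w s ↔ ∃ a < s.v .j1, ∃ b < s.v .j1,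
    Reorient (seqArc s) (storedDot s) (s.m .new (s.v .cnt')) a b ∧
    Reorient (seqArc s) (storedDot s) (s.m .new (s.v .cnt')) b (s.v .j) ∧
    Reorient (seqArc s) (storedDot s) (s.m .new (s.v .cnt')) (s.v .j) a := by
  simp [triangle, Expr.holds_ex, Expr.holds_and, holds_arcLabel, Expr.eval, seqArc_setV,
    storedDot_setV]

theorem holds_dominated (s : S) : dominated.Holds w s ↔ ∃ r' < s.v .cnt',
    s.m .new r' (s.v .j) = s.m .new (s.v .cnt') (s.v .j) ∧
      Dominates (seqArc s) (s.v .i1) (s.v .j1) (s.m .new r') (s.m .new (s.v .cnt')) := by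
  simp [dominated, Expr.holds_ex, Expr.holds_all, Expr.holds_and, Expr.holds_or, Expr.holds_eq,
    Expr.holds_iff, Expr.holds_sub, holds_arcSeq, Expr.eval, seqArc_setV, Dominates,
    or_iff_not_imp_left]

/-- The effect of `tryLabel`: the candidate is written into the first free row of `new`, and the
counter moves beyond it unless there is a reason to reject it. -/
theorem exec_tryLabel (s : S) (hs : s.Bounded N) (hc : s.v .cnt' + 1 ≤ N)
    (hj1 : s.v .j1 = s.v .j + 1) :
    ∃ new : ℕ → ℕ → ℕ, (tryLabel.exec w N s).m .new = new ∧
      (∀ r' < s.v .cnt', new r' = s.m .new r') ∧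
      (∀ q < s.v .j, new (s.v .cnt') q = s.m .cur (s.v .r) q) ∧ new (s.v .cnt') (s.v .j) = s.v .z ∧
      ((tryLabel.exec w N s).v .cnt' = s.v .cnt' ∧
        ((∃ a < s.v .j + 1, ∃ b < s.v .j + 1,
          Reorient (seqArc s) (storedDot s) (new (s.v .cnt')) a b ∧
          Reorient (seqArc s) (storedDot s) (new (s.v .cnt')) b (s.v .j) ∧
          Reorient (seqArc s) (storedDot s) (new (s.v .cnt')) (s.v .j) a) ∨
        ∃ r' < s.v .cnt', new r' (s.v .j) = new (s.v .cnt') (s.v .j) ∧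
          Dominates (seqArc s) (s.v .i1) (s.v .j + 1) (new r') (new (s.v .cnt'))) ∨
      (tryLabel.exec w N s).v .cnt' = s.v .cnt' + 1 ∧
        ¬ (∃ a < s.v .j + 1, ∃ b < s.v .j + 1,
          Reorient (seqArc s) (storedDot s) (new (s.v .cnt')) a b ∧
          Reorient (seqArc s) (storedDot s) (new (s.v .cnt')) b (s.v .j) ∧
          Reorient (seqArc s) (storedDot s) (new (s.v .cnt')) (s.v .j) a) ∧
        ¬ ∃ r' < s.v .cnt', new r' (s.v .j) = new (s.v .cnt') (s.v .j) ∧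
          Dominates (seqArc s) (s.v .i1) (s.v .j + 1) (new r') (new (s.v .cnt'))) := by
  set P : C := .seq (loop .q .j (put .new (var .cnt') (var .q) (get .cur (var .r) (var .q))))
    (put .new (var .cnt') (var .j) (var .z)) with hP
  set s' := P.exec w N s with hs'
  have hv : ∀ x, x ≠ .q → s'.v x = s.v x := fun x hx =>
    P.exec_v s x (by simpa [hP, Cmd.varWrites] using hx)
  have hm : ∀ a, a ≠ .new → s'.m a = s.m a := fun a ha =>
    P.exec_m s a (by simpa [hP, Cmd.arrWrites] using ha)
  have hnew : ∀ i' j', s'.m .new i' j' = if i' = s.v .cnt' ∧ j' = s.v .j then s.v .z else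
      if i' = s.v .cnt' ∧ j' < s.v .j then s.m .cur (s.v .r) j' else s.m .new i' j' := by
    intro i' j'
    set s1 := (loop .q .j (put .new (var .cnt') (var .q) (get .cur (var .r) (var .q))) : C).exec
      w N s with hs1
    have hv1 : ∀ x, x ≠ .q → s1.v x = s.v x := fun x hx =>
      Cmd.exec_v _ s x (by simpa [Cmd.varWrites] using hx)
    have h1 : s1.m .new i' j' = _ := Cmd.exec_loop_put (w := w) hs (s.v .cnt')
      (fun q => s.m .cur (s.v .r) q) (fun i _ => hs.m_le _ _ _) (by
        intro i _ t hv hm _ hx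
        simp [Expr.eval, hx, hv, hm]) i' j'
    have h2 : s'.m .new i' j' =
        (s1.setM .new (s1.v .cnt') (s1.v .j) (min (s1.v .z) N)).m .new i' j' :=
      rfl
    rw [h2, Store.setM_m, h1, hv1 _ (by simp), hv1 _ (by simp), hv1 _ (by simp),
      min_eq_left (hs.v_le _)]
    simp
  have hexec : ((or triangle dominated).Holds w s' → tryLabel.exec w N s = s') ∧
      (¬ (or triangle dominated).Holds w s' →
        tryLabel.exec w N s = s'.setV .cnt' (min (s'.v .cnt' + 1) N)) :=
    ⟨fun h => if_pos h, fun h => if_neg h⟩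
  have harc : seqArc s' = seqArc s := by
    unfold seqArc; rw [hm _ (by simp), hm _ (by simp)]
  have hdot : storedDot s' = storedDot s := by
    unfold storedDot; rw [hm _ (by simp)]
  have hiff : (or triangle dominated).Holds w s' ↔ _ := Expr.holds_or
  rw [holds_triangle, holds_dominated, harc, hdot, hv _ (by simp), hv _ (by simp),
    hv _ (by simp), hv _ (by simp), hj1] at hiff
  refine ⟨s'.m .new, ?_, ?_, ?_, ?_, ?_⟩
  · by_cases h : (or triangle dominated).Holds w s'
    · rw [hexec.1 h]
    · rw [hexec.2 h]; rfl
  · intro r' hr'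
    funext q
    rw [hnew, if_neg (by omega), if_neg (by omega)]
  · intro q hq
    rw [hnew, if_neg (by omega), if_pos ⟨rfl, hq⟩]
  · rw [hnew, if_pos ⟨rfl, rfl⟩]
  · by_cases h : (or triangle dominated).Holds w s'
    · rw [hexec.1 h]
      exact Or.inl ⟨hv _ (by simp), hiff.1 h⟩
    · rw [hexec.2 h]
      rw [hiff, not_or] at h
      exact Or.inr ⟨by rw [Store.setV_v, if_pos rfl, hv _ (by simp), min_eq_left hc], h⟩

/-- Whether or not the candidate is kept, all good labellings that continue it remain
represented. -/
theorem extending_tryLabel {s : S} (hs : s.Bounded N) {T d L : ℕ → ℕ → Prop} {P : ℕ → ℕ → Prop}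
    (hc : s.v .cnt' + 1 ≤ N) (hj1 : s.v .j1 = s.v .j + 1) (hje : s.v .j < s.v .i1)
    (hT : seqArc s = T) (hd : storedDot s = d)
    (hcur : GoodOn T d L (Set.Iio (s.v .j)) (s.m .cur (s.v .r))) (hL : L (s.v .j) (s.v .z))
    (h : Extending T d L (s.v .i1) (s.v .j) (s.m .cur) (s.v .cnt) (s.m .new) (s.v .cnt') P) :
    Extending T d L (s.v .i1) (s.v .j) (s.m .cur) (s.v .cnt) ((tryLabel.exec w N s).m .new)
      ((tryLabel.exec w N s).v .cnt') fun r z => P r z ∨ (r = s.v .r ∧ z = s.v .z) := by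
  obtain ⟨new, h1, h2, h3, h4, h5⟩ := exec_tryLabel (w := w) s hs hc hj1
  subst hT hd
  have h := h.congr h2
  rw [h1]
  rcases h5 with ⟨h5, h6⟩ | ⟨h5, h6, h7⟩
  · rw [h5]
    exact h.reject hje h3 h4 h6
  · rw [h5]
    exact h.accept hcur h3 h4 hL h6 h7

/-- One step along the sequence turns representatives for `j` positions into representatives for
`j + 1` positions. -/
theorem represent_extend {s : S} (hs : s.Bounded N) {m : ℕ} {x : ℕ → ℕ} (hm : s.v .i1 = m + 1)
    (hj : s.v .j < m + 1) (hmN : m + 1 ≤ N) (hT : TournamentOn (seqArc s) (m + 1))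
    (hx : SortedBy (seqArc s) (storedDot s) (s.v .M) m x) (hM : 0 < s.v .M)
    (hN : repBound (s.v .M) + 1 ≤ N)
    (h : Represent (seqArc s) (storedDot s) (seqList s) (m + 1) (s.v .j) (s.m .cur) (s.v .cnt)) :
    Represent (seqArc s) (storedDot s) (seqList s) (m + 1) (s.v .j + 1)
      ((extend.exec w N s).m .cur) ((extend.exec w N s).v .cnt) := by
  set T := seqArc s with hTd
  set d := storedDot s with hdd
  set L := seqList s with hLd
  have hLM : ∀ a z, L a z → z < s.v .M := fun a z h => h.1
  set s1 : S := (Cmd.seq (assign .j1 (.add (var .j) (const 1))) (assign .cnt' (const 0)) : C).exec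
    w N s with hs1
  have hb1 : s1.Bounded N := Cmd.exec_bounded _ hs
  have hv1 : ∀ y, y ≠ .j1 → y ≠ .cnt' → s1.v y = s.v y := fun y hy hy' =>
    Cmd.exec_v _ s y (by simpa [Cmd.varWrites] using ⟨hy, hy'⟩)
  have hj1 : s1.v .j1 = s.v .j + 1 := by
    simp only [hs1, Cmd.exec, Expr.eval, Store.setV_v]
    simp
    omega
  have hc1 : s1.v .cnt' = 0 := by
    simp [hs1, Cmd.exec, Expr.eval, Store.setV_v]
  have hm1 : s1.m = s.m := rfl
  -- the loops over the rows and the labels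
  set inner : C := .ite (get .L (seqAt .j) (var .z)) tryLabel skip with hinner
  set s2 : S := (loop .r .cnt (loop .z .M inner) : C).exec w N s1 with hs2
  have hInv : Extending T d L (m + 1) (s.v .j) (s.m .cur) (s.v .cnt) (s2.m .new) (s2.v .cnt')
      fun r' _ => r' < s.v .cnt := by
    have := Cmd.loop_rule (w := w) (x := .r) (y := .cnt) (p := loop .z .M inner) hb1
      (fun r t => Extending T d L (m + 1) (s.v .j) (s.m .cur) (s.v .cnt) (t.m .new) (t.v .cnt')
        fun r' _ => r' < r) ?_ ?_
    · rw [hv1 .cnt (by simp) (by simp)] at this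
      exact this
    · rw [hc1]
      exact extending_start.mono fun _ _ _ _ _ h => absurd h (by omega)
    · intro r t hr hbt hvt hmt ht
      have hrN : r ≤ N := hr.le.trans (hb1.v_le _)
      have := Cmd.loop_rule (w := w) (x := .z) (y := .M) (p := inner) (hbt.setV .r hrN)
        (fun z t' => Extending T d L (m + 1) (s.v .j) (s.m .cur) (s.v .cnt) (t'.m .new)
          (t'.v .cnt') fun r' z' => r' < r ∨ (r' = r ∧ z' < z)) ?_ ?_
      · refine this.mono fun ℓ hℓ r' _ _ hr' => ?_
        rcases Nat.lt_succ_iff_lt_or_eq.1 hr' with hr' | rfl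
        · exact Or.inl hr'
        · refine Or.inr ⟨rfl, ?_⟩
          have : (t.setV .r r').v .M = s.v .M := by
            rw [Store.setV_v, if_neg (by simp), hvt .M (by simp [hinner, Cmd.varWrites, tryLabel]),
              hv1 _ (by simp) (by simp)]
          rw [this]
          exact hLM _ _ (hℓ.mem (s.v .j) hj)
      · refine Extending.mono (by simpa using ht) fun _ _ _ _ _ h => ?_
        omega
      · intro z t' hz hbt' hvt' hmt' ht'
        set t₂ := t'.setV .z z with ht₂
        have hzN : z ≤ N := hz.le.trans ((hbt.setV .r hrN).v_le _)
        have hb2 : t₂.Bounded N := hbt'.setV .z hzN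
        have e : ∀ y, y ∉ [Var.r, .z, .q, .cnt', .j1] → t₂.v y = s.v y := by
          intro y hy
          simp only [List.mem_cons, List.not_mem_nil, or_false, not_or] at hy
          rw [ht₂, Store.setV_v, if_neg hy.2.1,
            hvt' y (by simp [hinner, Cmd.varWrites, tryLabel, hy]),
            Store.setV_v, if_neg hy.1, hvt y (by simp [hinner, Cmd.varWrites, tryLabel, hy]),
            hv1 y hy.2.2.2.2 hy.2.2.2.1]
        have em : ∀ a, a ≠ .new → t₂.m a = s.m a := by
          intro a ha
          rw [ht₂, Store.setV_m,
            hmt' a (by simp [hinner, Cmd.arrWrites, tryLabel, ha]), Store.setV_m,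
            hmt a (by simp [hinner, Cmd.arrWrites, tryLabel, ha]), hm1]
        have er : t₂.v .r = r := by
          rw [ht₂, Store.setV_v, if_neg (by simp),
            hvt' .r (by simp [hinner, Cmd.varWrites, tryLabel])]
          simp
        have ez : t₂.v .z = z := by simp [ht₂]
        have ej1 : t₂.v .j1 = s.v .j + 1 := by
          rw [ht₂, Store.setV_v, if_neg (by simp),
            hvt' .j1 (by simp [hinner, Cmd.varWrites, tryLabel]),
            Store.setV_v, if_neg (by simp),
            hvt .j1 (by simp [hinner, Cmd.varWrites, tryLabel]), hj1]
        have ec : t₂.v .cnt' = t'.v .cnt' := by simp [ht₂]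
        have en : t₂.m .new = t'.m .new := rfl
        have eT : seqArc t₂ = T := by
          unfold seqArc; rw [em _ (by simp), em _ (by simp)]; rfl
        have ed : storedDot t₂ = d := by
          unfold storedDot; rw [em _ (by simp)]; rfl
        have hzM : z < s.v .M := by
          have : (t.setV .r r).v .M = s.v .M := by
            rw [Store.setV_v, if_neg (by simp), hvt .M (by simp [hinner, Cmd.varWrites, tryLabel]),
              hv1 _ (by simp) (by simp)]
          omega
        have hrc : r < s.v .cnt := by rwa [hv1 _ (by simp) (by simp)] at hr
        have hcard : t'.v .cnt' ≤ repBound (s.v .M) := ht'.card_le hT hx hM hLM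
        have hcond : (get .L (seqAt .j) (var .z) : E).eval w t₂ ≠ 0 ↔ L (s.v .j) z := by
          have : (get .L (seqAt .j) (var .z) : E).eval w t₂ =
              t₂.m .L (t₂.m .seq 0 (t₂.v .j)) (t₂.v .z) := rfl
          rw [this, em _ (by simp), em _ (by simp), e .j (by simp), ez, hLd]
          exact (and_iff_right hzM).symm
        by_cases hLz : L (s.v .j) z
        · have hexec : inner.exec w N t₂ = tryLabel.exec w N t₂ := if_pos (hcond.2 hLz)
          rw [hexec]
          have hcur := h.good r hrc
          have := extending_tryLabel (w := w) (N := N) (s := t₂) hb2 (T := T) (d := d) (L := L)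
            (P := fun r' z' => r' < r ∨ (r' = r ∧ z' < z)) (by rw [ec]; omega)
            (by rw [ej1, e .j (by simp)]) (by rw [e .j (by simp), e .i1 (by simp), hm]; exact hj)
            eT ed (by rw [e .j (by simp), em _ (by simp), er]; exact hcur)
            (by rw [e .j (by simp), ez]; exact hLz)
            (by rw [e .j (by simp), e .i1 (by simp), hm, em _ (by simp), e .cnt (by simp), ec, en]
                exact ht')
          rw [e .j (by simp), e .i1 (by simp), hm, em _ (by simp), e .cnt (by simp), er, ez] at this
          refine this.mono fun _ _ _ _ _ h => ?_
          omega
        · have hexec : inner.exec w N t₂ = t₂ := if_neg (hcond.not.2 hLz)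
          rw [hexec, en, ec]
          refine ht'.mono fun ℓ hℓ r' _ _ hr' => ?_
          have hne : ℓ (s.v .j) ≠ z := fun hz' => hLz (hz' ▸ hℓ.mem (s.v .j) hj)
          omega
  have hfin := hInv.finish h hj fun r hr _ _ => hr
  -- the new representatives are copied back
  have hb2 : s2.Bounded N := Cmd.exec_bounded _ hb1
  set s3 := s2.setV .cnt (s2.v .cnt') with hs3
  have hb3 : s3.Bounded N := hb2.setV _ (hb2.v_le _)
  set copy : C :=
    loop .r .cnt (loop .q .j1 (put .cur (var .r) (var .q) (get .new (var .r) (var .q))))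
    with hcopy
  have hexec : extend.exec w N s = copy.exec w N s3 := by
    have : extend.exec w N s = copy.exec w N (s2.setV .cnt (min (s2.v .cnt') N)) := rfl
    rw [this, min_eq_left (hb2.v_le _)]
  have hj3 : s3.v .j1 = s.v .j + 1 := by
    rw [hs3, Store.setV_v, if_neg (by simp), hs2, Cmd.exec_v _ _ _
      (by simp [hinner, Cmd.varWrites, tryLabel]), hj1]
  have hcnt : (extend.exec w N s).v .cnt = s2.v .cnt' := by
    rw [hexec, Cmd.exec_v _ _ _ (by simp [hcopy, Cmd.varWrites])]
    simp [hs3]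
  rw [hcnt, hexec]
  refine hfin.congr ?_
  have := Cmd.loop_rule (w := w) (x := .r) (y := .cnt)
    (p := loop .q .j1 (put .cur (var .r) (var .q) (get .new (var .r) (var .q)))) hb3
    (fun r t => ∀ r' < r, ∀ q < s.v .j + 1, t.m .cur r' q = s2.m .new r' q) (by simp) ?_
  · simpa [hs3] using this
  · intro r t hr hbt hvt hmt ht r' hr' q hq
    have hrN : r ≤ N := hr.le.trans (hb3.v_le _)
    rw [Cmd.exec_loop_put (w := w) (hbt.setV .r hrN) r (fun q => s2.m .new r q)
      (fun i _ => hb2.m_le _ _ _) (by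
        intro i _ t' hv' hm' _ hx
        have h1 : t'.v .r = r := by rw [hv' _ (by simp)]; simp
        have h2 : t'.m .new = s2.m .new := by
          rw [hm' _ (by simp), Store.setV_m, hmt _ (by simp [Cmd.arrWrites])]; rfl
        simp [Expr.eval, hx, h1, h2])]
    have h3 : (t.setV .r r).v .j1 = s.v .j + 1 := by
      rw [Store.setV_v, if_neg (by simp), hvt _ (by simp [Cmd.varWrites]), hj3]
    rw [h3]
    rcases Nat.lt_succ_iff_lt_or_eq.1 hr' with hr' | rfl
    · rw [if_neg (by omega)]
      exact ht r' hr' q hq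
    · rw [if_pos ⟨rfl, hq⟩]

/-- The representatives for the whole sequence. -/
theorem represent_represent {s : S} (hs : s.Bounded N) {m : ℕ} {x : ℕ → ℕ} (hm : s.v .i1 = m + 1)
    (hmN : m + 1 ≤ N) (hT : TournamentOn (seqArc s) (m + 1))
    (hx : SortedBy (seqArc s) (storedDot s) (s.v .M) m x) (hM : 0 < s.v .M)
    (hN : repBound (s.v .M) + 1 ≤ N) :
    Represent (seqArc s) (storedDot s) (seqList s) (m + 1) (m + 1)
      ((represent.exec w N s).m .cur) ((represent.exec w N s).v .cnt) := by
  set s1 := s.setV .cnt (min 1 N) with hs1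
  have hb1 : s1.Bounded N := hs.setV _ (min_le_right _ _)
  have hexec : represent.exec w N s = (loop .j .i1 extend : C).exec w N s1 := rfl
  have := Cmd.loop_rule (w := w) (x := .j) (y := .i1) (p := extend) hb1
    (fun j t => Represent (seqArc s) (storedDot s) (seqList s) (m + 1) j (t.m .cur) (t.v .cnt)) ?_ ?_
  · rw [hexec]
    have h1 : s1.v .i1 = m + 1 := by simp [hs1, hm]
    rwa [h1] at this
  · have h1 : s1.v .cnt = 1 := by simp [hs1]; omega
    rw [h1]
    exact represent_zero _
  · intro j t hj hbt hvt hmt ht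
    have hj' : j < m + 1 := by simpa [hs1, hm] using hj
    set t₁ := t.setV .j j with ht₁
    have hb₁ : t₁.Bounded N := hbt.setV _ (hj.le.trans (hb1.v_le _))
    have ev : ∀ y, y ∈ [Var.i1, .M] → t₁.v y = s.v y := by
      intro y hy
      simp only [List.mem_cons, List.not_mem_nil, or_false] at hy
      rcases hy with rfl | rfl <;>
      · rw [ht₁, Store.setV_v, if_neg (by simp), hvt _ (by simp [extend, Cmd.varWrites, tryLabel])]
        simp [hs1]
    have em : ∀ a, a ≠ .new → a ≠ .cur → t₁.m a = s.m a := fun a ha ha' => by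
      rw [ht₁, Store.setV_m, hmt _ (by simp [extend, Cmd.arrWrites, tryLabel, ha, ha'])]
      rfl
    have eT : seqArc t₁ = seqArc s := by
      unfold seqArc; rw [em _ (by simp) (by simp), em _ (by simp) (by simp)]
    have ed : storedDot t₁ = storedDot s := by
      unfold storedDot; rw [em _ (by simp) (by simp)]
    have eL : seqList t₁ = seqList s := by
      unfold seqList list
      rw [em _ (by simp) (by simp), em _ (by simp) (by simp), ev .M (by simp)]
    have ej : t₁.v .j = j := by simp [ht₁]
    have ec : t₁.v .cnt = t.v .cnt := by simp [ht₁]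
    have := represent_extend (w := w) hb₁ (m := m) (x := x) (by rw [ev _ (by simp), hm])
      (by rw [ej]; exact hj') hmN (by rwa [eT]) (by rw [eT, ed, ev .M (by simp)]; exact hx)
      (by rwa [ev .M (by simp)]) (by rwa [ev .M (by simp)])
      (by rw [eT, ed, eL, ej, ec]; exact ht)
    rwa [eT, ed, eL, ej] at this

/-- The stored arcs. -/
def arc (s : S) (u v : ℕ) : Prop := s.m .T u v ≠ 0

/-- After a good labelling has been found, `reorder` sorts the sequence. -/
theorem exec_reorder {s : S} (hs : s.Bounded N) {e : ℕ} {L : ℕ → ℕ → Prop} (he : s.v .i1 = e)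
    (hT : TournamentOn (seqArc s) e) (hd : ∀ x y, storedDot s x y → storedDot s y x)
    (hL : ∀ a z, L a z → z < s.v .M)
    (h : GoodOn (seqArc s) (storedDot s) L (Set.Iio e) (s.m .cur 0))
    (hinj : Set.InjOn (s.m .seq 0) (Set.Iio e)) :
    (∃ x, SortedBy (seqArc (reorder.exec w N s)) (storedDot (reorder.exec w N s)) (s.v .M) e x) ∧
      (reorder.exec w N s).m .seq 0 '' Set.Iio e = s.m .seq 0 '' Set.Iio e ∧
      Set.InjOn ((reorder.exec w N s).m .seq 0) (Set.Iio e) := by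
  set σ := score (Reorient (seqArc s) (storedDot s) (s.m .cur 0)) e with hσ
  have hσinj : Set.InjOn σ (Set.Iio e) := h.score_injOn hT hd
  have hirr : ∀ a < e, ¬ Reorient (seqArc s) (storedDot s) (s.m .cur 0) a a := by
    rintro a ha (⟨-, h⟩ | ⟨-, h⟩) <;> exact hT.irrefl a ha h
  set P : C := loop .q .i1
    (put .tmp (const 0) (.sum .a .i1 (bool (arcLabel .cur (const 0) .a .q))) (seqAt .q)) with hP
  set s1 := P.exec w N s with hs1
  have hb1 : s1.Bounded N := Cmd.exec_bounded _ hs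
  have hv1 : s1.v .i1 = e := (Cmd.exec_v P s _ (by simp [hP, Cmd.varWrites])).trans he
  have hm1 : ∀ a, a ≠ .tmp → s1.m a = s.m a := fun a ha =>
    Cmd.exec_m P s a (by simpa [hP, Cmd.arrWrites] using ha)
  have htmp : ∀ q < e, s1.m .tmp 0 (σ q) = s.m .seq 0 q := by
    have := Cmd.loop_rule (w := w) (x := .q) (y := .i1)
      (p := put .tmp (const 0) (.sum .a .i1 (bool (arcLabel .cur (const 0) .a .q))) (seqAt .q)) hs
      (fun q t => ∀ q' < q, t.m .tmp 0 (σ q') = s.m .seq 0 q') (by simp) ?_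
    · rwa [he] at this
    · intro q t hq hbt hvt hmt ht q' hq'
      rw [he] at hq
      have hm : ∀ a, a ≠ .tmp → (t.setV .q q).m a = s.m a := fun a ha =>
        hmt a (by simpa [Cmd.arrWrites] using ha)
      have hi1 : t.v .i1 = e := (hvt _ (by simp [Cmd.varWrites])).trans he
      have hscore : (Expr.sum .a .i1 (bool (arcLabel .cur (const 0) .a .q)) : E).eval w
          (t.setV .q q) = σ q := by
        classical
        simp only [Expr.eval, Expr.eval_bool, holds_arcLabel, hσ, score, Finset.card_filter,
          seqArc_setV, storedDot_setV]
        have e1 : seqArc t = seqArc s := by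
          unfold seqArc; rw [hmt _ (by simp [Cmd.arrWrites]), hmt _ (by simp [Cmd.arrWrites])]
        have e2 : storedDot t = storedDot s := by
          unfold storedDot; rw [hmt _ (by simp [Cmd.arrWrites])]
        simp only [Store.setV_v, Store.setV_m, e1, e2, hmt .cur (by simp [Cmd.arrWrites]),
          if_neg (show Var.i1 ≠ Var.q by simp), if_neg (show Var.q ≠ Var.a by simp), if_true, hi1]
      simp only [Cmd.exec, hscore, Store.setM_m]
      have hval : (seqAt .q : E).eval w (t.setV .q q) = s.m .seq 0 q := by
        simp [seqAt, Expr.eval, hmt .seq (by simp [Cmd.arrWrites])]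
      rw [hval, min_eq_left (hs.m_le _ _ _)]
      simp only [Expr.eval, true_and]
      rcases Nat.lt_succ_iff_lt_or_eq.1 hq' with hq' | rfl
      · rw [if_neg fun he' => hq'.ne (hσinj (hq'.trans hq) hq he')]
        exact ht q' hq'
      · rw [if_pos rfl]
  have hseq : ∀ q < e, (reorder.exec w N s).m .seq 0 q = s1.m .tmp 0 q := by
    intro q hq
    have := Cmd.exec_loop_put (w := w) (x := .q) (y := .i1) (a := Arr.seq) (e := const 0)
      (g := get .tmp (const 0) (var .q)) hb1 0
      (fun q => s1.m .tmp 0 q) (fun i _ => hb1.m_le _ _ _) (by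
        intro i _ t _ hm _ hx
        simp [Expr.eval, hx, hm]) 0 q
    rw [if_pos ⟨rfl, by rwa [hv1]⟩] at this
    exact this
  have hseq' : ∀ q < e, (reorder.exec w N s).m .seq 0 (σ q) = s.m .seq 0 q := fun q hq => by
    rw [hseq _ (score_lt hq (hirr q hq)), htmp q hq]
  have hT' : (reorder.exec w N s).m .T = s.m .T :=
    Cmd.exec_m _ _ _ (by simp [reorder, Cmd.arrWrites])
  have hd' : storedDot (reorder.exec w N s) = storedDot s := by
    unfold storedDot; rw [Cmd.exec_m _ _ _ (by simp [reorder, Cmd.arrWrites])]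
  have := GoodOn.sortedBy_of_score (T := arc s) (seq := s.m .seq 0)
    (seq' := (reorder.exec w N s).m .seq 0) hT hd hL h hseq' hinj
  rw [hd']
  unfold seqArc
  rw [hT']
  exact this

/-- The state of the search after the first `i` vertices of a block: they are in an order that some
labels make transitive, and the rows of `cur` show the possible labels of the last of them, or
they have no good labelling. -/
structure Searching (T d L : ℕ → ℕ → Prop) (M : ℕ) (B : ℕ → ℕ) (i : ℕ) (t : S) : Prop where
  image : t.v .ok ≠ 0 → t.m .seq 0 '' Set.Iio i = B '' Set.Iio i
  injOn : t.v .ok ≠ 0 → Set.InjOn (t.m .seq 0) (Set.Iio i)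
  sorted : t.v .ok ≠ 0 →
    ∃ x, SortedBy (fun a b => T (t.m .seq 0 a) (t.m .seq 0 b)) d M i x
  last : t.v .ok ≠ 0 → ∀ i', i = i' + 1 → ∀ z, (∃ r < t.v .cnt, t.m .cur r i' = z) ↔
    ∃ y, GoodOn T d L (B '' Set.Iio i) y ∧ y (B i') = z
  none : t.v .ok = 0 → ¬ ∃ y, GoodOn T d L (B '' Set.Iio i) y

/-- The step from `i` to `i + 1` vertices: the sequence of the first `i` vertices is sorted, so the
number of representatives stays below the bound. -/
theorem searching_addVertex {s : S} (hs : s.Bounded N) {m : ℕ} {B : ℕ → ℕ}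
    (hB : ∀ i < m, s.m .B 0 i = B i) (hBinj : Set.InjOn B (Set.Iio m)) (hi : s.v .i < m)
    (hmN : m ≤ N) (hirr : ∀ v ∈ B '' Set.Iio m, ¬ arc s v v)
    (htot : ∀ u ∈ B '' Set.Iio m, ∀ v ∈ B '' Set.Iio m, u ≠ v → (arc s u v ↔ ¬ arc s v u))
    (hd : ∀ x y, storedDot s x y → storedDot s y x) (hM : 0 < s.v .M) (hN : repBound (s.v .M) + 1 ≤ N)
    (h : Searching (arc s) (storedDot s) (list s) (s.v .M) B (s.v .i) s) :
    Searching (arc s) (storedDot s) (list s) (s.v .M) B (s.v .i + 1) (addVertex.exec w N s) := by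
  set i := s.v .i with hid
  have hsub : B '' Set.Iio i ⊆ B '' Set.Iio (i + 1) :=
    Set.image_mono (Set.Iio_subset_Iio (Nat.le_succ i))
  by_cases hok : s.v .ok = 0
  · have hexec : addVertex.exec w N s = s := if_neg (not_not.2 hok)
    rw [hexec]
    refine ⟨fun h => absurd hok h, fun h => absurd hok h, fun h => absurd hok h,
      fun h => absurd hok h, fun _ => ?_⟩
    rintro ⟨y, hy⟩
    exact h.none hok ⟨y, hy.mono hsub⟩
  set P : C := .seq (put .seq (const 0) (var .i) (get .B (const 0) (var .i)))
    (assign .i1 (.add (var .i) (const 1))) with hP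
  set s1 := P.exec w N s with hs1
  have hb1 : s1.Bounded N := Cmd.exec_bounded _ hs
  have hv1 : ∀ y, y ≠ .i1 → s1.v y = s.v y := fun y hy =>
    Cmd.exec_v P s y (by simpa [hP, Cmd.varWrites] using hy)
  have hm1 : ∀ a, a ≠ .seq → s1.m a = s.m a := fun a ha =>
    Cmd.exec_m P s a (by simpa [hP, Cmd.arrWrites] using ha)
  have hi1 : s1.v .i1 = i + 1 := by
    have : s1.v .i1 = min (i + 1) N := rfl
    omega
  have hseq1 : ∀ q, s1.m .seq 0 q = if q = i then B i else s.m .seq 0 q := by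
    intro q
    have : s1.m .seq 0 q = (s.setM .seq 0 i (min (s.m .B 0 i) N)).m .seq 0 q := rfl
    rw [this, Store.setM_m, min_eq_left (hs.m_le _ _ _), hB i hi]
    simp
  have hsame : ∀ q < i, s1.m .seq 0 q = s.m .seq 0 q := fun q hq => by
    rw [hseq1, if_neg hq.ne]
  have hlast : s1.m .seq 0 i = B i := by rw [hseq1, if_pos rfl]
  have himg : s1.m .seq 0 '' Set.Iio (i + 1) = B '' Set.Iio (i + 1) := by
    have h1 : Set.Iio (i + 1) = insert i (Set.Iio i) := by
      ext q; simp only [Set.mem_Iio, Set.mem_insert_iff]; omega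
    rw [h1, Set.image_insert_eq, Set.image_insert_eq, hlast, ← h.image hok]
    exact congrArg _ (Set.image_congr fun q hq => hsame q hq)
  have hinj : Set.InjOn (s1.m .seq 0) (Set.Iio (i + 1)) := by
    have hnew : ∀ q < i, s.m .seq 0 q ≠ B i := by
      intro q hq he
      have : B i ∈ B '' Set.Iio i := by
        rw [← h.image hok, ← he]; exact ⟨q, hq, rfl⟩
      obtain ⟨c, hc, hc'⟩ := this
      exact (ne_of_lt hc) (hBinj (lt_trans hc hi) hi hc')
    intro a ha b hb hab
    rcases Nat.lt_succ_iff_lt_or_eq.1 ha with ha | rfl <;>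
      rcases Nat.lt_succ_iff_lt_or_eq.1 hb with hb | rfl
    · rw [hsame a ha, hsame b hb] at hab
      exact h.injOn hok ha hb hab
    · rw [hsame a ha, hlast] at hab
      exact absurd hab (hnew a ha)
    · rw [hsame b hb, hlast] at hab
      exact absurd hab.symm (hnew b hb)
    · rfl
  have hBm : ∀ q < i + 1, s1.m .seq 0 q ∈ B '' Set.Iio m := by
    intro q hq
    have : s1.m .seq 0 q ∈ B '' Set.Iio (i + 1) := himg ▸ ⟨q, hq, rfl⟩
    exact Set.image_mono (Set.Iio_subset_Iio hi) this
  have harc1 : ∀ a b, seqArc s1 a b ↔ arc s (s1.m .seq 0 a) (s1.m .seq 0 b) := fun a b => by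
    unfold seqArc arc; rw [hm1 .T (by simp)]
  have hT : TournamentOn (seqArc s1) (i + 1) := by
    refine ⟨fun a ha => ?_, fun a ha b hb hab => ?_⟩
    · rw [harc1]; exact hirr _ (hBm a ha)
    · rw [harc1, harc1]
      exact htot _ (hBm a ha) _ (hBm b hb) fun e => hab (hinj ha hb e)
  have hd1 : storedDot s1 = storedDot s := by unfold storedDot; rw [hm1 _ (by simp)]
  have hM1 : s1.v .M = s.v .M := hv1 _ (by simp)
  have hlist1 : list s1 = list s := by unfold list; rw [hm1 _ (by simp), hM1]
  obtain ⟨x, hx⟩ := h.sorted hok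
  have hx1 : SortedBy (seqArc s1) (storedDot s1) (s1.v .M) i x := by
    refine ⟨hM1 ▸ hx.1, fun c hc a hac => ?_⟩
    have := hx.2 c hc a hac
    unfold Reorient at this ⊢
    rwa [harc1, harc1, hd1, hsame a (hac.trans hc), hsame c hc]
  have hrep := represent_represent (w := w) hb1 hi1 (by omega) hT hx1 (hM1 ▸ hM) (hM1 ▸ hN)
  set s2 := represent.exec w N s1 with hs2
  have hb2 : s2.Bounded N := Cmd.exec_bounded _ hb1
  have hm2 : ∀ a, a ≠ .new → a ≠ .cur → s2.m a = s1.m a := fun a ha ha' =>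
    Cmd.exec_m _ _ a (by simp [represent, extend, tryLabel, Cmd.arrWrites, ha, ha'])
  have hv2 : ∀ y, y ∈ [Var.i1, .ok, .M] → s2.v y = s1.v y := by
    intro y hy
    simp only [List.mem_cons, List.not_mem_nil, or_false] at hy
    rcases hy with rfl | rfl | rfl <;>
      exact Cmd.exec_v _ _ _ (by simp [represent, extend, tryLabel, Cmd.varWrites])
  -- the possible labels of the new vertex, before the sequence is sorted again
  have hlastiff : ∀ z, (∃ r < s2.v .cnt, s2.m .cur r i = z) ↔
      ∃ y, GoodOn (arc s) (storedDot s) (list s) (B '' Set.Iio (i + 1)) y ∧ y (B i) = z := by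
    intro z
    rw [hrep.exists_last_iff, ← himg, ← hlast,
      exists_goodOn_image_iff _ hinj (show i ∈ Set.Iio (i + 1) by simp)]
    unfold seqList
    rw [hd1, hlist1, show seqArc s1 = fun a b => arc s (s1.m .seq 0 a) (s1.m .seq 0 b) from
      funext fun a => funext fun b => propext (harc1 a b)]
  by_cases hcnt : s2.v .cnt = 0
  · have hexec : addVertex.exec w N s = s2.setV .ok (min 0 N) := by
      have h1 : addVertex.exec w N s =
          (Cmd.ite (var .cnt) reorder (assign .ok (const 0))).exec w N s2 :=
        if_pos hok
      rw [h1]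
      exact if_neg (not_not.2 hcnt)
    have hok0 : (addVertex.exec w N s).v .ok = 0 := by rw [hexec]; simp
    refine ⟨fun h => absurd hok0 h, fun h => absurd hok0 h, fun h => absurd hok0 h,
      fun h => absurd hok0 h, fun _ => ?_⟩
    rintro ⟨y, hy⟩
    obtain ⟨r, hr, -⟩ := (hlastiff _).2 ⟨y, hy, rfl⟩
    omega
  · have hexec : addVertex.exec w N s = reorder.exec w N s2 := by
      have h1 : addVertex.exec w N s =
          (Cmd.ite (var .cnt) reorder (assign .ok (const 0))).exec w N s2 :=
        if_pos hok
      rw [h1]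
      exact if_pos hcnt
    have hT2 : seqArc s2 = seqArc s1 := by
      unfold seqArc; rw [hm2 _ (by simp) (by simp), hm2 _ (by simp) (by simp)]
    have hd2 : storedDot s2 = storedDot s1 := by unfold storedDot; rw [hm2 _ (by simp) (by simp)]
    have hseq2 : s2.m .seq = s1.m .seq := hm2 _ (by simp) (by simp)
    have hM2 : s2.v .M = s.v .M := (hv2 _ (by simp)).trans hM1
    obtain ⟨⟨x', hx'⟩, himg', hinj'⟩ := exec_reorder (w := w) hb2 (e := i + 1) (L := seqList s1)
      ((hv2 _ (by simp)).trans hi1) (hT2 ▸ hT) (by rw [hd2, hd1]; exact hd)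
      (fun a z h => by rw [hM2, ← hM1]; exact h.1)
      (by rw [hT2, hd2]; exact hrep.good 0 (by omega)) (by rw [hseq2]; exact hinj)
    rw [← hexec] at hx' himg' hinj'
    have hmr : ∀ a, a ≠ .tmp → a ≠ .seq → (addVertex.exec w N s).m a = s2.m a := fun a ha ha' => by
      rw [hexec]; exact Cmd.exec_m _ _ a (by simp [reorder, Cmd.arrWrites, ha, ha'])
    have hvr : (addVertex.exec w N s).v .cnt = s2.v .cnt := by
      rw [hexec]; exact Cmd.exec_v _ _ _ (by simp [reorder, Cmd.varWrites])
    have hokr : (addVertex.exec w N s).v .ok ≠ 0 := by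
      rw [hexec, Cmd.exec_v _ _ _ (by simp [reorder, Cmd.varWrites]), hv2 _ (by simp),
        hv1 _ (by simp)]
      exact hok
    refine ⟨fun _ => by rw [himg', hseq2, himg], fun _ => hinj', fun _ => ⟨x', ?_⟩,
      fun _ i' hi' z => ?_,
      fun h => absurd h hokr⟩
    · have hdr : storedDot (addVertex.exec w N s) = storedDot s := by
        unfold storedDot; rw [hmr _ (by simp) (by simp), hm2 _ (by simp) (by simp), hm1 _ (by simp)]
      have hTr : (addVertex.exec w N s).m .T = s.m .T := by
        rw [hmr _ (by simp) (by simp), hm2 _ (by simp) (by simp), hm1 _ (by simp)]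
      rw [hM2, hdr] at hx'
      unfold seqArc at hx'
      rw [hTr] at hx'
      exact hx'
    · obtain rfl : i = i' := by omega
      rw [hvr, hmr _ (by simp) (by simp)]
      exact hlastiff z

/-- The block of the edge `up` of a graph on the vertices below `n`, as in
`SimpleGraph.edgeBlock`. -/
def blockSet (T : ℕ → ℕ → Prop) (n u p : ℕ) : Set ℕ :=
  {v | v < n ∧ (v = p ∨ v = u ∨ ((T v u ∨ T u v) ∧ (T v p ∨ T p v)))}

theorem holds_adjacent (s : S) (a b : Var) :
    (adjacent a b).Holds w s ↔ arc s (s.v a) (s.v b) ∨ arc s (s.v b) (s.v a) := by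
  rw [adjacent, Expr.holds_or]; rfl

/-- The array `B` lists the vertices of the block of the edge `up`, with `p` in the last position. -/
theorem exec_collect {s : S} (hs : s.Bounded N) (hp : s.v .p < s.v .n)
    (hup : s.v .u ≠ s.v .p) (hpp : ¬ arc s (s.v .p) (s.v .p)) (hnN : s.v .n + 1 ≤ N) :
    (collect.exec w N s).v .m = (collect.exec w N s).v .mm + 1 ∧ (collect.exec w N s).v .m ≤ N ∧
    (collect.exec w N s).m .B 0 ((collect.exec w N s).v .mm) = s.v .p ∧
    (collect.exec w N s).m .B 0 '' Set.Iio ((collect.exec w N s).v .m) =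
      blockSet (arc s) (s.v .n) (s.v .u) (s.v .p) ∧
    Set.InjOn ((collect.exec w N s).m .B 0) (Set.Iio ((collect.exec w N s).v .m)) := by
  set p := s.v .p with hpd
  set u := s.v .u with hud
  set n := s.v .n with hnd
  set s1 := s.setV .m (min 0 N) with hs1
  have hb1 : s1.Bounded N := hs.setV _ (min_le_right _ _)
  set s2 := scan.exec w N s1 with hs2
  have hv2 : ∀ y, y ≠ .w → y ≠ .m → s2.v y = s.v y := by
    intro y hy hy'
    rw [hs2, Cmd.exec_v scan s1 _ (by simp [scan, Cmd.varWrites, hy, hy']), hs1, Store.setV_v,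
      if_neg hy']
  have hb2 : s2.Bounded N := Cmd.exec_bounded _ hb1
  have hQ : Set.InjOn (s2.m .B 0) (Set.Iio (s2.v .m)) ∧
      s2.m .B 0 '' Set.Iio (s2.v .m) =
        {v | v < n ∧ (v = u ∨ ((arc s v u ∨ arc s u v) ∧ (arc s v p ∨ arc s p v)))} ∧
      s2.v .m ≤ n := by
    set body : C := .ite inBlock
      (.seq (put .B (const 0) (var .m) (var .w)) (assign .m (.add (var .m) (const 1)))) skip
      with hbody
    have := Cmd.loop_rule (w := w) (x := .w) (y := .n) (p := body) hb1
      (fun x t => Set.InjOn (t.m .B 0) (Set.Iio (t.v .m)) ∧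
        t.m .B 0 '' Set.Iio (t.v .m) =
          {v | v < x ∧ (v = u ∨ ((arc s v u ∨ arc s u v) ∧ (arc s v p ∨ arc s p v)))} ∧
        t.v .m ≤ x) ?_ ?_
    · have h1 : s1.v .n = n := by simp [hs1, hnd]
      rw [h1] at this
      exact this
    · have h1 : s1.v .m = 0 := by simp [hs1]
      simp [h1]
    · rintro x t hx hbt hvt hmt ⟨hi, himg, hle⟩
      have hxn : x < n := by simpa [hs1, hnd] using hx
      set t1 := t.setV .w x with ht1
      have eu : t1.v .u = u := by
        rw [ht1, Store.setV_v, if_neg (by simp), hvt _ (by simp [hbody, Cmd.varWrites])]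
        simp [hs1, hud]
      have ep : t1.v .p = p := by
        rw [ht1, Store.setV_v, if_neg (by simp), hvt _ (by simp [hbody, Cmd.varWrites])]
        simp [hs1, hpd]
      have ew : t1.v .w = x := by simp [ht1]
      have em : t1.v .m = t.v .m := by simp [ht1]
      have eT : arc t1 = arc s := by
        unfold arc
        rw [ht1, Store.setV_m, hmt _ (by simp [hbody, Cmd.arrWrites])]; rfl
      have hholds : inBlock.Holds w t1 ↔
          (x = u ∨ ((arc s x u ∨ arc s u x) ∧ (arc s x p ∨ arc s p x))) := by
        rw [inBlock, Expr.holds_or, Expr.holds_eq, Expr.holds_and, holds_adjacent, holds_adjacent]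
        simp only [Expr.eval, eu, ep, ew, eT]
      have hset : ∀ v, (v < x + 1 ∧ (v = u ∨ ((arc s v u ∨ arc s u v) ∧ (arc s v p ∨ arc s p v)))) ↔
          (v < x ∧ (v = u ∨ ((arc s v u ∨ arc s u v) ∧ (arc s v p ∨ arc s p v)))) ∨
            (v = x ∧ inBlock.Holds w t1) := by
        intro v
        rw [hholds, Nat.lt_succ_iff_lt_or_eq, or_and_right]
        constructor
        · rintro (h | ⟨rfl, h⟩)
          exacts [Or.inl h, Or.inr ⟨rfl, h⟩]
        · rintro (h | ⟨rfl, h⟩)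
          exacts [Or.inl h, Or.inr ⟨rfl, h⟩]
      by_cases hc : inBlock.Holds w t1
      · have hexec : body.exec w N t1 = (t1.setM .B 0 (t.v .m) x).setV .m (t.v .m + 1) := by
          have h1 : body.exec w N t1 =
              (t1.setM .B 0 (t1.v .m) (min (t1.v .w) N)).setV .m (min (t1.v .m + 1) N) := if_pos hc
          rw [h1, em, ew, min_eq_left (by omega), min_eq_left (by omega)]
        rw [hexec]
        have hBv : ∀ c, ((t1.setM .B 0 (t.v .m) x).setV .m (t.v .m + 1)).m .B 0 c =
            if c = t.v .m then x else t.m .B 0 c := by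
          intro c
          rw [Store.setV_m, Store.setM_m]
          simp [ht1]
        have hmv : ((t1.setM .B 0 (t.v .m) x).setV .m (t.v .m + 1)).v .m = t.v .m + 1 := by simp
        have hlt : ∀ c < t.v .m, t.m .B 0 c < x := by
          intro c hc
          have : t.m .B 0 c ∈ t.m .B 0 '' Set.Iio (t.v .m) := ⟨c, hc, rfl⟩
          rw [himg] at this
          exact this.1
        rw [hmv]
        refine ⟨?_, ?_, by omega⟩
        · intro a ha b hb hab
          rw [hBv, hBv] at hab
          rcases Nat.lt_succ_iff_lt_or_eq.1 ha with ha | rfl <;>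
            rcases Nat.lt_succ_iff_lt_or_eq.1 hb with hb | rfl
          · rw [if_neg ha.ne, if_neg hb.ne] at hab
            exact hi ha hb hab
          · rw [if_neg ha.ne, if_pos rfl] at hab
            exact absurd hab (hlt a ha).ne
          · rw [if_neg hb.ne, if_pos rfl] at hab
            exact absurd hab.symm (hlt b hb).ne
          · rfl
        · ext v
          rw [Set.mem_ofPred_eq, hset]
          have himg' : v ∈ t.m .B 0 '' Set.Iio (t.v .m) ↔ _ := Set.ext_iff.1 himg v
          rw [Set.mem_ofPred_eq] at himg'
          rw [← himg']
          constructor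
          · rintro ⟨c, hc', rfl⟩
            rw [hBv]
            rcases Nat.lt_succ_iff_lt_or_eq.1 hc' with hc' | rfl
            · rw [if_neg hc'.ne]
              exact Or.inl ⟨c, hc', rfl⟩
            · rw [if_pos rfl]
              exact Or.inr ⟨rfl, hc⟩
          · rintro (⟨c, hc', rfl⟩ | ⟨rfl, -⟩)
            · have hc' : c < t.v .m := hc'
              exact ⟨c, Nat.lt_succ_of_lt hc', by rw [hBv, if_neg hc'.ne]⟩
            · exact ⟨t.v .m, Nat.lt_succ_self _, by rw [hBv, if_pos rfl]⟩
      · have hexec : body.exec w N t1 = t1 := if_neg hc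
        rw [hexec, em, show t1.m = t.m from rfl]
        refine ⟨hi, ?_, by omega⟩
        rw [himg]
        ext v
        rw [Set.mem_ofPred_eq, Set.mem_ofPred_eq, hset]
        exact ⟨Or.inl, fun h => h.resolve_right fun h => hc h.2⟩
  obtain ⟨hinj, himg, hle⟩ := hQ
  have hp2 : s2.v .p = p := hv2 _ (by simp) (by simp)
  have hexec : collect.exec w N s =
      ((s2.setM .B 0 (s2.v .m) p).setV .mm (s2.v .m)).setV .m (s2.v .m + 1) := by
    simp only [collect, Cmd.exec, Expr.eval]
    rw [← hs1, ← hs2]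
    simp only [Store.setV_v, Store.setM_v, if_neg (show Var.m ≠ Var.mm by simp), hp2]
    rw [min_eq_left (by omega), min_eq_left (by omega), min_eq_left (by omega)]
  have hm' : (collect.exec w N s).v .m = s2.v .m + 1 := by rw [hexec]; simp
  have hmm' : (collect.exec w N s).v .mm = s2.v .m := by rw [hexec]; simp
  have hBv : ∀ c, (collect.exec w N s).m .B 0 c = if c = s2.v .m then p else s2.m .B 0 c := by
    intro c
    rw [hexec, Store.setV_m, Store.setV_m, Store.setM_m]
    simp
  have hnp : ∀ c < s2.v .m, s2.m .B 0 c ≠ p := by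
    intro c hc he
    have : p ∈ s2.m .B 0 '' Set.Iio (s2.v .m) := ⟨c, hc, he⟩
    rw [himg] at this
    rcases this.2 with h | ⟨-, h | h⟩
    exacts [hup h.symm, hpp h, hpp h]
  rw [hm', hmm']
  refine ⟨rfl, by omega, by rw [hBv, if_pos rfl], ?_, ?_⟩
  · have h1 : Set.Iio (s2.v .m + 1) = insert (s2.v .m) (Set.Iio (s2.v .m)) := by
      ext q; simp only [Set.mem_Iio, Set.mem_insert_iff]; omega
    rw [h1, Set.image_insert_eq, hBv, if_pos rfl, Set.image_congr (g := s2.m .B 0)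
      (fun q hq => by rw [hBv, if_neg (ne_of_lt hq)]), himg]
    ext v
    simp only [blockSet, Set.mem_insert_iff, Set.mem_ofPred_eq]
    constructor
    · rintro (rfl | ⟨h, h'⟩)
      exacts [⟨hp, Or.inl rfl⟩, ⟨h, Or.inr h'⟩]
    · rintro ⟨h, rfl | h'⟩
      exacts [Or.inl rfl, Or.inr ⟨h, h'⟩]
  · intro a ha b hb hab
    rw [hBv, hBv] at hab
    rcases Nat.lt_succ_iff_lt_or_eq.1 ha with ha | rfl <;>
      rcases Nat.lt_succ_iff_lt_or_eq.1 hb with hb | rfl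
    · rw [if_neg ha.ne, if_neg hb.ne] at hab
      exact hinj ha hb hab
    · rw [if_neg ha.ne, if_pos rfl] at hab
      exact absurd hab (hnp a ha)
    · rw [if_neg hb.ne, if_pos rfl] at hab
      exact absurd hab.symm (hnp b hb)
    · rfl

/-- What the program relies on while it works on the lists: the arcs form a tournament on every
block, the table of inner products is symmetric, and `N` is large. -/
structure Ready (N : ℕ) (s : S) : Prop where
  bounded : s.Bounded N
  irrefl : ∀ v, ¬ arc s v v
  tournament : ∀ u < s.v .n, ∀ p < s.v .n, arc s u p ∨ arc s p u →
    ∀ a ∈ blockSet (arc s) (s.v .n) u p, ∀ b ∈ blockSet (arc s) (s.v .n) u p, a ≠ b →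
      (arc s a b ↔ ¬ arc s b a)
  symm : ∀ x y, storedDot s x y → storedDot s y x
  pos : 0 < s.v .M
  bound : repBound (s.v .M) + 1 ≤ N
  n_le : s.v .n + 1 ≤ N

/-- The effect of `filterList` on the lists. -/
theorem list_filterList {s : S} (hs : Ready N s) (hu : s.v .u < s.v .n) (hp : s.v .p < s.v .n)
    (hup : arc s (s.v .u) (s.v .p) ∨ arc s (s.v .p) (s.v .u)) (v z : ℕ) :
    list (filterList.exec w N s) v z ↔ if v = s.v .p then
      ∃ y, GoodOn (arc s) (storedDot s) (list s) (blockSet (arc s) (s.v .n) (s.v .u) (s.v .p)) y ∧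
        y (s.v .p) = z else list s v z := by
  have hne : s.v .u ≠ s.v .p := by
    intro e
    rw [e] at hup
    exact hs.irrefl _ (hup.elim id id)
  obtain ⟨h1, h2, h3, h4, h5⟩ := exec_collect (w := w) hs.bounded hp hne (hs.irrefl _) hs.n_le
  set s1 := collect.exec w N s with hs1
  have hb1 : s1.Bounded N := Cmd.exec_bounded _ hs.bounded
  set s2 := s1.setV .ok (min 1 N) with hs2
  have hb2 : s2.Bounded N := hb1.setV _ (min_le_right _ _)
  have hN : 1 ≤ N := by have := hs.n_le; omega
  have hok2 : s2.v .ok = 1 := by simp [hs2, hN]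
  have hv2 : ∀ y, y ∈ [Var.n, .M, .p, .u] → s2.v y = s.v y := by
    intro y hy
    simp only [List.mem_cons, List.not_mem_nil, or_false] at hy
    rcases hy with rfl | rfl | rfl | rfl <;>
    · rw [hs2, Store.setV_v, if_neg (by simp), hs1,
        Cmd.exec_v _ _ _ (by simp [collect, scan, Cmd.varWrites])]
  have hm2 : ∀ a, a ≠ .B → s2.m a = s.m a := fun a ha => by
    rw [hs2, Store.setV_m, hs1, Cmd.exec_m _ _ _ (by simp [collect, scan, Cmd.arrWrites, ha])]
  set m := s1.v .m with hm
  set B := s1.m .B 0 with hB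
  set block := blockSet (arc s) (s.v .n) (s.v .u) (s.v .p) with hblock
  have hm2' : s2.v .m = m := by simp [hs2, hm]
  have hsearch : Searching (arc s) (storedDot s) (list s) (s.v .M) B m
      ((loop .i .m addVertex : C).exec w N s2) := by
    have := Cmd.loop_rule (w := w) (x := .i) (y := .m) (p := addVertex) hb2
      (fun i t => Searching (arc s) (storedDot s) (list s) (s.v .M) B i t) ?_ ?_
    · rwa [hm2'] at this
    · exact ⟨fun _ => by simp, fun _ => by simp, fun _ => ⟨fun _ => 0, by simp [SortedBy]⟩,
        fun _ i' hi' => absurd hi' (by omega), fun h => by omega⟩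
    · intro i t hi hbt hvt hmt ht
      rw [hm2'] at hi
      set t1 := t.setV .i i with ht1
      have hbt1 : t1.Bounded N := hbt.setV _ (by omega)
      have em : ∀ a, a ∉ [Arr.seq, .cur, .new, .tmp] → t1.m a = s2.m a := by
        intro a ha
        simp only [List.mem_cons, List.not_mem_nil, or_false, not_or] at ha
        rw [ht1, Store.setV_m, hmt _ (by simp [addVertex, represent, extend, tryLabel, reorder,
          Cmd.arrWrites, ha])]
      have ev : t1.v .M = s.v .M := by
        rw [ht1, Store.setV_v, if_neg (by simp), hvt _ (by simp [addVertex, represent, extend,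
          tryLabel, reorder, Cmd.varWrites]), hv2 _ (by simp)]
      have ei : t1.v .i = i := by simp [ht1]
      have eT : arc t1 = arc s := by unfold arc; rw [em _ (by simp), hm2 _ (by simp)]
      have ed : storedDot t1 = storedDot s := by unfold storedDot; rw [em _ (by simp), hm2 _ (by simp)]
      have eL : list t1 = list s := by unfold list; rw [em _ (by simp), hm2 _ (by simp), ev]
      have := searching_addVertex (w := w) hbt1 (m := m) (B := B)
        (fun c _ => by rw [em _ (by simp)]; rfl) h5 (by rw [ei]; exact hi) h2
        (fun v _ => by rw [eT]; exact hs.irrefl v)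
        (by rw [eT, h4]; exact hs.tournament _ hu _ hp hup)
        (by rw [ed]; exact hs.symm) (by rw [ev]; exact hs.pos) (by rw [ev]; exact hs.bound)
        (by
          rw [eT, ed, eL, ev, ei]
          have e1 : t1.v .ok = t.v .ok := by simp [ht1]
          have e2 : t1.v .cnt = t.v .cnt := by simp [ht1]
          have e3 : t1.m = t.m := rfl
          exact ⟨by rw [e1, e3]; exact ht.image, by rw [e1, e3]; exact ht.injOn,
            by rw [e1, e3]; exact ht.sorted, by rw [e1, e2, e3]; exact ht.last,
            by rw [e1]; exact ht.none⟩)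
      rwa [eT, ed, eL, ev, ei] at this
  set s3 := (loop .i .m addVertex : C).exec w N s2 with hs3
  have hb3 : s3.Bounded N := Cmd.exec_bounded _ hb2
  have hv3 : ∀ y, y ∈ [Var.n, .M, .p, .u, .mm] → s3.v y = s2.v y := by
    intro y hy
    simp only [List.mem_cons, List.not_mem_nil, or_false] at hy
    rcases hy with rfl | rfl | rfl | rfl | rfl <;>
      exact Cmd.exec_v _ _ _ (by simp [addVertex, represent, extend, tryLabel, reorder,
        Cmd.varWrites])
  have hL3 : s3.m .L = s.m .L := by
    rw [hs3, Cmd.exec_m _ _ _ (by simp [addVertex, represent, extend, tryLabel, reorder,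
      Cmd.arrWrites]), hm2 _ (by simp)]
  have hp3 : s3.v .p = s.v .p := by rw [hv3 _ (by simp), hv2 _ (by simp)]
  have hM3 : s3.v .M = s.v .M := by rw [hv3 _ (by simp), hv2 _ (by simp)]
  have hmm3 : s3.v .mm = s1.v .mm := by rw [hv3 _ (by simp)]; simp [hs2]
  set test : E := and (var .ok) (ex .r .cnt (eq (get .cur (var .r) (var .mm)) (var .z))) with htest
  have htest' : ∀ z', ∀ t : S, (∀ x', x' ≠ Var.z → t.v x' = s3.v x') → t.m .cur = s3.m .cur →
      t.v .z = z' → (test.Holds w t ↔ ∃ y, GoodOn (arc s) (storedDot s) (list s) block y ∧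
        y (s.v .p) = z') := by
    intro z' t hv hc hz
    rw [htest, Expr.holds_and, Expr.holds_ex]
    simp only [Expr.holds_eq, Expr.eval, Store.setV_v, Store.setV_m, if_true,
      if_neg (show Var.mm ≠ Var.r by simp), if_neg (show Var.z ≠ Var.r by simp), hv .cnt (by simp),
      hv .mm (by simp), hc, hz, hmm3]
    have h6 : (var .ok : E).Holds w t ↔ s3.v .ok ≠ 0 := by
      rw [← hv .ok (by simp)]; rfl
    rw [h6, ← h4, ← h3]
    by_cases hok : s3.v .ok = 0
    · have := hsearch.none hok
      constructor
      · exact fun h => absurd hok h.1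
      · rintro ⟨y, hy, -⟩
        exact absurd ⟨y, hy⟩ this
    · rw [and_iff_right hok]
      exact hsearch.last hok (s1.v .mm) h1 z'
  classical
  have hfinal : ∀ i' j', (filterList.exec w N s).m .L i' j' =
      if i' = s.v .p ∧ j' < s.v .M then
        (if ∃ y, GoodOn (arc s) (storedDot s) (list s) block y ∧ y (s.v .p) = j' then 1 else 0)
      else s.m .L i' j' := by
    intro i' j'
    have := Cmd.exec_loop_put (w := w) (x := .z) (y := .M) (a := Arr.L) (e := var .p)
      (g := bool test) hb3 (s.v .p)
      (fun j' => if ∃ y, GoodOn (arc s) (storedDot s) (list s) block y ∧ y (s.v .p) = j' then 1 else 0)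
      (fun i _ => by split_ifs <;> omega) (by
        intro i _ t hv hm _ hx
        refine ⟨by simp [Expr.eval, hv, hp3], ?_⟩
        rw [Expr.eval_bool]
        simp only [htest' i t hv (hm _ (by simp)) hx]) i' j'
    rw [hM3, hL3] at this
    exact this
  have hM' : (filterList.exec w N s).v .M = s.v .M :=
    Cmd.exec_v _ _ _ (by simp [filterList, collect, scan, addVertex, represent, extend, tryLabel,
      reorder,
      Cmd.varWrites])
  unfold list
  rw [hM', hfinal]
  by_cases hvp : v = s.v .p
  · rw [if_pos hvp]
    by_cases hzM : z < s.v .M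
    · rw [if_pos ⟨hvp, hzM⟩]
      simp only [hzM, true_and]
      show _ ↔ ∃ y, GoodOn (arc s) (storedDot s) (list s) block y ∧ y (s.v .p) = z
      split_ifs with hex <;> simp [hex]
    · simp only [hzM, false_and, false_iff]
      rintro ⟨y, hy, hyz⟩
      exact hzM (hyz ▸ (hy.mem (s.v .p) ⟨hp, Or.inl rfl⟩).1)
  · rw [if_neg fun h => hvp h.1, if_neg hvp]

/-! ### Iterated filtering of the lists -/

/-- Remove from the list of `p` the labels that do not extend to the block of the edge `up`. -/
def filtered (T d : ℕ → ℕ → Prop) (n u p : ℕ) (L : ℕ → ℕ → Prop) (v z : ℕ) : Prop :=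
  if v = p then ∃ y, GoodOn T d L (blockSet T n u p) y ∧ y p = z else L v z

/-- No label can be removed. -/
def Stable (T d : ℕ → ℕ → Prop) (n : ℕ) (L : ℕ → ℕ → Prop) : Prop :=
  ∀ p < n, ∀ u < n, T u p ∨ T p u → filtered T d n u p L = L

/-- `L'` arises from `L` by the filters of the pairs `(p, u)` with `P p u`. -/
structure FilterSteps (T d : ℕ → ℕ → Prop) (n : ℕ) (P : ℕ → ℕ → Prop) (L L' : ℕ → ℕ → Prop) :
    Prop where
  le : L' ≤ L
  sound : ∀ y, GoodOn T d L (Set.Iio n) y → GoodOn T d L' (Set.Iio n) y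
  of_stable : Stable T d n L → L' = L
  stable_of : L' = L → ∀ p < n, ∀ u < n, P p u → T u p ∨ T p u → filtered T d n u p L = L

section Filtering

variable {T d : ℕ → ℕ → Prop} {n : ℕ} {L L' : ℕ → ℕ → Prop} {P P' : ℕ → ℕ → Prop}

theorem filtered_le {u p : ℕ} (hp : p < n) : filtered T d n u p L ≤ L := by
  intro v z h
  unfold filtered at h
  split_ifs at h with hv
  · obtain ⟨y, hy, hz⟩ := h
    rw [hv, ← hz]
    exact hy.mem p ⟨hp, Or.inl rfl⟩
  · exact h

/-- Filtering loses no good labelling of the whole graph. -/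
theorem goodOn_filtered {u p : ℕ} {y : ℕ → ℕ} (h : GoodOn T d L (Set.Iio n) y) :
    GoodOn T d (filtered T d n u p L) (Set.Iio n) y := by
  refine ⟨fun v hv => ?_, h.no_triangle⟩
  unfold filtered
  split_ifs with hvp
  · exact ⟨y, h.mono fun x hx => hx.1, by rw [hvp]⟩
  · exact h.mem v hv

theorem filterSteps_refl : FilterSteps T d n (fun _ _ => False) L L :=
  ⟨le_rfl, fun _ h => h, fun _ => rfl, fun _ _ _ _ _ h => h.elim⟩

theorem FilterSteps.mono (h : FilterSteps T d n P L L')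
    (hP : ∀ p < n, ∀ u < n, P' p u → T u p ∨ T p u → P p u) : FilterSteps T d n P' L L' :=
  ⟨h.le, h.sound, h.of_stable, fun he p hp u hu hP' ha =>
    h.stable_of he p hp u hu (hP p hp u hu hP' ha) ha⟩

theorem FilterSteps.step {u p : ℕ} (h : FilterSteps T d n P L L') (hp : p < n) (hu : u < n)
    (ha : T u p ∨ T p u) :
    FilterSteps T d n (fun p' u' => P p' u' ∨ (p' = p ∧ u' = u)) L (filtered T d n u p L') := by
  refine ⟨(filtered_le hp).trans h.le, fun y hy => goodOn_filtered (h.sound y hy), fun hs => ?_,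
    fun he p' hp' u' hu' hP ha' => ?_⟩
  · rw [h.of_stable hs]
    exact hs p hp u hu ha
  · have hL : L' = L := le_antisymm h.le (he ▸ filtered_le hp)
    rcases hP with hP | ⟨rfl, rfl⟩
    · exact h.stable_of hL p' hp' u' hu' hP ha'
    · rw [← hL]
      rw [he, hL]

theorem Ready.congr {s t : S} (hs : Ready N s) (hb : t.Bounded N) (hT : t.m .T = s.m .T)
    (hd : t.m .dot = s.m .dot) (hn : t.v .n = s.v .n) (hM : t.v .M = s.v .M) : Ready N t := by
  have hT : arc t = arc s := by unfold arc; rw [hT]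
  have hd : storedDot t = storedDot s := by unfold storedDot; rw [hd]
  exact ⟨hb, by rw [hT]; exact hs.irrefl, by rw [hT, hn]; exact hs.tournament,
    by rw [hd]; exact hs.symm, by rw [hM]; exact hs.pos, by rw [hM]; exact hs.bound,
    by rw [hn]; exact hs.n_le⟩

/-- A round that changes nothing proves that the lists are stable. -/
theorem filterSteps_round {s : S} (hs : Ready N s) :
    FilterSteps (arc s) (storedDot s) (s.v .n) (fun _ _ => True) (list s)
      (list (round.exec w N s)) := by
  set inner : C := .ite (adjacent .u .p) filterList skip with hinner
  have hwv : ∀ y, y ∈ [Var.n, .M] → y ∉ (filterList : C).varWrites := by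
    intro y hy
    simp only [List.mem_cons, List.not_mem_nil, or_false] at hy
    rcases hy with rfl | rfl <;>
      simp [filterList, collect, scan, addVertex, represent, extend, tryLabel, reorder,
        Cmd.varWrites]
  have hwp : Var.p ∉ (filterList : C).varWrites := by
    simp [filterList, collect, scan, addVertex, represent, extend, tryLabel, reorder,
      Cmd.varWrites]
  have hwa : ∀ a, a ∈ [Arr.T, .dot] → a ∉ (filterList : C).arrWrites := by
    intro a ha
    simp only [List.mem_cons, List.not_mem_nil, or_false] at ha
    rcases ha with rfl | rfl <;>
      simp [filterList, collect, scan, addVertex, represent, extend, tryLabel, reorder,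
        Cmd.arrWrites]
  have := Cmd.loop_rule (w := w) (x := .p) (y := .n) (p := loop .u .n inner) hs.bounded
    (fun p t => FilterSteps (arc s) (storedDot s) (s.v .n) (fun p' _ => p' < p) (list s) (list t))
    (filterSteps_refl.mono fun _ _ _ _ h _ => absurd h (by omega)) ?_
  · exact this.mono fun p hp _ _ _ _ => hp
  · intro p t hp hbt hvt hmt ht
    set t0 := t.setV .p p with ht0
    have hb0 : t0.Bounded N := hbt.setV _ (hp.le.trans (hs.bounded.v_le _))
    have ev0 : ∀ y, y ∈ [Var.n, .M] → t0.v y = s.v y := by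
      intro y hy
      have h1 := hwv y hy
      simp only [List.mem_cons, List.not_mem_nil, or_false] at hy
      have h2 : y ≠ .p ∧ y ≠ .u := by rcases hy with rfl | rfl <;> simp
      rw [ht0, Store.setV_v, if_neg h2.1, hvt _ (by
        simp only [hinner, Cmd.varWrites, List.mem_cons, List.mem_append, not_or]
        exact ⟨h2.1, h2.2, h1, by simp⟩)]
    have em0 : ∀ a, a ∈ [Arr.T, .dot] → t0.m a = s.m a := fun a ha =>
      hmt a (by
        simp only [hinner, Cmd.arrWrites, List.mem_append, not_or]
        exact ⟨hwa a ha, by simp⟩)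
    have hn0 : t0.v .n = s.v .n := ev0 _ (by simp)
    have := Cmd.loop_rule (w := w) (x := .u) (y := .n) (p := inner) hb0
      (fun u t' => FilterSteps (arc s) (storedDot s) (s.v .n)
        (fun p' u' => p' < p ∨ (p' = p ∧ u' < u)) (list s) (list t')) ?_ ?_
    · rw [hn0] at this
      refine this.mono fun p' _ u' hu' h _ => ?_
      omega
    · refine FilterSteps.mono (P := fun p' _ => p' < p) (L' := list t0) ht fun _ _ _ _ h _ => ?_
      omega
    · intro u t' hu hbt' hvt' hmt' ht'
      rw [hn0] at hu
      set t1 := t'.setV .u u with ht1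
      have hb1 : t1.Bounded N := hbt'.setV _ (by have := hs.n_le; omega)
      have ev1 : ∀ y, y ∈ [Var.n, .M] → t1.v y = s.v y := by
        intro y hy
        have h1 := hwv y hy
        have h2 : y ≠ .u := by
          simp only [List.mem_cons, List.not_mem_nil, or_false] at hy
          rcases hy with rfl | rfl <;> simp
        rw [ht1, Store.setV_v, if_neg h2, hvt' _ (by
          simp only [hinner, Cmd.varWrites, List.mem_cons, List.mem_append, not_or]
          exact ⟨h2, h1, by simp⟩), ev0 y hy]
      have em1 : ∀ a, a ∈ [Arr.T, .dot] → t1.m a = s.m a := fun a ha =>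
        (hmt' a (by
          simp only [hinner, Cmd.arrWrites, List.mem_append, not_or]
          exact ⟨hwa a ha, by simp⟩)).trans (em0 a ha)
      have eu : t1.v .u = u := by simp [ht1]
      have ep : t1.v .p = p := by
        rw [ht1, Store.setV_v, if_neg (by simp), hvt' _ (by
          simp only [hinner, Cmd.varWrites, List.mem_cons, List.mem_append, not_or]
          exact ⟨by simp, hwp, by simp⟩)]
        simp [ht0]
      have hready : Ready N t1 := hs.congr hb1 (em1 _ (by simp)) (em1 _ (by simp))
        (ev1 _ (by simp)) (ev1 _ (by simp))
      have eT : arc t1 = arc s := by unfold arc; rw [em1 _ (by simp)]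
      have ed : storedDot t1 = storedDot s := by unfold storedDot; rw [em1 _ (by simp)]
      have eL : list t1 = list t' := by unfold list; simp [ht1]
      have hadj : (adjacent .u .p : E).Holds w t1 ↔ arc s u p ∨ arc s p u := by
        rw [holds_adjacent, eT, eu, ep]
      have hn1 : t1.v .n = s.v .n := ev1 _ (by simp)
      by_cases ha : arc s u p ∨ arc s p u
      · have hexec : inner.exec w N t1 = filterList.exec w N t1 := if_pos (hadj.2 ha)
        have hlist : list (inner.exec w N t1) =
            filtered (arc s) (storedDot s) (s.v .n) u p (list t') := by
          funext v z
          have h1 := list_filterList (w := w) hready (by rw [eu, hn1]; exact hu)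
            (by rw [ep, hn1]; exact hp) (by rw [eT, eu, ep]; exact ha) v z
          rw [eT, ed, eu, ep, hn1, eL] at h1
          rw [hexec, h1, filtered]
        rw [hlist]
        refine (ht'.step hp hu ha).mono fun p' _ u' _ h _ => ?_
        omega
      · have hexec : inner.exec w N t1 = t1 := if_neg (hadj.not.2 ha)
        rw [hexec, eL]
        refine ht'.mono fun p' _ u' _ h ha' => ?_
        have : ¬ (p' = p ∧ u' = u) := by
          rintro ⟨rfl, rfl⟩
          exact ha ha'
        omega

open Classical in
/-- The total number of labels in the lists. -/
noncomputable def listSize (n M : ℕ) (L : ℕ → ℕ → Prop) : ℕ :=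
  ((Finset.range n ×ˢ Finset.range M).filter fun vz => L vz.1 vz.2).card

theorem listSize_lt {M : ℕ} (hle : L' ≤ L) (hL : ∀ v z, L v z → v < n ∧ z < M) (hne : L' ≠ L) :
    listSize n M L' < listSize n M L := by
  classical
  obtain ⟨v, z, h, h'⟩ : ∃ v z, L v z ∧ ¬ L' v z := by
    by_contra hcon
    push Not at hcon
    exact hne (le_antisymm hle fun v z h => hcon v z h)
  refine Finset.card_lt_card (Finset.ssubset_iff_of_subset ?_ |>.2 ⟨(v, z), ?_, ?_⟩)
  · intro vz hvz
    simp only [Finset.mem_filter] at hvz ⊢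
    exact ⟨hvz.1, hle _ _ hvz.2⟩
  · simpa [h] using hL v z h
  · simp [h']

/-- The answer of the search: it ends with stable lists that still contain all good labellings, and
the answer is `1` if and only if none of them is empty. -/
theorem exec_search {s : S} (hs : Ready N s) (hM : s.v .M + 1 ≤ N)
    (hL : ∀ v z, list s v z → v < s.v .n) :
    ∃ L, Stable (arc s) (storedDot s) (s.v .n) L ∧ L ≤ list s ∧
      (∀ y, GoodOn (arc s) (storedDot s) (list s) (Set.Iio (s.v .n)) y →
        GoodOn (arc s) (storedDot s) L (Set.Iio (s.v .n)) y) ∧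
      ((∀ v < s.v .n, ∃ z, L v z) → (search.exec w N s).v .ans = 1) ∧
      ((¬ ∀ v < s.v .n, ∃ z, L v z) → (search.exec w N s).v .ans = 0) := by
  set n := s.v .n with hnd
  set M := s.v .M with hMd
  set s1 : S := (s.setV .M1 (M + 1)).setV .n1 (n + 1) with hs1
  have hb1 : s1.Bounded N := (hs.bounded.setV _ hM).setV _ hs.n_le
  have hm1 : s1.m = s.m := rfl
  have hready1 : Ready N s1 := hs.congr hb1 rfl rfl (by simp [hs1]) (by simp [hs1])
  have hrv : ∀ y, y ∈ [Var.n, .M, .M1, .n1] → y ∉ (round : C).varWrites := by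
    intro y hy
    simp only [List.mem_cons, List.not_mem_nil, or_false] at hy
    rcases hy with rfl | rfl | rfl | rfl <;>
      simp [round, filterList, collect, scan, addVertex, represent, extend, tryLabel, reorder,
        Cmd.varWrites]
  have hra : ∀ a, a ∈ [Arr.T, .dot] → a ∉ (round : C).arrWrites := by
    intro a ha
    simp only [List.mem_cons, List.not_mem_nil, or_false] at ha
    rcases ha with rfl | rfl <;>
      simp [round, filterList, collect, scan, addVertex, represent, extend, tryLabel, reorder,
        Cmd.arrWrites]
  let I : ℕ → S → Prop := fun c t => list t ≤ list s ∧
    (∀ y, GoodOn (arc s) (storedDot s) (list s) (Set.Iio n) y →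
      GoodOn (arc s) (storedDot s) (list t) (Set.Iio n) y) ∧
    (Stable (arc s) (storedDot s) n (list t) ∨ listSize n M (list t) + c ≤ n * M)
  have hstep : ∀ c t, t.Bounded N → (∀ y, y ∈ [Var.n, .M] → t.v y = s.v y) →
      (∀ a, a ∈ [Arr.T, .dot] → t.m a = s.m a) → I c t → I (c + 1) (round.exec w N t) := by
    rintro c t hb hv hm ⟨h1, h2, h3⟩
    have hready : Ready N t := hs.congr hb (hm _ (by simp)) (hm _ (by simp)) (hv _ (by simp))
      (hv _ (by simp))
    have eT : arc t = arc s := by unfold arc; rw [hm _ (by simp)]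
    have ed : storedDot t = storedDot s := by unfold storedDot; rw [hm _ (by simp)]
    have hF := filterSteps_round (w := w) hready
    rw [eT, ed, hv .n (by simp)] at hF
    refine ⟨hF.le.trans h1, fun y hy => hF.sound y (h2 y hy), ?_⟩
    by_cases heq : list (round.exec w N t) = list t
    · left
      rw [heq]
      exact fun p hp u hu ha => hF.stable_of heq p hp u hu trivial ha
    · right
      rcases h3 with h3 | h3
      · exact absurd (hF.of_stable h3) heq
      · have := listSize_lt (n := n) (M := M) hF.le
          (fun v z h => ⟨hL v z (h1 v z h), (h1 v z h).1⟩) heq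
        omega
  set P : C := loop .t .M1 (loop .t' .n1 round) with hP
  set s2 := P.exec w N s1 with hs2
  have hI : I ((M + 1) * (n + 1)) s2 := by
    have hM1 : s1.v .M1 = M + 1 := by simp [hs1]
    have hn1 : s1.v .n1 = n + 1 := by simp [hs1]
    have h0 : I 0 s1 := by
      have : list s1 = list s := by unfold list; simp [hs1]
      refine ⟨this.le, fun y hy => this ▸ hy, Or.inr ?_⟩
      classical
      unfold listSize
      refine (Finset.card_filter_le _ _).trans ?_
      simp
    have := Cmd.loop_rule (w := w) (x := .t) (y := .M1) (p := loop .t' .n1 round) hb1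
      (fun a t => I (a * (n + 1)) t) (by simpa using h0) ?_
    · rwa [hM1] at this
    · intro a t ha hbt hvt hmt ht
      have hbt0 : (t.setV .t a).Bounded N := hbt.setV _ (ha.le.trans (hb1.v_le _))
      have hvt' : ∀ y, y ∈ [Var.n, .M, .M1, .n1] → (t.setV .t a).v y = s1.v y := by
        intro y hy
        have h1 := hrv y hy
        have h2 : y ≠ .t ∧ y ≠ .t' := by
          simp only [List.mem_cons, List.not_mem_nil, or_false] at hy
          rcases hy with rfl | rfl | rfl | rfl <;> simp
        rw [Store.setV_v, if_neg h2.1, hvt y (by simp [Cmd.varWrites, h1, h2])]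
      have := Cmd.loop_rule (w := w) (x := .t') (y := .n1) (p := round) hbt0
        (fun b t' => I (a * (n + 1) + b) t') ht ?_
      · rw [hvt' _ (by simp), hn1] at this
        rwa [Nat.add_mul, one_mul]
      · intro b t' hb hbt1 hvt1 hmt1 ht1
        refine hstep _ _ (hbt1.setV _ (hb.le.trans (hbt0.v_le _))) ?_ ?_ ht1
        · intro y hy
          have hy' : y ∈ [Var.n, .M, .M1, .n1] := by
            simp only [List.mem_cons, List.not_mem_nil, or_false] at hy
            rcases hy with rfl | rfl <;> simp
          have h2 : y ≠ .t' ∧ y ≠ .n1 ∧ y ≠ .M1 := by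
            simp only [List.mem_cons, List.not_mem_nil, or_false] at hy
            rcases hy with rfl | rfl <;> simp
          rw [Store.setV_v, if_neg h2.1, hvt1 y (by simp [Cmd.varWrites, hrv y hy', h2]),
            hvt' y hy',
            hs1, Store.setV_v, if_neg h2.2.1, Store.setV_v, if_neg h2.2.2]
        · intro a' ha'
          rw [Store.setV_m, hmt1 a' (hra a' ha'), Store.setV_m, hmt a' (hra a' ha'), hm1]
  obtain ⟨h1, h2, h3⟩ := hI
  have hstable : Stable (arc s) (storedDot s) n (list s2) := by
    rcases h3 with h3 | h3
    · exact h3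
    · have : (M + 1) * (n + 1) = n * M + M + n + 1 := by ring
      omega
  have hN : 1 ≤ N := by omega
  have hn2 : s2.v .n = n := by
    rw [hs2, Cmd.exec_v P _ _ (by simp [hP, Cmd.varWrites, hrv])]
    simp [hs1, hnd]
  have hM2 : s2.v .M = M := by
    rw [hs2, Cmd.exec_v P _ _ (by simp [hP, Cmd.varWrites, hrv])]
    simp [hs1, hMd]
  set test : E := all .x .n (ex .y .M (get .L (var .x) (var .y))) with htest
  have htest' : test.Holds w s2 ↔ ∀ v < n, ∃ z, list s2 v z := by
    rw [htest, Expr.holds_all, hn2]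
    refine forall₂_congr fun v _ => ?_
    rw [Expr.holds_ex, Store.setV_v, if_neg (by simp), hM2]
    refine exists_congr fun z => ?_
    unfold list
    rw [hM2]
    exact Iff.rfl
  have hans : (search.exec w N s).v .ans = min ((Expr.bool test).eval w s2) N := by
    have h4 : search.exec w N s = (Cmd.seq P (assign .ans (Expr.bool test))).exec w N
        ((s.setV .M1 (min (M + 1) N)).setV .n1
          (min ((s.setV .M1 (min (M + 1) N)).v .n + 1) N)) := rfl
    rw [h4, Store.setV_v, if_neg (by simp), min_eq_left hM, min_eq_left hs.n_le]
    simp only [Cmd.exec, Store.setV_v]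
    rfl
  refine ⟨list s2, hstable, h1, h2, fun h => ?_, fun h => ?_⟩
  · rw [hans, Expr.eval_bool, if_pos (htest'.2 h)]
    omega
  · rw [hans, Expr.eval_bool, if_neg (htest'.not.2 h)]
    omega

end Filtering

/-! ### The initial tables -/

theorem not_dotRel_zero {x y : ℕ} : ¬ DotRel 0 x y := fun h => by simp [DotRel, dotBit] at h

/-- The four quadrants of the table of inner products: a new leading digit changes the inner product
if and only if it is `1` in both labels. -/
theorem dotRel_succ {t x y : ℕ} (hx : x < 2 ^ t) (hy : y < 2 ^ t) :
    (DotRel (t + 1) x y ↔ DotRel t x y) ∧ (DotRel (t + 1) (x + 2 ^ t) y ↔ DotRel t x y) ∧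
    (DotRel (t + 1) x (y + 2 ^ t) ↔ DotRel t x y) ∧
    (DotRel (t + 1) (x + 2 ^ t) (y + 2 ^ t) ↔ ¬ DotRel t x y) := by
  have hlow : ∀ i ≤ t, ∀ x y, dotBit i (2 ^ t + x) y = dotBit i x y := by
    intro i
    induction i with
    | zero => exact fun _ _ _ => rfl
    | succ i ih =>
      intro hi x y
      rw [dotBit, dotBit, ih (by omega), Nat.testBit_two_pow_add_gt (by omega)]
  have hlow' : ∀ x y, dotBit t x (2 ^ t + y) = dotBit t x y := fun x y => by
    rw [dotBit_comm, hlow t le_rfl, dotBit_comm]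
  have hxt := Nat.testBit_lt_two_pow hx
  have hyt := Nat.testBit_lt_two_pow hy
  have hpow : 2 ^ (t + 1) = 2 ^ t + 2 ^ t := by ring
  have h1 : x < 2 ^ (t + 1) := by omega
  have h2 : y < 2 ^ (t + 1) := by omega
  have h3 : 2 ^ t + x < 2 ^ (t + 1) := by omega
  have h4 : 2 ^ t + y < 2 ^ (t + 1) := by omega
  simp [DotRel, dotBit, hlow t le_rfl, hlow', Nat.testBit_two_pow_add_eq, hxt, hyt, hx, hy,
    Nat.add_comm _ (2 ^ t), h1, h2, h3, h4]

theorem DotRel.lt_of_succ {t i j : ℕ} (h : DotRel (t + 1) i j) :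
    i < 2 ^ t + 2 ^ t ∧ j < 2 ^ t + 2 ^ t := by
  have hpow : 2 ^ (t + 1) = 2 ^ t + 2 ^ t := by ring
  exact ⟨hpow ▸ h.1, hpow ▸ h.2.1⟩

/-- The table after the quadrants belonging to the cells `(x, y)` with `P x y` are filled. -/
def DotTable (t : ℕ) (P : ℕ → ℕ → Prop) (m : ℕ → ℕ → ℕ) : Prop :=
  ∀ i j, m i j ≠ 0 ↔ DotRel (t + 1) i j ∧ ((i < 2 ^ t ∧ j < 2 ^ t) ∨
    P (if i < 2 ^ t then i else i - 2 ^ t) (if j < 2 ^ t then j else j - 2 ^ t))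

theorem DotTable.start {t : ℕ} {m : ℕ → ℕ → ℕ} (h : ∀ i j, m i j ≠ 0 ↔ DotRel t i j) :
    DotTable t (fun _ _ => False) m := by
  intro i j
  rw [h, or_false]
  by_cases hij : i < 2 ^ t ∧ j < 2 ^ t
  · rw [(dotRel_succ hij.1 hij.2).1]
    exact (and_iff_left hij).symm
  · exact ⟨fun h => absurd ⟨h.1, h.2.1⟩ hij, fun h => absurd h.2 hij⟩

theorem DotTable.congr {t : ℕ} {P P' : ℕ → ℕ → Prop} {m : ℕ → ℕ → ℕ} (h : DotTable t P m)
    (hP : ∀ x < 2 ^ t, ∀ y < 2 ^ t, P x y ↔ P' x y) : DotTable t P' m := by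
  intro i j
  rw [h i j]
  refine and_congr_right fun hd => or_congr_right ?_
  have := DotRel.lt_of_succ hd
  refine hP _ ?_ _ ?_ <;> split_ifs <;> omega

/-- The step of `dotCells`. -/
theorem DotTable.step {t x y : ℕ} {P : ℕ → ℕ → Prop} {m m' : ℕ → ℕ → ℕ} (h : DotTable t P m)
    (hx : x < 2 ^ t) (hy : y < 2 ^ t)
    (h10 : m' (x + 2 ^ t) y ≠ 0 ↔ m x y ≠ 0) (h01 : m' x (y + 2 ^ t) ≠ 0 ↔ m x y ≠ 0)
    (h11 : m' (x + 2 ^ t) (y + 2 ^ t) ≠ 0 ↔ ¬ m x y ≠ 0)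
    (hm : ∀ i j, ¬ (i = x + 2 ^ t ∧ j = y) → ¬ (i = x ∧ j = y + 2 ^ t) →
      ¬ (i = x + 2 ^ t ∧ j = y + 2 ^ t) → m' i j = m i j) :
    DotTable t (fun a b => P a b ∨ (a = x ∧ b = y)) m' := by
  obtain ⟨q00, q10, q01, q11⟩ := dotRel_succ hx hy
  have hxy : m x y ≠ 0 ↔ DotRel t x y := by
    rw [h x y, ← q00]; simp [hx, hy]
  intro i j
  have hl : ∀ a, ¬ a + 2 ^ t < 2 ^ t := fun a => by omega
  by_cases c1 : i = x + 2 ^ t ∧ j = y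
  · rw [c1.1, c1.2, h10, hxy, q10, if_neg (hl x), if_pos hy, Nat.add_sub_cancel]
    exact (and_iff_left (Or.inr (Or.inr ⟨rfl, rfl⟩))).symm
  by_cases c2 : i = x ∧ j = y + 2 ^ t
  · rw [c2.1, c2.2, h01, hxy, q01, if_neg (hl y), if_pos hx, Nat.add_sub_cancel]
    exact (and_iff_left (Or.inr (Or.inr ⟨rfl, rfl⟩))).symm
  by_cases c3 : i = x + 2 ^ t ∧ j = y + 2 ^ t
  · rw [c3.1, c3.2, h11, hxy, q11, if_neg (hl x), if_neg (hl y), Nat.add_sub_cancel,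
      Nat.add_sub_cancel]
    exact (and_iff_left (Or.inr (Or.inr ⟨rfl, rfl⟩))).symm
  rw [hm i j c1 c2 c3, h i j]
  have hnew : ¬ (i < 2 ^ t ∧ j < 2 ^ t) → ¬ ((if i < 2 ^ t then i else i - 2 ^ t) = x ∧
      (if j < 2 ^ t then j else j - 2 ^ t) = y) := by
    intro h1
    split_ifs <;> omega
  refine and_congr_right fun hd => ⟨fun h1 => h1.imp_right Or.inl, fun h1 => ?_⟩
  rcases h1 with h1 | h1 | h1
  · exact Or.inl h1
  · exact Or.inr h1
  · by_contra h2
    exact hnew (fun h3 => h2 (Or.inl h3)) h1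

theorem DotTable.finish {t : ℕ} {m : ℕ → ℕ → ℕ} (h : DotTable t (fun _ _ => True) m) (i j : ℕ) :
    m i j ≠ 0 ↔ DotRel (t + 1) i j := by
  rw [h i j]; simp

theorem exec_initDot {s : S} (hs : s.Bounded N) (hN : 2 ^ s.v .k ≤ N)
    (h0 : ∀ i j, s.m .dot i j = 0) :
    (initDot.exec w N s).v .M = 2 ^ s.v .k ∧
      ∀ x y, storedDot (initDot.exec w N s) x y ↔ DotRel (s.v .k) x y := by
  have hN1 : 1 ≤ N := Nat.one_le_two_pow.trans hN
  set s1 : S := s.setV .M 1 with hs1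
  have hb1 : s1.Bounded N := hs.setV _ hN1
  have h1 : (assign .M (const 1) : C).exec w N s = s1 := by
    simp only [Cmd.exec, Expr.eval, min_eq_left hN1, hs1]
  have hk : s1.v .k = s.v .k := by simp [hs1]
  have h2 : initDot.exec w N s = (loop .t .k dotDouble).exec w N s1 := by
    rw [← h1]; rfl
  rw [h2, ← hk]
  refine Cmd.loop_rule (w := w) (x := .t) (y := .k) (p := dotDouble) hb1
    (fun t a => a.v .M = 2 ^ t ∧ ∀ x y, storedDot a x y ↔ DotRel t x y) ?_ ?_
  · refine ⟨by simp [hs1], fun x y => ?_⟩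
    simp [storedDot, hs1, h0, not_dotRel_zero]
  · rintro t a ht hba hva hma ⟨hM, hd⟩
    have htN : 2 ^ (t + 1) ≤ N := (Nat.pow_le_pow_right (by omega) (by omega)).trans hN
    have hpow : 2 ^ (t + 1) = 2 ^ t + 2 ^ t := by ring
    set a1 : S := a.setV .t t with ha1
    have hba1 : a1.Bounded N := hba.setV _ (ht.le.trans (hb1.v_le _))
    have hM1 : a1.v .M = 2 ^ t := by simpa [ha1] using hM
    have hrow : DotTable t (fun x _ => x < 2 ^ t)
        (((loop .x .M (loop .y .M dotCells)).exec w N a1).m .dot) := by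
      rw [← hM1]
      refine Cmd.loop_rule (w := w) (x := .x) (y := .M) (p := loop .y .M dotCells) hba1
        (fun x b => DotTable t (fun x' _ => x' < x) (b.m .dot)) ?_ ?_
      · exact (DotTable.start hd).congr (by simp)
      · intro x b hx hbb hvb _ hb
        have hMb : (b.setV .x x).v .M = 2 ^ t := by
          rw [Store.setV_v, if_neg (by simp), hvb _ (by simp [Cmd.varWrites, dotCells]), hM1]
        have hbx : (b.setV .x x).Bounded N := hbb.setV _ (hx.le.trans (hba1.v_le _))
        refine DotTable.congr (P := fun x' y' => x' < x ∨ x' = x ∧ y' < (b.setV .x x).v .M) ?_ ?_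
        swap
        · intro x' _ y' hy'
          rw [hMb]
          omega
        refine Cmd.loop_rule (w := w) (x := .y) (y := .M) (p := dotCells) hbx
          (fun y c => DotTable t (fun x' y' => x' < x ∨ x' = x ∧ y' < y) (c.m .dot)) ?_ ?_
        · exact hb.congr (by simp)
        · intro y c hy hbc hvc _ hc
          have hMc : c.v .M = 2 ^ t := by rw [hvc _ (by simp [Cmd.varWrites, dotCells]), hMb]
          have hxc : c.v .x = x := by rw [hvc _ (by simp [Cmd.varWrites, dotCells])]; simp
          have hc1 : ∀ i j, c.m .dot i j ≤ N := hbc.m_le _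
          have hx' : x < 2 ^ t := hM1 ▸ hx
          have hy' : y < 2 ^ t := hMb ▸ hy
          refine DotTable.congr (DotTable.step (x := x) (y := y) hc hx' hy' ?_ ?_ ?_ ?_) ?_
          · simp [dotCells, Cmd.exec, Expr.eval, Store.setM_m, Store.setM_v, hMc, hxc]
            omega
          · simp [dotCells, Cmd.exec, Expr.eval, Store.setM_m, Store.setM_v, hMc, hxc]
            omega
          · simp [dotCells, Cmd.exec, Expr.eval, Store.setM_m, Store.setM_v, hMc, hxc, Expr.not]
            omega
          · intro i j c1 c2 c3
            simp [dotCells, Cmd.exec, Expr.eval, Store.setM_m, Store.setM_v, hMc, hxc, c1, c2, c3]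
          · intro x' _ y' _
            omega
    set a2 := (loop .x .M (loop .y .M dotCells)).exec w N a1 with ha2
    have hM2 : a2.v .M = 2 ^ t := by
      rw [ha2, Cmd.exec_v _ _ _ (by simp [Cmd.varWrites, dotCells]), hM1]
    refine ⟨?_, fun x y => DotTable.finish (hrow.congr fun x hx y _ => by simp [hx]) x y⟩
    change (a2.setV .M (min (a2.v .M + a2.v .M) N)).v .M = _
    rw [hM2]
    simp
    omega

theorem exec_initLists {s : S} (hs : s.Bounded N) (hN : 1 ≤ N)
    (h0 : ∀ i j, s.m .L i j = 0) (v z : ℕ) :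
    (initLists.exec w N s).m .L v z ≠ 0 ↔ v < s.v .n ∧ z < s.v .M := by
  have := Cmd.loop_rule (w := w) (x := .x) (y := .n)
    (p := loop .y .M (put .L (var .x) (var .y) (const 1))) hs
    (fun x t => ∀ v z, t.m .L v z ≠ 0 ↔ v < x ∧ z < s.v .M) (by simp [h0]) ?_
  · exact this v z
  · intro x t hx hb hv _ ht v z
    have hbx : (t.setV .x x).Bounded N := hb.setV _ (hx.le.trans (hs.v_le _))
    rw [Cmd.exec_loop_put hbx x (fun _ => 1) (fun _ _ => hN)
      (fun i _ t' h1 _ _ _ => ⟨by simp [Expr.eval, h1], rfl⟩)]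
    have hM : (t.setV .x x).v .M = s.v .M := by simp [hv, Cmd.varWrites]
    rw [hM]
    have := ht v z
    rw [Store.setV_m]
    split_ifs with h
    · simp only [ne_eq, one_ne_zero, not_false_eq_true, true_iff]; omega
    · rw [this]; omega

theorem exec_initArcs {s : S} (hs : s.Bounded N) (hN : 1 ≤ N) (h0 : ∀ i j, s.m .T i j = 0)
    (u v : ℕ) : (initArcs.exec w N s).m .T u v ≠ 0 ↔
      u < s.v .n ∧ v < s.v .n ∧ w.getD (2 + (u * s.v .n + v)) 0 ≠ 0 := by
  set g : E := .inp (.add (const 2) (.add (.sum .x .x (var .n)) (var .y))) with hg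
  have := Cmd.loop_rule (w := w) (x := .x) (y := .n)
    (p := loop .y .n (put .T (var .x) (var .y) g)) hs
    (fun x t => ∀ u v, t.m .T u v ≠ 0 ↔
      u < x ∧ v < s.v .n ∧ w.getD (2 + (u * s.v .n + v)) 0 ≠ 0) (by simp [h0]) ?_
  · exact this u v
  · intro x t hx hb hv _ ht u v
    have hbx : (t.setV .x x).Bounded N := hb.setV _ (hx.le.trans (hs.v_le _))
    have hn : (t.setV .x x).v .n = s.v .n := by simp [hv, Cmd.varWrites]
    rw [Cmd.exec_loop_put hbx x
      (fun y => if w.getD (2 + (x * s.v .n + y)) 0 = 0 then 0 else 1)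
      (fun _ _ => by split_ifs <;> omega)
      (fun i _ t' h1 _ _ hi => ⟨by simp [Expr.eval, h1], by
        have hx' : t'.v .x = x := by simp [h1]
        have hn' : t'.v .n = s.v .n := by rw [h1 _ (by simp), hn]
        simp [hg, Expr.eval, hi, hx', hn', -List.getD_eq_getElem?_getD]⟩)]
    rw [hn, Store.setV_m]
    have := ht u v
    split_ifs with h h'
    · obtain ⟨rfl, h⟩ := h
      simp [h, h', -List.getD_eq_getElem?_getD]
    · obtain ⟨rfl, h⟩ := h
      simp [h, h', -List.getD_eq_getElem?_getD]
    · rw [this]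
      constructor
      · rintro ⟨h1, h2⟩; exact ⟨by omega, h2⟩
      · rintro ⟨h1, h2, h3⟩; exact ⟨by omega, h2, h3⟩

/-! ### Correctness of the program -/

/-- The entries of a matrix that is written row by row. -/
theorem getD_flatMap {A B : Type} {g : A → List B} {n : ℕ} (hg : ∀ a, (g a).length = n) (c : B)
    (l : List A) {i j : ℕ} (hi : i < l.length) (hj : j < n) :
    (l.flatMap g).getD (i * n + j) c = (g l[i]).getD j c := by
  induction l generalizing i with
  | nil => simp at hi
  | cons a l ih =>
    rw [List.flatMap_cons]
    cases i with
    | zero =>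
      rw [Nat.zero_mul, Nat.zero_add, List.getD_append _ _ _ _ (by rwa [hg])]
      rfl
    | succ i =>
      rw [List.getD_append_right _ _ _ _ (by rw [hg, Nat.succ_mul]; omega), hg,
        show (i + 1) * n + j - n = i * n + j by rw [Nat.succ_mul]; omega,
        ih (by simpa using hi)]
      rfl

theorem getD_encode (I : InversionInstance) (u v : Fin I.n) :
    (kInversion.encode I).getD (2 + (u * I.n + v)) 0 = I.D.mult u v := by
  have h := getD_flatMap (g := fun u => (List.finRange I.n).map fun v => I.D.mult u v) (n := I.n)
    (by simp) 0 (List.finRange I.n) (i := u) (j := v) (by simp) v.2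
  rw [Nat.add_comm 2]
  refine Eq.trans (h : _) ?_
  simp

theorem length_encode (I : InversionInstance) :
    (kInversion.encode I).length = I.n * I.n + 2 := by
  simp [kInversion, List.length_flatMap]

theorem holds_twoCycle (s : S) : twoCycle.Holds w s ↔
    ∃ x < s.v .n, ∃ y < s.v .n, arc s x y ∧ arc s y x := by
  simp only [twoCycle, Expr.holds_ex, Expr.holds_and, Store.setV_v]
  rfl

/-- The program decides the problem, if the bound `N` is large enough to avoid truncation. -/
theorem exec_main (I : InversionInstance) (hG : I.D.underlying.IsBlockGraph) {s : S}
    (hs : s.Bounded N) (hn : s.v .n = I.n) (hk : s.v .k = I.k) (h0 : ∀ a i j, s.m a i j = 0)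
    (hnN : I.n + 1 ≤ N) (hMN : 2 ^ I.k + 1 ≤ N) (hN : repBound (2 ^ I.k) + 1 ≤ N) :
    (I.D.InvLE I.k → (main.exec (kInversion.encode I) N s).v .ans = 1) ∧
      (¬ I.D.InvLE I.k → (main.exec (kInversion.encode I) N s).v .ans = 0) := by
  classical
  set w := kInversion.encode I with hw
  set s1 := initDot.exec w N s with hs1
  set s2 := initArcs.exec w N s1 with hs2
  set s3 := initLists.exec w N s2 with hs3
  have hb1 : s1.Bounded N := Cmd.exec_bounded _ hs
  have hb2 : s2.Bounded N := Cmd.exec_bounded _ hb1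
  have hb3 : s3.Bounded N := Cmd.exec_bounded _ hb2
  obtain ⟨hM1, hd1⟩ := exec_initDot (w := w) hs (by rw [hk]; omega) (h0 .dot)
  rw [← hs1, hk] at hM1 hd1
  have hn1 : s1.v .n = I.n := by
    rw [hs1, Cmd.exec_v _ _ _ (by simp [initDot, dotDouble, dotCells, Cmd.varWrites]), hn]
  have hn2 : s2.v .n = I.n := by
    rw [hs2, Cmd.exec_v _ _ _ (by simp [initArcs, Cmd.varWrites]), hn1]
  have hn3 : s3.v .n = I.n := by
    rw [hs3, Cmd.exec_v _ _ _ (by simp [initLists, Cmd.varWrites]), hn2]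
  have hM2 : s2.v .M = 2 ^ I.k := by
    rw [hs2, Cmd.exec_v _ _ _ (by simp [initArcs, Cmd.varWrites]), hM1]
  have hM3 : s3.v .M = 2 ^ I.k := by
    rw [hs3, Cmd.exec_v _ _ _ (by simp [initLists, Cmd.varWrites]), hM2]
  have harr : ∀ a, a ≠ Arr.dot → ∀ i j, s1.m a i j = 0 := fun a ha i j => by
    rw [hs1, Cmd.exec_m _ _ _ (by simpa [initDot, dotDouble, dotCells, Cmd.arrWrites] using ha), h0]
  have hd3 : storedDot s3 = DotRel I.k := by
    have : s3.m .dot = s1.m .dot := by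
      rw [hs3, Cmd.exec_m _ _ _ (by simp [initLists, Cmd.arrWrites]), hs2,
        Cmd.exec_m _ _ _ (by simp [initArcs, Cmd.arrWrites])]
    funext x y
    refine propext (Iff.trans ?_ (hd1 x y))
    rw [storedDot, storedDot, this]
  have hL3 : ∀ v z, list s3 v z ↔ v < I.n ∧ z < 2 ^ I.k := by
    intro v z
    have := exec_initLists (w := w) hb2 (by omega) (fun i j => by
      rw [hs2, Cmd.exec_m _ _ _ (by simp [initArcs, Cmd.arrWrites]), harr _ (by simp)]) v z
    rw [list, this, hn2, hM2, hM3]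
    tauto
  have harc : ∀ u v, arc s3 u v ↔ ∃ (hu : u < I.n) (hv : v < I.n), I.D.Arc ⟨u, hu⟩ ⟨v, hv⟩ := by
    intro u v
    have := exec_initArcs (w := w) hb1 (by omega) (harr .T (by simp)) u v
    rw [hn1] at this
    rw [arc, hs3, Cmd.exec_m _ _ _ (by simp [initLists, Cmd.arrWrites]), this]
    constructor
    · rintro ⟨hu, hv, h⟩
      rw [hw, getD_encode I ⟨u, hu⟩ ⟨v, hv⟩] at h
      exact ⟨hu, hv, Nat.pos_of_ne_zero h⟩
    · rintro ⟨hu, hv, h⟩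
      refine ⟨hu, hv, ?_⟩
      rw [hw, getD_encode I ⟨u, hu⟩ ⟨v, hv⟩]
      exact h.ne'
  have harc' : I.D.Arc = fun a b : Fin I.n => arc s3 a b := by
    funext a b
    exact propext ⟨fun h => (harc _ _).2 ⟨a.2, b.2, h⟩, fun h => ((harc _ _).1 h).2.2⟩
  have hadj : ∀ a b : Fin I.n, I.D.underlying.Adj a b ↔ a ≠ b ∧ (arc s3 a b ∨ arc s3 b a) := by
    intro a b
    rw [DirGraph.underlying, SimpleGraph.fromRel_adj, harc']
  have hmain : main.exec w N s = if twoCycle.Holds w s3 then s3.setV .ans (min 0 N)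
      else search.exec w N s3 := by
    by_cases h : twoCycle.Holds w s3
    · rw [if_pos h]; exact if_pos h
    · rw [if_neg h]; exact if_neg h
  rw [hmain, I.D.invLE_iff_exists_goodOn hG]
  by_cases h2 : twoCycle.Holds w s3
  · rw [if_pos h2]
    refine ⟨fun h => ?_, fun _ => by simp⟩
    obtain ⟨x, -, y, -, hxy, hyx⟩ := (holds_twoCycle s3).1 h2
    obtain ⟨_, _, hxy⟩ := (harc _ _).1 hxy
    exact absurd ⟨hxy, ((harc _ _).1 hyx).2.2⟩ (h.1 _ _)
  rw [if_neg h2]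
  have h2' : ∀ u v, ¬ (arc s3 u v ∧ arc s3 v u) := by
    rintro u v ⟨huv, hvu⟩
    have hu := (harc _ _).1 huv
    exact h2 ((holds_twoCycle s3).2 ⟨u, hn3 ▸ hu.1, v, hn3 ▸ hu.2.1, huv, hvu⟩)
  have hirr : ∀ v, ¬ arc s3 v v := fun v h => h2' v v ⟨h, h⟩
  have hadj' : ∀ a b : Fin I.n, arc s3 a b ∨ arc s3 b a → I.D.underlying.Adj a b := by
    intro a b h
    refine (hadj a b).2 ⟨?_, h⟩
    rintro rfl
    exact hirr _ (h.elim id id)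
  have hblock : ∀ (u p a : Fin I.n), (a : ℕ) ∈ blockSet (arc s3) I.n u p ↔
      a ∈ I.D.underlying.edgeBlock u p := by
    intro u p a
    have hiff : ∀ b : Fin I.n, arc s3 a b ∨ arc s3 b a ↔ I.D.underlying.Adj a b :=
      fun b => ⟨hadj' a b, fun h => ((hadj a b).1 h).2⟩
    simp only [blockSet, SimpleGraph.edgeBlock, Set.mem_ofPred_eq, hiff, Fin.val_inj, a.2, true_and]
  have hready : Ready N s3 := by
    refine ⟨hb3, hirr, ?_, ?_, by rw [hM3]; positivity, by rwa [hM3], by rwa [hn3]⟩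
    · rw [hn3]
      intro u hu p hp hup a ha b hb hab
      have ha' := (hblock ⟨u, hu⟩ ⟨p, hp⟩ ⟨a, ha.1⟩).1 ha
      have hb' := (hblock ⟨u, hu⟩ ⟨p, hp⟩ ⟨b, hb.1⟩).1 hb
      have := hG.isClique_edgeBlock (hadj' ⟨u, hu⟩ ⟨p, hp⟩ hup) ha' hb' (by simpa using hab)
      have h3 := ((hadj _ _).1 this).2
      have h4 := h2' a b
      tauto
    · rw [hd3]
      exact fun x y => DotRel.symm
  obtain ⟨L, hst, hle, hsound, hyes, hno⟩ := exec_search (w := w) hready (by rwa [hM3])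
    (fun v z h => hn3 ▸ ((hL3 v z).1 h).1)
  rw [hn3] at hst hsound hyes hno
  rw [hd3] at hst hsound
  constructor
  · rintro ⟨-, y, hy⟩
    refine hyes ?_
    obtain ⟨y', hval⟩ : ∃ y' : ℕ → ℕ, ∀ a : Fin I.n, y' a = y a :=
      ⟨fun v => if h : v < I.n then y ⟨v, h⟩ else 0, fun a => by simp⟩
    have hR : ∀ a b : Fin I.n, Reorient (arc s3) (DotRel I.k) y' a b ↔
        Reorient I.D.Arc (DotRel I.k) y a b := by
      intro a b
      rw [Reorient, hval, hval, harc', Reorient]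
    have hgood : GoodOn (arc s3) (DotRel I.k) (list s3) (Set.Iio I.n) y' := by
      refine ⟨fun v hv => (hL3 _ _).2 ⟨hv, ?_⟩, fun a ha b hb c hc => ?_⟩
      · exact hval ⟨v, hv⟩ ▸ hy.mem _ trivial
      · have := hy.no_triangle ⟨a, ha⟩ trivial ⟨b, hb⟩ trivial ⟨c, hc⟩ trivial
        rwa [← hR, ← hR, ← hR] at this
    exact fun v hv => ⟨_, (hsound _ hgood).mem v hv⟩
  · intro hno'
    refine hno fun hne => hno' ⟨fun u v h => ?_, ?_⟩
    · rw [harc'] at h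
      exact h2' u v h
    · have hmem : ∀ u p, I.D.underlying.Adj u p → ∀ z, L p z → ∃ y,
          GoodOn I.D.Arc (DotRel I.k) (fun v => L v) (I.D.underlying.edgeBlock u p) y ∧
            y p = z := by
        intro u p hup z hz
        have hfil := hst p p.2 u u.2 ((hadj u p).1 hup).2
        have hz' : filtered (arc s3) (DotRel I.k) I.n u p L p z := by rwa [hfil]
        rw [filtered, if_pos rfl] at hz'
        obtain ⟨y, hy, hyz⟩ := hz'
        refine ⟨fun a => y a, ⟨fun v hv => hy.mem _ ((hblock u p v).2 hv), ?_⟩, hyz⟩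
        intro a ha b hb c hc
        have := hy.no_triangle a ((hblock u p a).2 ha) b ((hblock u p b).2 hb) c
          ((hblock u p c).2 hc)
        rw [harc']
        exact this
      obtain ⟨y, hy⟩ := exists_goodOn_univ hG (T := I.D.Arc) (d := DotRel I.k)
        (L := fun v : Fin I.n => L v) (fun a b h => hadj' a b (Or.inl (by rwa [harc'] at h)))
        (fun v => hne v v.2) hmem
      exact ⟨y, ⟨fun v hv => ((hL3 _ _).1 (hle _ _ (hy.mem v hv))).2, hy.no_triangle⟩⟩

/-! ### The bound and the running time -/

/-- The part of the bound `N` that depends on the parameter `k`: it exceeds the number `2 ^ k` of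
labels and the number of representatives. It is a power of a power of two, since the machine
computes it by doubling. -/
def bigBound (k : ℕ) : ℕ := 2 ^ 2 ^ (4 * k + 5)

theorem repBound_le_bigBound (k : ℕ) : repBound (2 ^ k) + 1 ≤ bigBound k := by
  have h1 : repBound (2 ^ k) = 2 ^ (k + 2 ^ (4 * k + 4)) := by
    rw [repBound, pow_add 2 k]
    congr 2
    ring
  rw [h1, bigBound]
  refine Nat.pow_lt_pow_right (by omega) ?_
  have h2 : 2 ^ (4 * k + 5) = 2 ^ (4 * k + 4) + 2 ^ (4 * k + 4) := by ring
  have h3 : 4 * k + 4 < 2 ^ (4 * k + 4) := Nat.lt_two_pow_self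
  omega

theorem le_bigBound (k : ℕ) : 2 ^ (4 * k + 5) + 1 ≤ bigBound k := Nat.lt_two_pow_self

theorem two_pow_le_bigBound (k : ℕ) : 2 ^ k + 1 ≤ bigBound k := by
  have h : 2 ^ k ≤ 2 ^ (4 * k + 5) := Nat.pow_le_pow_right (by omega) (by omega)
  have := le_bigBound k
  omega

theorem primrec_bigBound : Primrec bigBound := by
  have hpow : Primrec₂ fun a b : ℕ => a ^ b := Primrec₂.unpaired'.1 Nat.Primrec.pow
  have hlin : Primrec fun k : ℕ => 4 * k + 5 :=
    Primrec.nat_add.comp (Primrec.nat_mul.comp (.const 4) .id) (.const 5)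
  exact hpow.comp (.const 2) (hpow.comp (.const 2) hlin)

/-- The program that reads the number of vertices and the parameter, and computes the bound. -/
def prelude : RamProg :=
  .seq (.const 3 1) <|
  .seq (.load (4 + 2 * Var.n.ctorIdx) 2) <|
  .seq (.load (4 + 2 * Var.k.ctorIdx) 3) <|
  .seq (.add 5 (4 + 2 * Var.k.ctorIdx) (4 + 2 * Var.k.ctorIdx)) <|
  .seq (.add 5 5 5) <|
  .seq (.const 7 5) <|
  .seq (.add 5 5 7) <|
  .seq (.const 7 1) <|
  .seq (.double 5 7) <|
  .seq (.const 9 1) <|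
  .seq (.double 7 9) <|
  .add 1 0 9

/-- The store in which the program starts. -/
def start (I : InversionInstance) : S where
  v x := if x = .n then I.n else if x = .k then I.k else 0
  m _ _ _ := 0

open RamProg in
/-- After the prelude, the machine represents the initial store; the time is linear in the bound, as
the loops double a register. -/
theorem haltsIn_prelude (I : InversionInstance) : ∃ s',
    prelude.HaltsIn (RamState.initial (kInversion.encode I)) (20 * bigBound I.k) s' ∧
      Represents Var.ctorIdx Arr.ctorIdx (kInversion.encode I)
        ((kInversion.encode I).length + bigBound I.k) (start I) s' := by
  set w := kInversion.encode I with hw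
  set s0 := RamState.initial w with hs0
  have hm0 : s0.mem 0 = I.n := rfl
  have hm1 : s0.mem 1 = I.k := rfl
  have hr0 : ∀ r, s0.reg r = if r = 0 then w.length else 0 := fun _ => rfl
  have hn : 4 + 2 * Var.n.ctorIdx = 4 := rfl
  have hk : 4 + 2 * Var.k.ctorIdx = 6 := rfl
  have r1 := haltsIn_const 3 1 s0
  set s1 := s0.setReg 3 1 with hs1
  have r2 := haltsIn_load 4 2 s1
  have e2 : s1.mem (s1.reg 2) = I.n := by simp [hs1, setReg_reg, hr0, hm0]
  rw [e2] at r2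
  set s2 := s1.setReg 4 I.n with hs2
  have r3 := haltsIn_load 6 3 s2
  have e3 : s2.mem (s2.reg 3) = I.k := by simp [hs2, hs1, setReg_reg, hm1]
  rw [e3] at r3
  set s3 := s2.setReg 6 I.k with hs3
  have r4 := haltsIn_add 5 6 6 s3
  set s4 := s3.setReg 5 (s3.reg 6 + s3.reg 6) with hs4
  have r5 := haltsIn_add 5 5 5 s4
  set s5 := s4.setReg 5 (s4.reg 5 + s4.reg 5) with hs5
  have r6 := haltsIn_const 7 5 s5
  set s6 := s5.setReg 7 5 with hs6
  have r7 := haltsIn_add 5 5 7 s6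
  set s7 := s6.setReg 5 (s6.reg 5 + s6.reg 7) with hs7
  have r8 := haltsIn_const 7 1 s7
  set s8 := s7.setReg 7 1 with hs8
  have h8 : ∀ r, s8.reg r = if r = 7 then 1 else if r = 5 then 4 * I.k + 5 else
      if r = 6 then I.k else if r = 4 then I.n else if r = 3 then 1 else s0.reg r := by
    intro r
    simp only [hs8, hs7, hs6, hs5, hs4, hs3, hs2, hs1, setReg_reg]
    split_ifs
    all_goals simp_all
    omega
  obtain ⟨s9, r9, v9, m9, f9⟩ := haltsIn_double (x := 5) (y := 7) (n := 4 * I.k + 5) (c := 1)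
    (by omega) (by omega) (by omega) s8 (by simp [h8]) (by simp [h8]) (by simp [h8])
  rw [one_mul] at v9
  have r10 := haltsIn_const 9 1 s9
  set s10 := s9.setReg 9 1 with hs10
  obtain ⟨s11, r11, v11, m11, f11⟩ := haltsIn_double (x := 7) (y := 9) (n := 2 ^ (4 * I.k + 5))
    (c := 1) (by omega) (by omega) (by omega) s10
    (by rw [hs10, setReg_reg_of_ne _ _ (by omega), f9 _ (by omega) (by omega)]; simp [h8])
    (by rw [hs10, setReg_reg_of_ne _ _ (by omega), v9]) (setReg_reg_self _ _ _)
  rw [one_mul] at v11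
  have hlow : ∀ r, r ≠ 5 → r ≠ 7 → r ≠ 9 → s11.reg r = s8.reg r := by
    intro r h5 h7 h9
    rw [f11 r h7 h9, hs10, setReg_reg_of_ne _ _ h9, f9 r h5 h7]
  have r12 := haltsIn_add 1 0 9 s11
  rw [v11, hlow 0 (by omega) (by omega) (by omega)] at r12
  have hlow' : ∀ r, r ≠ 5 → r ≠ 7 → r ≠ 9 → r ≠ 1 →
      (s11.setReg 1 (s8.reg 0 + 2 ^ 2 ^ (4 * I.k + 5))).reg r = s8.reg r := by
    intro r h5 h7 h9 h1
    rw [setReg_reg_of_ne _ _ h1, hlow r h5 h7 h9]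
  have hmem : s11.mem = s0.mem := by
    rw [m11, hs10, setReg_mem, m9]; rfl
  refine ⟨_, HaltsIn.mono (r1.seq (r2.seq (r3.seq (r4.seq (r5.seq (r6.seq (r7.seq (r8.seq
    (r9.seq (r10.seq (r11.seq r12))))))))))) ?_, ?_⟩
  · have h1 := le_bigBound I.k
    have h2 : 4 * I.k + 5 < 2 ^ (4 * I.k + 5) := Nat.lt_two_pow_self
    omega
  · constructor
    · rw [hlow' 0 (by omega) (by omega) (by omega) (by omega), h8]; simp [hr0]
    · rw [setReg_reg_self, h8]; simp [hr0, bigBound]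
    · rw [hlow' 2 (by omega) (by omega) (by omega) (by omega), h8]; simp [hr0]
    · rw [hlow' 3 (by omega) (by omega) (by omega) (by omega), h8]; simp
    · intro x
      rw [hlow' _ (by omega) (by omega) (by omega) (by omega), h8]
      have h4 : 4 + 2 * x.ctorIdx = 4 ↔ x = .n := by cases x <;> decide
      have h6 : 4 + 2 * x.ctorIdx = 6 ↔ x = .k := by cases x <;> decide
      have e : ∀ c, c % 2 = 1 ∨ c = 0 → (4 + 2 * x.ctorIdx = c ↔ False) := fun c hc =>
        iff_false_intro (by omega)
      simp only [h4, h6, hr0, start, e 7, e 5, e 3, e 0, Nat.reduceMod, true_or, or_true, if_false]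
      rcases eq_or_ne x .n with rfl | hx
      · simp
      · simp [hx]
    · intro i _
      rw [setReg_mem, hmem]; rfl
    · intro a i j
      rw [setReg_mem, hmem]
      exact List.getD_eq_default _ _ (by omega)

/-- The whole machine program, which copies the answer to register `0` in the end. -/
def program : RamProg :=
  .seq prelude (.seq (main.compile Var.ctorIdx Arr.ctorIdx 0) (.add 0 (4 + 2 * Var.ans.ctorIdx) 2))

theorem haltsIn_program (I : InversionInstance) (hG : I.D.underlying.IsBlockGraph) : ∃ s',
    program.HaltsIn (RamState.initial (kInversion.encode I)) (20 * bigBound I.k +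
      (main.time Arr.ctorIdx ((kInversion.encode I).length + bigBound I.k) + 1)) s' ∧
    (I.D.InvLE I.k → s'.reg 0 = 1) ∧ (¬ I.D.InvLE I.k → s'.reg 0 = 0) := by
  obtain ⟨s1, r1, h1⟩ := haltsIn_prelude I
  set w := kInversion.encode I with hw
  set N := w.length + bigBound I.k with hN
  have hlen : w.length = I.n * I.n + 2 := length_encode I
  have hnN : I.n + 1 ≤ N := by
    have : I.n ≤ I.n * I.n := Nat.le_mul_self _
    omega
  have hMN : 2 ^ I.k + 1 ≤ N := (two_pow_le_bigBound I.k).trans (by omega)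
  have hkN : I.k ≤ N := by
    have : I.k < 2 ^ I.k := Nat.lt_two_pow_self
    omega
  have hb : (start I).Bounded N := by
    refine ⟨fun x => ?_, fun _ _ _ => Nat.zero_le _⟩
    simp only [start]
    split_ifs <;> omega
  obtain ⟨s2, r2, h2, -⟩ := main.haltsIn_compile (Function.LeftInverse.injective Var.ofNat_ctorIdx)
    (Function.LeftInverse.injective Arr.ofNat_ctorIdx) 0 h1 hb
  have r3 := RamProg.haltsIn_add 0 (4 + 2 * Var.ans.ctorIdx) 2 s2
  rw [h2.vars, h2.zero, add_zero] at r3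
  obtain ⟨hyes, hno⟩ := exec_main I hG hb rfl rfl (fun _ _ _ => rfl) hnN hMN
    ((repBound_le_bigBound I.k).trans (by omega))
  refine ⟨_, r1.seq (r2.seq r3), fun h => ?_, fun h => ?_⟩
  · rw [RamProg.setReg_reg_self]; exact hyes h
  · rw [RamProg.setReg_reg_self]; exact hno h

/-- The algorithm is fixed-parameter tractable. The exponent is that of the polynomial which bounds
the running time in `N`. -/
theorem fptOn_isBlockGraph :
    kInversion.FPTOn {I : InversionInstance | I.D.underlying.IsBlockGraph} := by
  obtain ⟨K, hK⟩ := main.polyBounded_time Arr.ctorIdx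
  have hpow : Primrec₂ fun a b : ℕ => a ^ b := Primrec₂.unpaired'.1 Nat.Primrec.pow
  refine ⟨program, fun k => (21 + K) * bigBound k ^ (K + 1), K,
    (Primrec.nat_mul.comp (.const _) (hpow.comp primrec_bigBound (.const _))).to_comp,
    fun I hI => ?_⟩
  obtain ⟨s, ⟨t, ht, hrun⟩, hyes, hno⟩ := haltsIn_program I hI
  refine ⟨t, s, hrun, ht.trans ?_, hyes, hno⟩
  change _ ≤ (21 + K) * bigBound I.k ^ (K + 1) * (kInversion.encode I).length ^ K
  have hlen := length_encode I
  set ℓ := (kInversion.encode I).length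
  set W := bigBound I.k
  have hW : 2 ≤ W := by
    have := two_pow_le_bigBound I.k
    have : 0 < 2 ^ I.k := by positivity
    omega
  have hℓ : 2 ≤ ℓ := by omega
  -- the sum is at most the product, which separates the parameter from the length
  have h1 : ℓ + W ≤ ℓ * W := by nlinarith
  have h2 : main.time Arr.ctorIdx (ℓ + W) ≤ K * (ℓ * W) ^ K :=
    (hK _ (by omega)).trans (Nat.mul_le_mul_left _ (Nat.pow_le_pow_left h1 _))
  have h3 : K * (ℓ * W) ^ K ≤ K * (W ^ (K + 1) * ℓ ^ K) := by
    refine Nat.mul_le_mul_left _ ?_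
    rw [mul_pow, mul_comm (ℓ ^ K)]
    exact Nat.mul_le_mul_right _ (Nat.pow_le_pow_right (by omega) (by omega))
  have h4 : W ≤ W ^ (K + 1) * ℓ ^ K :=
    (Nat.le_self_pow (by omega) W).trans (Nat.le_mul_of_pos_right _ (by positivity))
  calc 20 * W + (main.time Arr.ctorIdx (ℓ + W) + 1)
      ≤ 20 * (W ^ (K + 1) * ℓ ^ K) + (K * (W ^ (K + 1) * ℓ ^ K) + W ^ (K + 1) * ℓ ^ K) := by
        have := h2.trans h3
        omega
    _ = (21 + K) * W ^ (K + 1) * ℓ ^ K := by ring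

end Inversion

theorem theorem2 :
    kInversion.FPTOn {I : InversionInstance | I.D.underlying.IsBlockGraph} := by
  exact Inversion.fptOn_isBlockGraph
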